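/- Let $-\infty\le a<b\le\infty$. A nonnegative upper semicontinuous function $w$ on a closed set $\Sigma\subset\mathbb R$ is called admissible if $|x|w(x)\to0$ as $|x|\to\infty$, $x\in\Sigma$ (when $\Sigma$ is unbounded), and $\{x\in\Sigma: w(x)>0\}$ has positive logarithmic capacity. A weight $w=e^{-Q}>0$ on $(a,b)$, extended by $0$ to the closure of $(a,b)$ in $\mathbb R$, is called admissible and approximating if it is admissible on this closure, has finite moments, is twice differentiable with $(\log\frac1w)''\ge0$ on $(a,b)$, and satisfies $\lim_{x\to a+}\frac{w(x)}{x-a}=0$ if $a$ is finite and $\lim_{x\to b-}\frac{w(x)}{b-x}=0$ if $b$ is finite. Let $n\ge2$, let $x_1,\dots,x_n\in(a,b)$ be distinct, $\omega(x)=\prod_{k}(x-x_k)$, $l_k(x)=\frac{\omega(x)}{\omega'(x_k)(x-x_k)}$. For a positive differentiable weight $v$ on $(a,b)$ put: - $C_{k,v}=\frac{\omega''(x_k)}{\omega'(x_k)}+\frac{v'(x_k)}{v(x_k)}$ (Fejér constants); - $\{x_1,\dots,x_n\}$ is an $n$-th Fekete set for a weight $u$ if the supremum of $\Big(\prod_{i<j}|z_i-z_j|u(z_i)u(z_j)\Big)^{\frac{2}{n(n-1)}}$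 over $z_1,\dots,z_n\in(a,b)$ is attained at $(x_1,\dots,x_n)$; - $\{x_1,\dots,x_n\}$ is $1(v)$-normal if $|x_k|<La_n$ for all $k$ with some $L>1$, and $v(x)\sum_{k=1}^n\frac{l_k^2(x)}{v(x_k)}\le1$ for $x\in(a,b)$. Here $a_n=\max(|\alpha|,|\beta|)$ is the Mhaskar–Rakhmanov–Saff number of $v=e^{-R}$, where $a<\alpha<\beta<b$ are determined by $\frac1\pi\int_\alpha^\beta\frac{R'(t)\,dt}{\sqrt{(t-\alpha)(\beta-t)}}=0$ and $\frac1\pi\int_\alpha^\beta\frac{tR'(t)\,dt}{\sqrt{(t-\alpha)(\beta-t)}}=n$ (for even weights $\alpha=-a_n$, $\beta=a_n$); - polynomials $\hat l_1,\dots,\hat l_n$ with $\hat l_k(t_i)=\delta_{ki}$ for some distinct nodes $t_1,\dots,t_n\in(a,b)$ form a $v$-stable interpolatory system if $0\le v(x)\sum_{k}\frac{\hat l_k(x)}{v(t_k)}y_k\le\max_k y_k$ for all $y_1,\dots,y_n\ge0$ and $x\in(a,b)$; a $v$-stable system is most economical if $\sum_k\deg\hat l_k$ is minimal among all $v$-stable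 interpolatory systems of $n$ polynomials; - "$Y_{n,v}=v\sum_k l_k^2/v(x_k)$ is $v$-stable and most economical" means that $l_1^2,\dots,l_n^2$, with nodes $x_1,\dots,x_n$, is such a system. Let $w=e^{-Q}$ be an admissible approximating weight on $(a,b)$, let $p_{m,w}=\gamma_mx^m+\dots$ ($\gamma_m>0$) be its orthonormal polynomials, $\varrho_n=\gamma_{n-1}/\gamma_n$, $A_n(x)=\varrho_n\int_a^bp_{n,w}^2(t)w(t)\frac{Q'(t)-Q'(x)}{t-x}\,dt$ and $w_n=\frac{w\varrho_n}{A_n}$. 1. If $\frac1w$ is $2n$ times differentiable with $\left(\frac1w\right)^{(2n)}\ge0$ on $(a,b)$, then the following are equivalent: (A) $C_{k,w}=0$ for $k=1,\dots,n$; (B) $\{x_1,\dots,x_n\}$ is an $n$-th Fekete set for $w^{\frac1{2(n-1)}}$; (B$^*$) $\{x_1,\dots,x_n\}$ is the unique $n$-th Fekete set for $w^{\frac1{2(n-1)}}$; (D) $Y_{n,w}$ is $w$-stable and most economical; (E) $\{x_1,\dots,x_n\}$ is $1(w)$-normal. 2. If $w_n$ is an admissible approximating weight on $(a,b)$ and $\frac1{w_n}$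 is $2n$ times differentiable with $\left(\frac1{w_n}\right)^{(2n)}\ge0$ on $(a,b)$, then the following are equivalent: (A') $C_{k,w_n}=0$ for $k=1,\dots,n$; (B') $\{x_1,\dots,x_n\}$ is an $n$-th Fekete set for $w_n^{\frac1{2(n-1)}}$; (B'$^*$) $\{x_1,\dots,x_n\}$ is the unique $n$-th Fekete set for $w_n^{\frac1{2(n-1)}}$; (C) $p_{n,w}(x_k)=0$ for $k=1,\dots,n$; (D') $Y_{n,w_n}$ is $w_n$-stable and most economical; (E') $\{x_1,\dots,x_n\}$ is $1(w_n)$-normal. -/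

import Mathlib

open Set Filter Topology MeasureTheory Polynomial
open scoped ENNReal

noncomputable section

namespace FejerFekete

/-! ### Weights -/

/-- The open interval `(a, b)` of the real line; its end points may be infinite. -/
def openInterval (a b : EReal) : Set ℝ := {t : ℝ | a < (t : EReal) ∧ (t : EReal) < b}

/-- The logarithmic energy `∬ log (1 / |x - y|) dμ dμ`, as positive part minus negative part.
The kernel is `+∞` on the diagonal. -/
def logEnergy (μ : Measure ℝ) : EReal :=
  ((∫⁻ x, ∫⁻ y, (if x = y then ⊤ else ENNReal.ofReal (Real.log (1 / |x - y|))) ∂μ ∂μ : ℝ≥0∞) : EReal)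
    - ((∫⁻ x, ∫⁻ y, ENNReal.ofReal (Real.log |x - y|) ∂μ ∂μ : ℝ≥0∞) : EReal)

/-- The logarithmic capacity of `E`: the supremum of `exp (- energy)` over the probability
measures with compact support in `E`. -/
def logCapacity (E : Set ℝ) : ℝ≥0∞ :=
  ⨆ (μ : Measure ℝ) (_ : IsProbabilityMeasure μ ∧ ∃ K ⊆ E, IsCompact K ∧ μ Kᶜ = 0),
    EReal.exp (-(logEnergy μ))

/-- Quasi-admissible weights on a closed set `S` of the real line. -/
structure IsQuasiAdmissible (S : Set ℝ) (w : ℝ → ℝ) : Prop where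
  isClosed : IsClosed S
  nonneg : ∀ t ∈ S, 0 ≤ w t
  usc : UpperSemicontinuousOn w S
  decay : ¬ Bornology.IsBounded S →
    Tendsto (fun t => |t| * w t) (Bornology.cobounded ℝ ⊓ 𝓟 S) (𝓝 0)

/-- Admissible weights on a closed set `S` of the real line. -/
structure IsAdmissible (S : Set ℝ) (w : ℝ → ℝ) : Prop extends IsQuasiAdmissible S w where
  capacity_pos : 0 < logCapacity {t ∈ S | 0 < w t}

/-- Admissible weights that are approximating on `(a, b)`. Only the values of `w` on `(a, b)`
matter: on the closed interval the weight is extended by zero to the finite end points. -/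
structure IsApproximating (a b : EReal) (w : ℝ → ℝ) : Prop where
  admissible : IsAdmissible (closure (openInterval a b)) ((openInterval a b).indicator w)
  pos : ∀ t ∈ openInterval a b, 0 < w t
  finite_moments : ∀ m : ℕ, IntegrableOn (fun t => t ^ m * w t) (openInterval a b)
  differentiable : DifferentiableOn ℝ w (openInterval a b)
  differentiable_deriv : DifferentiableOn ℝ (deriv w) (openInterval a b)
  log_convex : ∀ t ∈ openInterval a b, 0 ≤ deriv (deriv (fun s => Real.log (1 / w s))) t
  left_end : ∀ a' : ℝ, a = (a' : EReal) → Tendsto (fun t => w t / (t - a')) (𝓝[>] a') (𝓝 0)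
  right_end : ∀ b' : ℝ, b = (b' : EReal) → Tendsto (fun t => w t / (b' - t)) (𝓝[<] b') (𝓝 0)

/-- `f` is `N` times differentiable on the (open) set `S` and its `N`-th derivative is
nonnegative there. -/
def HasNonnegDeriv (N : ℕ) (f : ℝ → ℝ) (S : Set ℝ) : Prop :=
  (∀ m < N, DifferentiableOn ℝ (iteratedDeriv m f) S) ∧ ∀ t ∈ S, 0 ≤ iteratedDeriv N f t

/-! ### Fekete sets -/

/-- `(∏_{i<j} |z_i - z_j| w(z_i) w(z_j)) ^ (2 / (n (n - 1)))`. -/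
def feketeFun (n : ℕ) (w : ℝ → ℝ) (z : Fin n → ℝ) : ℝ :=
  (∏ i : Fin n, ∏ j ∈ Finset.Ioi i, |z i - z j| * w (z i) * w (z j))
    ^ (2 / ((n : ℝ) * ((n : ℝ) - 1)))

/-- `{x_1, …, x_n}` is an `n`-th weighted Fekete set: the supremum of `feketeFun` over all
`z_1, …, z_n` in `S` is attained at `x_1, …, x_n`. -/
def IsFekete (S : Set ℝ) (n : ℕ) (w : ℝ → ℝ) (x : Fin n → ℝ) : Prop :=
  (∀ k, x k ∈ S) ∧ ∀ z : Fin n → ℝ, (∀ k, z k ∈ S) → feketeFun n w z ≤ feketeFun n w x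

/-- `{x_1, …, x_n}` is the unique `n`-th weighted Fekete set. -/
def IsUniqueFekete (S : Set ℝ) (n : ℕ) (w : ℝ → ℝ) (x : Fin n → ℝ) : Prop :=
  IsFekete S n w x ∧ ∀ z : Fin n → ℝ, IsFekete S n w z → Set.range z = Set.range x

/-- The weight `w ^ (1 / (2 (n - 1)))`. -/
def rootWeight (n : ℕ) (w : ℝ → ℝ) : ℝ → ℝ := fun t => w t ^ (1 / (2 * ((n : ℝ) - 1)))

/-! ### Lagrange interpolation and Fejér constants -/

/-- The fundamental polynomials `l_k` of Lagrange interpolation at `x_1, …, x_n`. -/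
def fundPoly {n : ℕ} (x : Fin n → ℝ) (k : Fin n) : ℝ[X] := Lagrange.basis Finset.univ x k

/-- The Fejér constant `ω'' (x_k) / ω' (x_k) + w' (x_k) / w (x_k)`, `ω = ∏ (X - x_i)`. -/
def fejerConst {n : ℕ} (w : ℝ → ℝ) (x : Fin n → ℝ) (k : Fin n) : ℝ :=
  (derivative (derivative (Lagrange.nodal Finset.univ x))).eval (x k)
      / (derivative (Lagrange.nodal Finset.univ x)).eval (x k)
    + deriv w (x k) / w (x k)

/-! ### Orthogonal polynomials and the weights `w_n` -/

/-- `∫_S p q w`. -/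
def weightedInner (S : Set ℝ) (w : ℝ → ℝ) (p q : ℝ[X]) : ℝ :=
  ∫ t in S, p.eval t * q.eval t * w t

/-- The monic orthogonal polynomial of degree `n`, by the Gram-Schmidt process. -/
def monicOrtho (S : Set ℝ) (w : ℝ → ℝ) (n : ℕ) : ℝ[X] :=
  X ^ n - ∑ j : Fin n,
    C (weightedInner S w (X ^ n) (monicOrtho S w j)
        / weightedInner S w (monicOrtho S w j) (monicOrtho S w j)) * monicOrtho S w j
termination_by n
decreasing_by all_goals exact j.2

/-- The orthonormal polynomial `p_{n,w}`, with positive leading coefficient `γ_n`. -/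
def orthoPoly (S : Set ℝ) (w : ℝ → ℝ) (n : ℕ) : ℝ[X] :=
  C (1 / Real.sqrt (weightedInner S w (monicOrtho S w n) (monicOrtho S w n))) * monicOrtho S w n

/-- `ϱ_n = γ_{n-1} / γ_n` (for `n ≥ 1`). -/
def rhoConst (S : Set ℝ) (w : ℝ → ℝ) (n : ℕ) : ℝ :=
  (orthoPoly S w (n - 1)).leadingCoeff / (orthoPoly S w n).leadingCoeff

/-- `Q = - log w`. -/
def extField (w : ℝ → ℝ) : ℝ → ℝ := fun t => -Real.log (w t)

/-- `A_n(x) = ϱ_n ∫_a^b p_{n,w}(t)² w(t) (Q'(t) - Q'(x)) / (t - x) dt`. -/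
def funA (S : Set ℝ) (w : ℝ → ℝ) (n : ℕ) (x : ℝ) : ℝ :=
  rhoConst S w n * ∫ t in S, (orthoPoly S w n).eval t ^ 2 * w t
    * ((deriv (extField w) t - deriv (extField w) x) / (t - x))

/-- `w_n = w ϱ_n / A_n`. -/
def modWeight (S : Set ℝ) (w : ℝ → ℝ) (n : ℕ) : ℝ → ℝ :=
  fun x => w x * rhoConst S w n / funA S w n x

/-! ### Normal systems of nodes -/

/-- `α < β` are the two end points of the Mhaskar-Rakhmanov-Saff interval of order `n` of the
weight `w = exp (-Q)` on `S`. -/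
structure IsMRSInterval (S : Set ℝ) (w : ℝ → ℝ) (n : ℕ) (α β : ℝ) : Prop where
  left_mem : α ∈ S
  right_mem : β ∈ S
  lt : α < β
  eq_zero : 1 / Real.pi *
    ∫ t in α..β, deriv (extField w) t / Real.sqrt ((t - α) * (β - t)) = 0
  eq_order : 1 / Real.pi *
    ∫ t in α..β, t * deriv (extField w) t / Real.sqrt ((t - α) * (β - t)) = n

/-- `A` is the Mhaskar-Rakhmanov-Saff number `a_n`: the least `A` for which `[-A, A]` contains
the Mhaskar-Rakhmanov-Saff interval of order `n`. -/
def IsMRSNumber (S : Set ℝ) (w : ℝ → ℝ) (n : ℕ) (A : ℝ) : Prop :=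
  ∃ α β : ℝ, IsMRSInterval S w n α β ∧ A = max |α| |β|

/-- `x_1, …, x_n` are `1(w)`-normal. -/
def IsOneNormal (S : Set ℝ) {n : ℕ} (w : ℝ → ℝ) (x : Fin n → ℝ) : Prop :=
  (∃ A : ℝ, IsMRSNumber S w n A ∧ ∃ L : ℝ, 1 < L ∧ ∀ k, |x k| < L * A) ∧
    ∀ t ∈ S, w t * ∑ k, (fundPoly x k).eval t ^ 2 / w (x k) ≤ 1

/-! ### Stable and most economical interpolatory systems -/

/-- `q_k (x_i) = δ_{ki}`, for distinct nodes `x_1, …, x_n` in `S`. -/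
def IsInterpolatorySystem (S : Set ℝ) {n : ℕ} (x : Fin n → ℝ) (q : Fin n → ℝ[X]) : Prop :=
  Function.Injective x ∧ (∀ k, x k ∈ S) ∧
    ∀ k i, (q k).eval (x i) = if k = i then 1 else 0

/-- `q_1, …, q_n` is a `w`-stable interpolatory system on `S` with nodes `x_1, …, x_n`. -/
def IsStable (S : Set ℝ) {n : ℕ} (w : ℝ → ℝ) (x : Fin n → ℝ) (q : Fin n → ℝ[X]) : Prop :=
  IsInterpolatorySystem S x q ∧
    ∀ y : Fin n → ℝ, (∀ k, 0 ≤ y k) → ∀ t ∈ S,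
      0 ≤ w t * ∑ k, (q k).eval t / w (x k) * y k ∧
        w t * ∑ k, (q k).eval t / w (x k) * y k ≤ ⨆ k, y k

/-- The system is `w`-stable, and its total degree is minimal among all `w`-stable interpolatory
systems of `n` polynomials on `S`, whatever their nodes. -/
def IsStableMostEconomical (S : Set ℝ) {n : ℕ} (w : ℝ → ℝ) (x : Fin n → ℝ)
    (q : Fin n → ℝ[X]) : Prop :=
  IsStable S w x q ∧ ∀ (x' : Fin n → ℝ) (q' : Fin n → ℝ[X]), IsStable S w x' q' →
    ∑ k, (q k).natDegree ≤ ∑ k, (q' k).natDegree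

/-- The Grünwald system `l_k²`, for which `Y_{n,w} = w ∑ l_k² / w(x_k)`. -/
def gruenwaldSystem {n : ℕ} (x : Fin n → ℝ) : Fin n → ℝ[X] := fun k => fundPoly x k ^ 2

end FejerFekete

end

/-!
Everything is reduced to one inequality, the Grünwald bound `w ∑ l_k² / w(x_k) ≤ 1` on `(a, b)`.

*Fejér constants and the bound.* The Grünwald polynomial `∑ l_k² / w(x_k)` has the values of `1 / w`
at the nodes, and its derivative agrees with that of `1 / w` at `x_k` exactly if the Fejér constant
`C_k` vanishes. So if all `C_k` vanish, it is the Hermite interpolation polynomial of `1 / w`, and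
`(1 / w)^(2n) ≥ 0` makes the interpolation error nonnegative (`nonneg_of_double_zeros`,
`gruenwaldBound_of_fejerConst`).

*The bound and Fekete sets.* For the weight `w^(1/(2(n-1)))` Fekete sets maximise the weighted
discriminant `∏ (z_i - z_j)² ∏ w(z_i)`. The Vandermonde matrix of `z` is the product of the matrix
`(l_k(z_i))` and the Vandermonde matrix of `x`; after scaling by the square roots of the weights,
the rows of `(l_k(z_i))` have length at most `1` by the Grünwald bound, so that Hadamard's
inequality (`det_sq_le_exp`) shows that `x` is a maximum. Conversely, moving a single node of a
Fekete set shows that `l_k² w` has a maximum at `x_k`, so that `C_k = 0`.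

*Uniqueness* (`eq_of_strictMono_of_weightedDisc_max`). The logarithm of the discriminant is concave
on increasing tuples, strictly so in the differences of the nodes. Two maximisers are thus
translates of each other, and every translate in between is a maximiser. Equality in Hadamard's
inequality makes `1 / w` agree with the Grünwald polynomial along these translates, and the
invariance of the discriminant makes a product of translates of this polynomial constant. Since its
degree is `2n - 2 > 0`, this is impossible unless the translation is trivial.

*Stability and normality.* The Grünwald system is stable exactly if the Grünwald bound holds; the
polynomials of any stable system are nonnegative on `(a, b)`, so they have double zeros at `n - 1`
nodes, and none of them has degree below `2n - 2`. For normality the only question is whether the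
Mhaskar-Rakhmanov-Saff interval exists. With centre `c` and radius `r`, and `t = c + r cos θ`, its
two equations become conditions on the integrals of `Q'(c + r cos θ)` with and without the factor
`cos θ`. Each centre determines a radius which solves the second equation and depends continuously
on the centre; the first one is then solved by the intermediate value theorem
(`exists_center_radius`).

*Orthogonal polynomials.* By integration by parts, consecutive monic orthogonal polynomials satisfy
a lowering and a raising relation, whose coefficients are integrals of difference quotients of `Q'`
(`ladder_lower`, `ladder_raise`). One of these coefficients is a multiple of `A_n`. At a zero of
`p_n` the relations combine to `p_n'' / p_n' = Q' + A_n' / A_n = -w_n' / w_n`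
(`eval_derivative_derivative_monicOrtho`), so the zeros of `p_n` have vanishing Fejér constants for
`w_n`. By the first part they form the unique Fekete set, which gives the converse.
-/

namespace FejerFekete

/-! ### Rolle's theorem and the sign of the Hermite interpolation error -/

/-- Rolle's theorem for a finite set of zeros; the zeros of the derivative which it provides
avoid the given ones. -/
theorem exists_finset_deriv_eq_zero {S : Set ℝ} (hS : S.OrdConnected) {f f' : ℝ → ℝ}
    (hf : ∀ t ∈ S, HasDerivAt f (f' t) t) {m : ℕ} {Z : Finset ℝ} (hZS : ∀ z ∈ Z, z ∈ S)
    (hZ : ∀ z ∈ Z, f z = 0) (hcard : Z.card = m + 1) :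
    ∃ Y : Finset ℝ, (∀ y ∈ Y, y ∈ S) ∧ (∀ y ∈ Y, f' y = 0) ∧ Y.card = m ∧ Disjoint Y Z := by
  set z := Z.orderEmbOfFin hcard with hz
  have hzm : ∀ i, z i ∈ Z := fun i => Finset.orderEmbOfFin_mem Z hcard i
  have key : ∀ i : Fin m, ∃ y, z i.castSucc < y ∧ y < z i.succ ∧ y ∈ S ∧ f' y = 0 := by
    intro i
    have hlt : z i.castSucc < z i.succ := z.strictMono Fin.castSucc_lt_succ
    have hsub : Icc (z i.castSucc) (z i.succ) ⊆ S := hS.out (hZS _ (hzm _)) (hZS _ (hzm _))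
    obtain ⟨y, hy, hy0⟩ := exists_hasDerivAt_eq_zero (f := f) (f' := f') hlt
      (fun t ht => (hf t (hsub ht)).continuousAt.continuousWithinAt)
      (by rw [hZ _ (hzm _), hZ _ (hzm _)])
      (fun t ht => hf t (hsub (Ioo_subset_Icc_self ht)))
    exact ⟨y, hy.1, hy.2, hsub (Ioo_subset_Icc_self hy), hy0⟩
  choose y hy1 hy2 hyS hy0 using key
  have hmono : StrictMono y := by
    intro i j hij
    refine (hy2 i).trans_le (le_trans (z.monotone ?_) (hy1 j).le)
    exact Fin.succ_le_castSucc_iff.2 hij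
  refine ⟨Finset.univ.map ⟨y, hmono.injective⟩, ?_, ?_, by simp, ?_⟩
  · simpa using hyS
  · simpa using hy0
  · rw [Finset.disjoint_left]
    simp only [Finset.mem_map, Finset.mem_univ, true_and, Function.Embedding.coeFn_mk,
      forall_exists_index, forall_apply_eq_imp_iff]
    intro i hi
    have : y i ∈ Set.range z := by rw [hz, Finset.range_orderEmbOfFin]; exact hi
    obtain ⟨j, hj⟩ := this
    have h1 : i.castSucc < j := z.lt_iff_lt.1 (by rw [hj]; exact hy1 i)
    have h2 : j < i.succ := z.lt_iff_lt.1 (by rw [hj]; exact hy2 i)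
    rw [Fin.lt_def] at h1 h2
    simp at h1 h2
    omega

/-- If `g 1, …, g (N + 1)` are consecutive derivatives of `g 0` and `g 0` has `N + 1` zeros, then
`g N` has a zero. -/
theorem exists_iterated_deriv_eq_zero {S : Set ℝ} (hS : S.OrdConnected) (N : ℕ) :
    ∀ (g : ℕ → ℝ → ℝ), (∀ m < N, ∀ t ∈ S, HasDerivAt (g m) (g (m + 1) t) t) →
    ∀ Z : Finset ℝ, (∀ z ∈ Z, z ∈ S) → (∀ z ∈ Z, g 0 z = 0) → Z.card = N + 1 →
    ∃ ξ ∈ S, g N ξ = 0 := by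
  induction N with
  | zero =>
    intro g _ Z hZS hZ hc
    obtain ⟨z, rfl⟩ := Finset.card_eq_one.1 hc
    exact ⟨z, hZS z (by simp), hZ z (by simp)⟩
  | succ N ih =>
    intro g hg Z hZS hZ hc
    obtain ⟨Y, hYS, hY, hYc, -⟩ := exists_finset_deriv_eq_zero hS (hg 0 (by omega)) hZS hZ hc
    exact ih (fun m => g (m + 1)) (fun m hm => hg (m + 1) (by omega)) Y hYS hY hYc

/-- The Hermite interpolation error is nonnegative: a function with double zeros at `n` nodes, whose
derivative of order `2 n` is nonnegative, is itself nonnegative. -/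
theorem nonneg_of_double_zeros {S : Set ℝ} (hS : S.OrdConnected) {n : ℕ} (hn : 1 ≤ n)
    {x : Fin n → ℝ} (hx : Function.Injective x) (hxS : ∀ k, x k ∈ S) {g : ℕ → ℝ → ℝ}
    (hg : ∀ m < 2 * n, ∀ t ∈ S, HasDerivAt (g m) (g (m + 1) t) t)
    (h0 : ∀ k, g 0 (x k) = 0) (h1 : ∀ k, g 1 (x k) = 0) (hpos : ∀ t ∈ S, 0 ≤ g (2 * n) t)
    {t : ℝ} (ht : t ∈ S) : 0 ≤ g 0 t := by
  by_cases htx : ∃ k, x k = t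
  · obtain ⟨k, rfl⟩ := htx
    exact (h0 k).ge
  push Not at htx
  set p : ℝ[X] := Lagrange.nodal Finset.univ x ^ 2 with hp
  have hmon : p.Monic := (Lagrange.nodal_monic).pow 2
  have hdeg : p.natDegree = 2 * n := by
    rw [hp, natDegree_pow, Lagrange.natDegree_nodal, Finset.card_fin]
  have hpt : 0 < p.eval t := by
    have : (Lagrange.nodal Finset.univ x).eval t ≠ 0 :=
      Lagrange.eval_nodal_not_at_node (fun k _ => (htx k).symm)
    rw [hp, eval_pow]; positivity
  have hp0 : ∀ k, p.eval (x k) = 0 := fun k => by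
    rw [hp, eval_pow, Lagrange.eval_nodal_at_node (Finset.mem_univ k)]; simp
  have hp1 : ∀ k, (derivative p).eval (x k) = 0 := fun k => by
    rw [hp, derivative_pow, eval_mul, eval_mul, eval_pow,
      Lagrange.eval_nodal_at_node (Finset.mem_univ k)]; simp
  set K := g 0 t / p.eval t with hK
  set h : ℕ → ℝ → ℝ := fun m s => g m s - K * (derivative^[m] p).eval s with hh
  have hhd : ∀ m < 2 * n, ∀ s ∈ S, HasDerivAt (h m) (h (m + 1) s) s := by
    intro m hm s hs
    have := (hg m hm s hs).sub (((derivative^[m] p).hasDerivAt s).const_mul K)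
    simp only [hh, Function.iterate_succ_apply']
    exact this
  -- the nodes and `t` are zeros of `h 0`
  set X : Finset ℝ := Finset.univ.map ⟨x, hx⟩ with hX
  have hXc : X.card = n := by simp [hX]
  have htX : t ∉ X := by simpa [hX] using htx
  obtain ⟨Y, hYS, hY, hYc, hYd⟩ := exists_finset_deriv_eq_zero hS (hhd 0 (by omega))
    (Z := insert t X) (m := n)
    (by simpa [hX, ht] using hxS)
    (by
      simp only [Finset.mem_insert, hX, Finset.mem_map, Finset.mem_univ, true_and,
        Function.Embedding.coeFn_mk, forall_eq_or_imp, forall_exists_index,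
        forall_apply_eq_imp_iff, hh, Function.iterate_zero, id]
      refine ⟨?_, fun k => by rw [h0, hp0]; ring⟩
      rw [hK]; field_simp; ring)
    (by rw [Finset.card_insert_of_notMem htX, hXc])
  have hYX : Disjoint Y X := hYd.mono_right (Finset.subset_insert _ _)
  obtain ⟨ξ, hξ, hξ0⟩ := exists_iterated_deriv_eq_zero hS (2 * n - 1) (fun m => h (m + 1))
    (fun m hm => hhd (m + 1) (by omega)) (Y ∪ X)
    (by
      intro z hz
      rcases Finset.mem_union.1 hz with hz | hz
      · exact hYS z hz
      · obtain ⟨k, -, rfl⟩ := Finset.mem_map.1 hz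
        exact hxS k)
    (by
      intro z hz
      rcases Finset.mem_union.1 hz with hz | hz
      · exact hY z hz
      · obtain ⟨k, -, rfl⟩ := Finset.mem_map.1 hz
        simp only [hh, Function.Embedding.coeFn_mk, zero_add, Function.iterate_one]
        rw [h1, hp1]; ring)
    (by rw [Finset.card_union_of_disjoint hYX, hYc, hXc]; omega)
  have hlast : derivative^[2 * n] p = C ((2 * n).factorial : ℝ) := by
    have hd : (derivative^[2 * n] p).natDegree = 0 := by
      have := natDegree_iterate_derivative p (2 * n)
      omega
    rw [eq_C_of_natDegree_eq_zero hd, coeff_iterate_derivative, zero_add,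
      Nat.descFactorial_self, ← hdeg, hmon.coeff_natDegree]
    simp
  simp only [hh, show 2 * n - 1 + 1 = 2 * n by omega, hlast, eval_C] at hξ0
  have hKnn : 0 ≤ K := by
    have hf : (0 : ℝ) < (2 * n).factorial := by exact_mod_cast Nat.factorial_pos _
    have := hpos ξ hξ
    by_contra hneg
    push Not at hneg
    nlinarith [mul_neg_of_neg_of_pos hneg hf]
  have : g 0 t = K * p.eval t := by rw [hK]; field_simp
  rw [this]; positivity

/-! ### Hadamard's inequality -/

/-- Hadamard's inequality, up to the exponential of the defect of the row lengths from `1`. The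
eigenvalues `μ` of `M Mᵀ` satisfy `μ ≤ exp (μ - 1)`. -/
theorem det_sq_le_exp {n : ℕ} (M : Matrix (Fin n) (Fin n) ℝ) :
    M.det ^ 2 ≤ Real.exp (∑ i, (∑ k, M i k ^ 2 - 1)) := by
  have hps := Matrix.posSemidef_self_mul_conjTranspose M
  have hdet : (M * M.conjTranspose).det = M.det ^ 2 := by
    rw [Matrix.det_mul, Matrix.conjTranspose_eq_transpose_of_trivial, Matrix.det_transpose, sq]
  have htr : (M * M.conjTranspose).trace = ∑ i, ∑ k, M i k ^ 2 := by
    simp [Matrix.trace, Matrix.mul_apply, sq]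
  have h1 := hps.1.det_eq_prod_eigenvalues
  have h2 := hps.1.trace_eq_sum_eigenvalues
  simp only [RCLike.ofReal_real_eq_id, id] at h1 h2
  rw [← hdet, h1]
  calc ∏ i, hps.1.eigenvalues i ≤ ∏ i, Real.exp (hps.1.eigenvalues i - 1) :=
        Finset.prod_le_prod (fun i _ => hps.eigenvalues_nonneg i)
          (fun i _ => by simpa using Real.add_one_le_exp (hps.1.eigenvalues i - 1))
    _ = Real.exp (∑ i, (∑ k, M i k ^ 2 - 1)) := by
        rw [← Real.exp_sum, Finset.sum_sub_distrib, ← h2, htr, Finset.sum_sub_distrib]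

/-! ### The weighted discriminant -/

/-- The weighted discriminant `∏_{i<j} (z_i - z_j)² ∏ w(z_i)`, with the first product written as
the square of a Vandermonde determinant. -/
noncomputable def weightedDisc {n : ℕ} (w : ℝ → ℝ) (z : Fin n → ℝ) : ℝ :=
  (Matrix.vandermonde z).det ^ 2 * ∏ i, w (z i)

/-- The inequality `w ∑ l_k² / w(x_k) ≤ 1` on `S`. -/
def GruenwaldBound (S : Set ℝ) {n : ℕ} (w : ℝ → ℝ) (x : Fin n → ℝ) : Prop :=
  ∀ t ∈ S, w t * ∑ k, (fundPoly x k).eval t ^ 2 / w (x k) ≤ 1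

theorem prod_Ioi_mul {n : ℕ} (u : Fin n → ℝ) :
    ∏ i : Fin n, ∏ j ∈ Finset.Ioi i, u i * u j = ∏ i, u i ^ (n - 1) := by
  simp_rw [Finset.prod_mul_distrib]
  have hcomm : ∏ i : Fin n, ∏ j ∈ Finset.Ioi i, u j = ∏ j : Fin n, ∏ _i ∈ Finset.Iio j, u j :=
    Finset.prod_comm' (by simp)
  rw [hcomm, ← Finset.prod_mul_distrib]
  refine Finset.prod_congr rfl fun i _ => ?_
  rw [Finset.prod_const, Finset.prod_const, Fin.card_Ioi, Fin.card_Iio, ← pow_add]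
  congr 1
  have := i.2
  omega

theorem weightedDisc_nonneg {n : ℕ} {w : ℝ → ℝ} {z : Fin n → ℝ} (hw : ∀ i, 0 < w (z i)) :
    0 ≤ weightedDisc w z :=
  mul_nonneg (sq_nonneg _) (Finset.prod_nonneg fun i _ => (hw i).le)

theorem weightedDisc_pos {n : ℕ} {w : ℝ → ℝ} {z : Fin n → ℝ} (hw : ∀ i, 0 < w (z i))
    (hz : Function.Injective z) : 0 < weightedDisc w z := by
  have : (Matrix.vandermonde z).det ≠ 0 := Matrix.det_vandermonde_ne_zero_iff.2 hz
  exact mul_pos (by positivity) (Finset.prod_pos fun i _ => hw i)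

theorem weightedDisc_comp_perm {n : ℕ} (w : ℝ → ℝ) (z : Fin n → ℝ) (σ : Equiv.Perm (Fin n)) :
    weightedDisc w (z ∘ σ) = weightedDisc w z := by
  have h : Matrix.vandermonde (z ∘ σ) = (Matrix.vandermonde z).submatrix σ id := by
    ext i j; simp [Matrix.vandermonde_apply]
  have hs : ((Equiv.Perm.sign σ : ℤ) : ℝ) ^ 2 = 1 := by
    rcases Int.units_eq_one_or (Equiv.Perm.sign σ) with h | h <;> simp [h]
  rw [weightedDisc, weightedDisc, h, Matrix.det_permute, mul_pow, hs, one_mul]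
  congr 1
  exact Equiv.prod_comp σ (fun i => w (z i))

/-- For the weight `w ^ (1 / (2 (n - 1)))`, the function maximised by Fekete sets is a power of the
weighted discriminant. -/
theorem feketeFun_rootWeight {n : ℕ} (hn : 2 ≤ n) {w : ℝ → ℝ} {z : Fin n → ℝ}
    (hw : ∀ i, 0 < w (z i)) :
    feketeFun n (rootWeight n w) z = weightedDisc w z ^ (1 / ((n : ℝ) * ((n : ℝ) - 1))) := by
  have hn' : (1 : ℝ) ≤ (n : ℝ) - 1 := by
    have : (2 : ℝ) ≤ n := by exact_mod_cast hn
    linarith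
  have hu : ∀ i, (rootWeight n w (z i) ^ (n - 1)) ^ 2 = w (z i) := by
    intro i
    rw [rootWeight, ← Real.rpow_natCast, ← Real.rpow_natCast, ← Real.rpow_mul (hw i).le,
      ← Real.rpow_mul (hw i).le, Nat.cast_sub (by omega)]
    conv_rhs => rw [← Real.rpow_one (w (z i))]
    congr 1
    push_cast
    field_simp
  set B := ∏ i : Fin n, ∏ j ∈ Finset.Ioi i, |z i - z j| * rootWeight n w (z i) *
    rootWeight n w (z j) with hB
  have hB' : B = (∏ i : Fin n, ∏ j ∈ Finset.Ioi i, |z j - z i|) *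
      ∏ i, rootWeight n w (z i) ^ (n - 1) := by
    rw [hB, ← prod_Ioi_mul, ← Finset.prod_mul_distrib]
    refine Finset.prod_congr rfl fun i _ => ?_
    rw [← Finset.prod_mul_distrib]
    refine Finset.prod_congr rfl fun j _ => ?_
    rw [abs_sub_comm, mul_assoc]
  have hB0 : 0 ≤ B := by
    refine Finset.prod_nonneg fun i _ => Finset.prod_nonneg fun j _ => ?_
    exact mul_nonneg (mul_nonneg (abs_nonneg _) (Real.rpow_nonneg (hw i).le _))
      (Real.rpow_nonneg (hw j).le _)
  have hB2 : B ^ 2 = weightedDisc w z := by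
    rw [hB', mul_pow, weightedDisc, Matrix.det_vandermonde,
      ← Finset.prod_congr rfl (fun i _ => hu i), Finset.prod_pow]
    simp_rw [← Finset.abs_prod, sq_abs, Finset.prod_pow]
  rw [feketeFun, ← hB, ← hB2, ← Real.rpow_natCast, ← Real.rpow_mul hB0]
  congr 1
  push_cast
  ring

theorem isFekete_rootWeight_iff {n : ℕ} (hn : 2 ≤ n) {S : Set ℝ} {w : ℝ → ℝ}
    (hw : ∀ t ∈ S, 0 < w t) {x : Fin n → ℝ} :
    IsFekete S n (rootWeight n w) x ↔ (∀ k, x k ∈ S) ∧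
      ∀ z : Fin n → ℝ, (∀ k, z k ∈ S) → weightedDisc w z ≤ weightedDisc w x := by
  have hn' : (2 : ℝ) ≤ n := by exact_mod_cast hn
  have he : 0 < 1 / ((n : ℝ) * ((n : ℝ) - 1)) := by
    apply one_div_pos.2; apply mul_pos <;> linarith
  refine and_congr_right fun hx => forall₂_congr fun z hz => ?_
  rw [feketeFun_rootWeight hn fun i => hw _ (hz i), feketeFun_rootWeight hn fun i => hw _ (hx i),
    Real.rpow_le_rpow_iff (weightedDisc_nonneg fun i => hw _ (hz i))
      (weightedDisc_nonneg fun i => hw _ (hx i)) he]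

/-! ### Change of nodes -/

theorem eval_fundPoly {n : ℕ} {x : Fin n → ℝ} (hx : Function.Injective x) (k i : Fin n) :
    (fundPoly x k).eval (x i) = if k = i then 1 else 0 := by
  split_ifs with h
  · subst h; exact Lagrange.eval_basis_self hx.injOn (Finset.mem_univ _)
  · exact Lagrange.eval_basis_of_ne h (Finset.mem_univ _)

/-- The matrix of the values at `z_i` of the fundamental polynomials of `x` takes the Vandermonde
matrix of `x` to that of `z`. -/
theorem fundPoly_matrix_mul_vandermonde {n : ℕ} {x : Fin n → ℝ} (hx : Function.Injective x)
    (z : Fin n → ℝ) :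
    (Matrix.of fun i k => (fundPoly x k).eval (z i)) * Matrix.vandermonde x =
      Matrix.vandermonde z := by
  ext i j
  have h : (X ^ (j : ℕ) : ℝ[X]) =
      Lagrange.interpolate Finset.univ x fun k => (X ^ (j : ℕ) : ℝ[X]).eval (x k) :=
    Lagrange.eq_interpolate hx.injOn (by simp)
  have h2 := congrArg (eval (z i)) h
  rw [Lagrange.interpolate_apply, eval_finsetSum] at h2
  simp only [eval_pow, eval_X, eval_mul, eval_C] at h2
  rw [Matrix.mul_apply, Matrix.vandermonde_apply, h2]
  refine Finset.sum_congr rfl fun k _ => ?_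
  simp [Matrix.vandermonde_apply, fundPoly, mul_comm]

theorem weightedDisc_eq_mul {n : ℕ} {x : Fin n → ℝ} (hx : Function.Injective x) {w : ℝ → ℝ}
    (hwx : ∀ k, 0 < w (x k)) (z : Fin n → ℝ) :
    weightedDisc w z = weightedDisc w x *
      ((Matrix.of fun i k => (fundPoly x k).eval (z i)).det ^ 2 * ∏ i, w (z i) / w (x i)) := by
  rw [weightedDisc, weightedDisc, ← fundPoly_matrix_mul_vandermonde hx z, Matrix.det_mul,
    Finset.prod_div_distrib]
  have : ∏ i, w (x i) ≠ 0 := (Finset.prod_pos fun i _ => hwx i).ne'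
  field_simp

theorem weightedDisc_le_mul_exp {n : ℕ} {x : Fin n → ℝ} (hx : Function.Injective x) {w : ℝ → ℝ}
    (hwx : ∀ k, 0 < w (x k)) {z : Fin n → ℝ} (hwz : ∀ k, 0 < w (z k)) :
    weightedDisc w z ≤ weightedDisc w x *
      Real.exp (∑ i, (w (z i) * ∑ k, (fundPoly x k).eval (z i) ^ 2 / w (x k) - 1)) := by
  set L : Matrix (Fin n) (Fin n) ℝ := Matrix.of fun i k => (fundPoly x k).eval (z i) with hL
  set M : Matrix (Fin n) (Fin n) ℝ := Matrix.diagonal (fun i => √(w (z i))) * L *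
    Matrix.diagonal (fun k => (√(w (x k)))⁻¹) with hM
  have hdet : M.det ^ 2 = L.det ^ 2 * ∏ i, w (z i) / w (x i) := by
    rw [hM, Matrix.det_mul, Matrix.det_mul, Matrix.det_diagonal, Matrix.det_diagonal, mul_pow,
      mul_pow, ← Finset.prod_pow, ← Finset.prod_pow, Finset.prod_div_distrib, div_eq_mul_inv,
      ← Finset.prod_inv_distrib]
    simp_rw [inv_pow]
    rw [Finset.prod_congr rfl fun i _ => Real.sq_sqrt (hwz i).le,
      Finset.prod_congr rfl fun i _ => congrArg _ (Real.sq_sqrt (hwx i).le)]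
    ring
  have hrow : ∀ i, ∑ k, M i k ^ 2 = w (z i) * ∑ k, (fundPoly x k).eval (z i) ^ 2 / w (x k) := by
    intro i
    rw [Finset.mul_sum]
    refine Finset.sum_congr rfl fun k _ => ?_
    rw [hM, Matrix.mul_diagonal, Matrix.diagonal_mul, mul_pow, mul_pow, inv_pow,
      Real.sq_sqrt (hwz i).le, Real.sq_sqrt (hwx k).le, hL, Matrix.of_apply]
    ring
  rw [weightedDisc_eq_mul hx hwx z, ← hdet]
  refine mul_le_mul_of_nonneg_left ?_ (weightedDisc_nonneg hwx)
  simpa only [hrow] using det_sq_le_exp M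

theorem GruenwaldBound.weightedDisc_le {n : ℕ} {S : Set ℝ} {x : Fin n → ℝ}
    (hx : Function.Injective x) (hxS : ∀ k, x k ∈ S) {w : ℝ → ℝ} (hw : ∀ t ∈ S, 0 < w t)
    (h : GruenwaldBound S w x) {z : Fin n → ℝ} (hz : ∀ k, z k ∈ S) :
    weightedDisc w z ≤ weightedDisc w x := by
  refine (weightedDisc_le_mul_exp hx (fun k => hw _ (hxS k)) (fun k => hw _ (hz k))).trans ?_
  refine mul_le_of_le_one_right (weightedDisc_nonneg fun k => hw _ (hxS k)) ?_
  rw [Real.exp_le_one_iff]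
  exact Finset.sum_nonpos fun i _ => by linarith [h _ (hz i)]

/-- Equality in Hadamard's inequality: a competing maximiser lies on the contact set. -/
theorem GruenwaldBound.eq_one_of_weightedDisc_le {n : ℕ} {S : Set ℝ} {x : Fin n → ℝ}
    (hx : Function.Injective x) (hxS : ∀ k, x k ∈ S) {w : ℝ → ℝ} (hw : ∀ t ∈ S, 0 < w t)
    (h : GruenwaldBound S w x) {z : Fin n → ℝ} (hz : ∀ k, z k ∈ S)
    (hle : weightedDisc w x ≤ weightedDisc w z) (i : Fin n) :
    w (z i) * ∑ k, (fundPoly x k).eval (z i) ^ 2 / w (x k) = 1 := by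
  have h1 := hle.trans
    (weightedDisc_le_mul_exp hx (fun k => hw _ (hxS k)) (fun k => hw _ (hz k)))
  have h2 := (le_mul_iff_one_le_right (weightedDisc_pos (fun k => hw _ (hxS k)) hx)).1 h1
  rw [Real.one_le_exp_iff] at h2
  have h3 : ∀ j ∈ Finset.univ,
      w (z j) * ∑ k, (fundPoly x k).eval (z j) ^ 2 / w (x k) - 1 ≤ 0 :=
    fun j _ => by linarith [h _ (hz j)]
  have h4 := (Finset.sum_eq_zero_iff_of_nonpos h3).1 (le_antisymm (Finset.sum_nonpos h3) h2) i
    (Finset.mem_univ i)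
  linarith

theorem weightedDisc_update {n : ℕ} {x : Fin n → ℝ} (hx : Function.Injective x) {w : ℝ → ℝ}
    (hwx : ∀ k, 0 < w (x k)) (k : Fin n) (s : ℝ) :
    weightedDisc w (Function.update x k s) =
      weightedDisc w x * ((fundPoly x k).eval s ^ 2 * (w s / w (x k))) := by
  rw [weightedDisc_eq_mul hx hwx]
  have hdet : (Matrix.of fun i j => (fundPoly x j).eval (Function.update x k s i)).det =
      (fundPoly x k).eval s := by
    have : (Matrix.of fun i j => (fundPoly x j).eval (Function.update x k s i)) =
        (1 : Matrix (Fin n) (Fin n) ℝ).updateRow k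
          (∑ j, (fundPoly x j).eval s • (1 : Matrix (Fin n) (Fin n) ℝ) j) := by
      ext i j
      by_cases hik : i = k
      · subst hik
        simp [Matrix.one_apply]
      · simp [hik, eval_fundPoly hx, Matrix.one_apply, eq_comm]
    rw [this, Matrix.det_updateRow_sum]
    simp
  have hprod : ∏ i, w (Function.update x k s i) / w (x i) = w s / w (x k) := by
    rw [Finset.prod_eq_single k]
    · simp
    · intro i _ hik
      rw [Function.update_of_ne hik, div_self (hwx i).ne']
    · simp
  rw [hdet, hprod]

/-! ### Fejér constants, the Grünwald bound and Fekete sets -/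

theorem two_mul_eval_derivative_fundPoly {n : ℕ} {x : Fin n → ℝ} (hx : Function.Injective x)
    (k : Fin n) :
    2 * (derivative (fundPoly x k)).eval (x k) =
      (derivative (derivative (Lagrange.nodal Finset.univ x))).eval (x k)
        / (derivative (Lagrange.nodal Finset.univ x)).eval (x k) := by
  set N := Lagrange.nodal (Finset.univ.erase k) x with hN
  have hω : Lagrange.nodal Finset.univ x = (X - C (x k)) * N :=
    Lagrange.nodal_eq_mul_nodal_erase (Finset.mem_univ k)
  have hl : fundPoly x k = C (Lagrange.nodalWeight Finset.univ x k) * N := by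
    rw [fundPoly, Lagrange.basis_eq_prod_sub_inv_mul_nodal_div (Finset.mem_univ k),
      ← Lagrange.nodal_erase_eq_nodal_div (Finset.mem_univ k)]
  have h1 := eval_fundPoly hx k k
  rw [hl, if_pos rfl, eval_mul, eval_C] at h1
  have hNx : N.eval (x k) ≠ 0 := right_ne_zero_of_mul_eq_one h1
  rw [hω, hl]
  simp only [derivative_mul, derivative_sub, derivative_X, derivative_C, eval_mul, eval_add,
    eval_sub, eval_X, eval_C, sub_zero, one_mul, zero_mul, derivative_add, sub_self, zero_add,
    add_zero]
  rw [eq_div_iff hNx]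
  linear_combination 2 * (derivative N).eval (x k) * h1

theorem fejerConst_eq {n : ℕ} {x : Fin n → ℝ} (hx : Function.Injective x) (w : ℝ → ℝ)
    (k : Fin n) :
    fejerConst w x k = 2 * (derivative (fundPoly x k)).eval (x k) + deriv w (x k) / w (x k) := by
  rw [fejerConst, two_mul_eval_derivative_fundPoly hx]

/-- The Fejér constant vanishes because `l_k² w` has a maximum at `x_k`. -/
theorem fejerConst_eq_zero_of_le {n : ℕ} {x : Fin n → ℝ} (hx : Function.Injective x) {S : Set ℝ}
    (hS : IsOpen S) {w : ℝ → ℝ} (hd : DifferentiableOn ℝ w S) {k : Fin n} (hxk : x k ∈ S)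
    (hwk : 0 < w (x k)) (h : ∀ s ∈ S, (fundPoly x k).eval s ^ 2 * w s ≤ w (x k)) :
    fejerConst w x k = 0 := by
  have hone : (fundPoly x k).eval (x k) = 1 := by rw [eval_fundPoly hx, if_pos rfl]
  have hmax : IsLocalMax (fun s => (fundPoly x k).eval s ^ 2 * w s) (x k) := by
    filter_upwards [hS.mem_nhds hxk] with s hs
    simpa [hone] using h s hs
  have hw' := (hd.differentiableAt (hS.mem_nhds hxk)).hasDerivAt
  have hder := (((fundPoly x k).hasDerivAt (x k)).pow 2).mul hw'
  have h0 := hmax.hasDerivAt_eq_zero hder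
  simp only [Pi.pow_apply, hone] at h0
  rw [fejerConst_eq hx, eq_comm, ← sub_eq_zero]
  field_simp
  norm_num at h0
  linarith

theorem fejerConst_eq_zero_of_weightedDisc_le {n : ℕ} {x : Fin n → ℝ}
    (hx : Function.Injective x) {S : Set ℝ} (hS : IsOpen S) {w : ℝ → ℝ}
    (hd : DifferentiableOn ℝ w S) (hw : ∀ t ∈ S, 0 < w t) (hxS : ∀ k, x k ∈ S)
    (h : ∀ z : Fin n → ℝ, (∀ k, z k ∈ S) → weightedDisc w z ≤ weightedDisc w x) (k : Fin n) :
    fejerConst w x k = 0 := by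
  refine fejerConst_eq_zero_of_le hx hS hd (hxS k) (hw _ (hxS k)) fun s hs => ?_
  have h1 := h (Function.update x k s) fun j => by
    by_cases hj : j = k
    · subst hj; simpa using hs
    · simpa [hj] using hxS j
  rw [weightedDisc_update hx fun j => hw _ (hxS j)] at h1
  have h2 := (mul_le_iff_le_one_right (weightedDisc_pos (fun j => hw _ (hxS j)) hx)).1 h1
  rwa [mul_div_assoc', div_le_one (hw _ (hxS k))] at h2

/-- The Grünwald polynomial `∑ l_k² / w(x_k)`. -/
noncomputable def gruenwaldPoly {n : ℕ} (w : ℝ → ℝ) (x : Fin n → ℝ) : ℝ[X] :=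
  ∑ k, C (1 / w (x k)) * fundPoly x k ^ 2

theorem eval_gruenwaldPoly {n : ℕ} (w : ℝ → ℝ) (x : Fin n → ℝ) (t : ℝ) :
    (gruenwaldPoly w x).eval t = ∑ k, (fundPoly x k).eval t ^ 2 / w (x k) := by
  rw [gruenwaldPoly, eval_finsetSum]
  refine Finset.sum_congr rfl fun k _ => ?_
  rw [eval_mul, eval_C, eval_pow]; ring

theorem natDegree_fundPoly {n : ℕ} {x : Fin n → ℝ} (hx : Function.Injective x) (k : Fin n) :
    (fundPoly x k).natDegree = n - 1 := by
  rw [fundPoly, Lagrange.natDegree_basis hx.injOn (Finset.mem_univ k), Finset.card_fin]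

theorem natDegree_gruenwaldPoly {n : ℕ} [NeZero n] {x : Fin n → ℝ} (hx : Function.Injective x)
    {w : ℝ → ℝ} (hw : ∀ k, 0 < w (x k)) : (gruenwaldPoly w x).natDegree = 2 * (n - 1) := by
  have hdeg : ∀ k, (fundPoly x k ^ 2).natDegree = 2 * (n - 1) := fun k => by
    rw [natDegree_pow, natDegree_fundPoly hx]
  refine natDegree_eq_of_le_of_coeff_ne_zero ?_ ?_
  · refine natDegree_sum_le_of_forall_le _ _ fun k _ => ?_
    exact (natDegree_C_mul_le _ _).trans (hdeg k).le
  · rw [gruenwaldPoly, finsetSum_coeff]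
    refine (Finset.sum_pos (fun k _ => ?_) Finset.univ_nonempty).ne'
    rw [coeff_C_mul, ← hdeg k, coeff_natDegree, leadingCoeff_pow]
    have : fundPoly x k ≠ 0 := Lagrange.basis_ne_zero hx.injOn (Finset.mem_univ k)
    have h2 : (fundPoly x k).leadingCoeff ≠ 0 := leadingCoeff_ne_zero.2 this
    have := hw k
    positivity

/-- If the Fejér constants vanish, then the Hermite interpolation polynomial of `1 / w` is the
Grünwald polynomial, and it stays below `1 / w`. -/
theorem gruenwaldBound_of_fejerConst {n : ℕ} (hn : 1 ≤ n) {x : Fin n → ℝ}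
    (hx : Function.Injective x) {S : Set ℝ} (hS : IsOpen S) (hS' : S.OrdConnected) {w : ℝ → ℝ}
    (hd : DifferentiableOn ℝ w S) (hw : ∀ t ∈ S, 0 < w t) (hxS : ∀ k, x k ∈ S)
    (hder : HasNonnegDeriv (2 * n) (fun t => 1 / w t) S) (h : ∀ k, fejerConst w x k = 0) :
    GruenwaldBound S w x := by
  have : NeZero n := ⟨by omega⟩
  set P := gruenwaldPoly w x with hP
  have hPn : P.natDegree = 2 * (n - 1) := natDegree_gruenwaldPoly hx fun k => hw _ (hxS k)
  set f : ℝ → ℝ := fun t => 1 / w t with hf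
  have hfd : ∀ m < 2 * n, ∀ t ∈ S,
      HasDerivAt (iteratedDeriv m f) (iteratedDeriv (m + 1) f t) t := by
    intro m hm t ht
    rw [iteratedDeriv_succ]
    exact ((hder.1 m hm).differentiableAt (hS.mem_nhds ht)).hasDerivAt
  intro t ht
  have hnn := nonneg_of_double_zeros hS' hn hx hxS
    (g := fun m s => iteratedDeriv m f s - (derivative^[m] P).eval s)
    (by
      intro m hm s hs
      simp only [Function.iterate_succ_apply']
      exact (hfd m hm s hs).sub ((derivative^[m] P).hasDerivAt s))
    (by
      intro k
      simp only [iteratedDeriv_zero, Function.iterate_zero, id, hP, eval_gruenwaldPoly, hf]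
      rw [Finset.sum_eq_single k, eval_fundPoly hx, if_pos rfl]
      · ring
      · intro j _ hj
        rw [eval_fundPoly hx, if_neg hj]; simp
      · simp)
    (by
      intro k
      have hw' := (hd.differentiableAt (hS.mem_nhds (hxS k))).hasDerivAt
      have hwk := (hw _ (hxS k)).ne'
      have h1 : deriv f (x k) = - deriv w (x k) / w (x k) ^ 2 := by
        simp only [hf, one_div]
        exact (hw'.inv hwk).deriv
      have h2 : (derivative P).eval (x k) =
          2 * (derivative (fundPoly x k)).eval (x k) / w (x k) := by
        rw [hP, gruenwaldPoly, derivative_sum, eval_finsetSum, Finset.sum_eq_single k]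
        · simp [derivative_pow, eval_fundPoly hx]; ring
        · intro j _ hj
          simp [derivative_pow, eval_fundPoly hx, hj]
        · simp
      have h3 := h k
      rw [fejerConst_eq hx] at h3
      simp only [iteratedDeriv_one, Function.iterate_one]
      rw [h1, h2, eq_neg_of_add_eq_zero_left h3]
      field_simp
      ring)
    (by
      intro s hs
      rw [iterate_derivative_eq_zero (by omega)]
      simpa using hder.2 s hs)
    ht
  simp only [iteratedDeriv_zero, Function.iterate_zero, id, hP, eval_gruenwaldPoly, hf] at hnn
  have := mul_le_mul_of_nonneg_left (sub_nonneg.1 hnn) (hw t ht).le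
  rwa [mul_one_div_cancel (hw t ht).ne'] at this

/-! ### Uniqueness of Fekete sets -/

theorem log_weightedDisc {n : ℕ} {w : ℝ → ℝ} {z : Fin n → ℝ} (hw : ∀ i, 0 < w (z i))
    (hz : StrictMono z) :
    Real.log (weightedDisc w z) =
      2 * (∑ i, ∑ j ∈ Finset.Ioi i, Real.log (z j - z i)) + ∑ i, Real.log (w (z i)) := by
  have h1 : ∀ i, ∀ j ∈ Finset.Ioi i, z j - z i ≠ 0 := fun i j hj =>
    (sub_pos.2 (hz (Finset.mem_Ioi.1 hj))).ne'
  have h2 : ∀ i, ∏ j ∈ Finset.Ioi i, (z j - z i) ≠ 0 := fun i => Finset.prod_ne_zero_iff.2 (h1 i)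
  rw [weightedDisc, Matrix.det_vandermonde, Real.log_mul
    (pow_ne_zero _ (Finset.prod_ne_zero_iff.2 fun i _ => h2 i))
    (Finset.prod_ne_zero_iff.2 fun i _ => (hw i).ne'), Real.log_pow,
    Real.log_prod fun i _ => h2 i, Real.log_prod fun i _ => (hw i).ne',
    Finset.sum_congr rfl fun i _ => Real.log_prod (h1 i)]
  push_cast
  rfl

/-- Two increasing maximisers of the weighted discriminant coincide. By log-concavity they are
translates of each other, and all the translates in between are maximisers. On these the weight is
the reciprocal of the Grünwald polynomial, while the product of the weights does not change: the
product of translates of a nonconstant polynomial would be constant. -/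
theorem eq_of_strictMono_of_weightedDisc_max {n : ℕ} (hn : 2 ≤ n) {S : Set ℝ} (hS : Convex ℝ S)
    {w : ℝ → ℝ} (hw : ∀ t ∈ S, 0 < w t) (hconc : ConcaveOn ℝ S fun t => Real.log (w t))
    {x z : Fin n → ℝ} (hx : StrictMono x) (hz : StrictMono z)
    (hxS : ∀ k, x k ∈ S) (hzS : ∀ k, z k ∈ S) (hb : GruenwaldBound S w x)
    (heq : weightedDisc w z = weightedDisc w x) : z = x := by
  have : NeZero n := ⟨by omega⟩
  set y : ℝ → Fin n → ℝ := fun t i => (1 - t) * x i + t * z i with hy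
  have hyS : ∀ t ∈ Icc (0 : ℝ) 1, ∀ i, y t i ∈ S := fun t ht i =>
    hS (hxS i) (hzS i) (sub_nonneg.2 ht.2) ht.1 (by ring)
  have hym : ∀ t ∈ Icc (0 : ℝ) 1, StrictMono (y t) := by
    intro t ht i j hij
    have h1 := hx hij
    have h2 := hz hij
    simp only [hy]
    rcases eq_or_lt_of_le ht.1 with h0 | h0
    · rw [← h0]; linarith
    · have := mul_lt_mul_of_pos_left h2 h0
      have := mul_le_mul_of_nonneg_left h1.le (sub_nonneg.2 ht.2)
      linarith
  have hpos : ∀ {u : Fin n → ℝ}, (∀ i, u i ∈ S) → ∀ i, 0 < w (u i) := fun hu i => hw _ (hu i)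
  have hle : ∀ t ∈ Icc (0 : ℝ) 1, weightedDisc w (y t) ≤ weightedDisc w x := fun t ht =>
    hb.weightedDisc_le hx.injective hxS hw (hyS t ht)
  have hlogle : ∀ t ∈ Icc (0 : ℝ) 1,
      Real.log (weightedDisc w (y t)) ≤ Real.log (weightedDisc w x) := fun t ht =>
    Real.log_le_log (weightedDisc_pos (hpos (hyS t ht)) (hym t ht).injective) (hle t ht)
  have hlogz : Real.log (weightedDisc w z) = Real.log (weightedDisc w x) := by rw [heq]
  have hwc : ∀ t ∈ Icc (0 : ℝ) 1, (1 - t) * ∑ i, Real.log (w (x i)) + t * ∑ i, Real.log (w (z i))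
      ≤ ∑ i, Real.log (w (y t i)) := by
    intro t ht
    rw [Finset.mul_sum, Finset.mul_sum, ← Finset.sum_add_distrib]
    exact Finset.sum_le_sum fun i _ =>
      hconc.2 (hxS i) (hzS i) (sub_nonneg.2 ht.2) ht.1 (by ring)
  have hdc : ∀ t ∈ Icc (0 : ℝ) 1, ∀ i, ∀ j ∈ Finset.Ioi i,
      (1 - t) * Real.log (x j - x i) + t * Real.log (z j - z i) ≤ Real.log (y t j - y t i) := by
    intro t ht i j hij
    have := strictConcaveOn_log_Ioi.concaveOn.2 (mem_Ioi.2 (sub_pos.2 (hx (Finset.mem_Ioi.1 hij))))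
      (mem_Ioi.2 (sub_pos.2 (hz (Finset.mem_Ioi.1 hij)))) (sub_nonneg.2 ht.2) ht.1 (by ring)
    simp only [smul_eq_mul] at this
    refine this.trans_eq ?_
    congr 1
    simp only [hy]; ring
  -- all differences agree
  have hdiff : ∀ i j, i < j → x j - x i = z j - z i := by
    intro i₀ j₀ hij
    by_contra hne
    have hh : (1 / 2 : ℝ) ∈ Icc (0 : ℝ) 1 := by norm_num
    have hstrict : (1 - 1 / 2) * Real.log (x j₀ - x i₀) + 1 / 2 * Real.log (z j₀ - z i₀) <
        Real.log (y (1 / 2) j₀ - y (1 / 2) i₀) := by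
      have := strictConcaveOn_log_Ioi.2 (mem_Ioi.2 (sub_pos.2 (hx hij)))
        (mem_Ioi.2 (sub_pos.2 (hz hij))) hne (half_pos one_pos) (half_pos one_pos) (add_halves 1)
      simp only [smul_eq_mul] at this
      refine lt_of_eq_of_lt (by norm_num) (this.trans_eq ?_)
      congr 1
      simp only [hy]; ring
    have h1 : ∑ i, ∑ j ∈ Finset.Ioi i,
        ((1 - 1 / 2) * Real.log (x j - x i) + 1 / 2 * Real.log (z j - z i)) <
        ∑ i, ∑ j ∈ Finset.Ioi i, Real.log (y (1 / 2) j - y (1 / 2) i) := by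
      refine Finset.sum_lt_sum (fun i _ => Finset.sum_le_sum (hdc _ hh i))
        ⟨i₀, Finset.mem_univ _, Finset.sum_lt_sum (hdc _ hh i₀)
          ⟨j₀, Finset.mem_Ioi.2 hij, hstrict⟩⟩
    simp only [Finset.sum_add_distrib, ← Finset.mul_sum] at h1
    have h2 := hwc _ hh
    have h3 := hlogle _ hh
    rw [log_weightedDisc (hpos (hyS _ hh)) (hym _ hh)] at h3
    rw [log_weightedDisc (hpos hzS) hz] at hlogz
    rw [log_weightedDisc (hpos hxS) hx] at h3 hlogz
    linarith
  obtain ⟨c, hc⟩ : ∃ c, ∀ i, z i = x i + c := by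
    refine ⟨z 0 - x 0, fun i => ?_⟩
    rcases eq_or_lt_of_le (Fin.zero_le i) with h | h
    · rw [← h]; ring
    · have := hdiff 0 i h
      linarith
  by_contra hzx
  have hc0 : c ≠ 0 := by
    rintro rfl
    exact hzx (funext fun i => by rw [hc, add_zero])
  have hyt : ∀ t i, y t i = x i + t * c := fun t i => by simp only [hy, hc]; ring
  set P := gruenwaldPoly w x with hP
  set R : ℝ[X] := ∏ i, P.comp (C c * X + C (x i)) with hR
  have hlow : ∀ t ∈ Icc (0 : ℝ) 1, weightedDisc w (y t) = weightedDisc w x := by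
    intro t ht
    refine le_antisymm (hle t ht) ?_
    rw [← Real.log_le_log_iff (weightedDisc_pos (hpos hxS) hx.injective)
      (weightedDisc_pos (hpos (hyS t ht)) (hym t ht).injective)]
    have h1 : ∑ i, ∑ j ∈ Finset.Ioi i,
        ((1 - t) * Real.log (x j - x i) + t * Real.log (z j - z i)) ≤
        ∑ i, ∑ j ∈ Finset.Ioi i, Real.log (y t j - y t i) :=
      Finset.sum_le_sum fun i _ => Finset.sum_le_sum (hdc t ht i)
    simp only [Finset.sum_add_distrib, ← Finset.mul_sum] at h1
    have h2 := hwc t ht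
    have h4 : Real.log (weightedDisc w x) = (1 - t) * Real.log (weightedDisc w x) +
        t * Real.log (weightedDisc w z) := by rw [hlogz]; ring
    rw [h4, log_weightedDisc (hpos (hyS t ht)) (hym t ht), log_weightedDisc (hpos hzS) hz,
      log_weightedDisc (hpos hxS) hx]
    linarith
  have hRt : ∀ t ∈ Icc (0 : ℝ) 1, R.eval t = (∏ i, w (x i))⁻¹ := by
    intro t ht
    have h1 : ∀ i, P.eval (y t i) = (w (y t i))⁻¹ := by
      intro i
      have := hb.eq_one_of_weightedDisc_le hx.injective hxS hw (hyS t ht) (hlow t ht).ge i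
      rw [← eval_gruenwaldPoly] at this
      exact eq_inv_of_mul_eq_one_right this
    have h2 : ∏ i, w (y t i) = ∏ i, w (x i) := by
      have h3 := hlow t ht
      have h4 : (Matrix.vandermonde (y t)).det = (Matrix.vandermonde x).det := by
        rw [← Matrix.det_vandermonde_add x (t * c)]
        congr 2
        exact funext (hyt t)
      rw [weightedDisc, weightedDisc, h4] at h3
      exact mul_left_cancel₀ (pow_ne_zero 2 (Matrix.det_vandermonde_ne_zero_iff.2 hx.injective)) h3
    rw [hR, eval_prod, ← h2, ← Finset.prod_inv_distrib]
    refine Finset.prod_congr rfl fun i _ => ?_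
    rw [← h1, hyt, eval_comp]
    simp; ring_nf
  have hRC : R = C (∏ i, w (x i))⁻¹ := by
    refine eq_of_infinite_eval_eq _ _ ((Icc_infinite (zero_lt_one' ℝ)).mono fun t ht => ?_)
    simp [hRt t ht]
  have hPn : P.natDegree = 2 * (n - 1) := natDegree_gruenwaldPoly hx.injective (hpos hxS)
  have hq : ∀ i, (P.comp (C c * X + C (x i))).natDegree = 2 * (n - 1) := fun i => by
    rw [natDegree_comp, natDegree_linear hc0, hPn, mul_one]
  have hdegR : R.natDegree = n * (2 * (n - 1)) := by
    rw [hR, natDegree_prod _ _ fun i _ h0 => by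
      have := hq i
      rw [h0, natDegree_zero] at this
      omega]
    simp [hq]
  rw [hRC, natDegree_C] at hdegR
  have : 0 < n * (2 * (n - 1)) := Nat.mul_pos (by omega) (by omega)
  omega

theorem gruenwaldBound_of_weightedDisc_le {n : ℕ} (hn : 2 ≤ n) {S : Set ℝ} (hS : IsOpen S)
    (hS' : S.OrdConnected) {w : ℝ → ℝ} (hd : DifferentiableOn ℝ w S) (hw : ∀ t ∈ S, 0 < w t)
    (hder : HasNonnegDeriv (2 * n) (fun t => 1 / w t) S) {x : Fin n → ℝ}
    (hx : Function.Injective x) (hxS : ∀ k, x k ∈ S)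
    (h : ∀ z : Fin n → ℝ, (∀ k, z k ∈ S) → weightedDisc w z ≤ weightedDisc w x) :
    GruenwaldBound S w x :=
  gruenwaldBound_of_fejerConst (by omega) hx hS hS' hd hw hxS hder
    (fejerConst_eq_zero_of_weightedDisc_le hx hS hd hw hxS h)

theorem isUniqueFekete_of_isFekete {n : ℕ} (hn : 2 ≤ n) {S : Set ℝ} (hS : IsOpen S)
    (hS' : S.OrdConnected) {w : ℝ → ℝ} (hd : DifferentiableOn ℝ w S) (hw : ∀ t ∈ S, 0 < w t)
    (hconc : ConcaveOn ℝ S fun t => Real.log (w t))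
    (hder : HasNonnegDeriv (2 * n) (fun t => 1 / w t) S) {x : Fin n → ℝ}
    (hx : Function.Injective x) (h : IsFekete S n (rootWeight n w) x) :
    IsUniqueFekete S n (rootWeight n w) x := by
  refine ⟨h, fun z hz => ?_⟩
  obtain ⟨hxS, hxm⟩ := (isFekete_rootWeight_iff hn hw).1 h
  obtain ⟨hzS, hzm⟩ := (isFekete_rootWeight_iff hn hw).1 hz
  have heq : weightedDisc w z = weightedDisc w x := le_antisymm (hxm z hzS) (hzm x hxS)
  have hzi : Function.Injective z := by
    rw [← Matrix.det_vandermonde_ne_zero_iff]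
    intro h0
    have h1 := weightedDisc_pos (fun k => hw _ (hxS k)) hx
    rw [← heq, weightedDisc, h0] at h1
    simp at h1
  have hxs : StrictMono (x ∘ Tuple.sort x) :=
    (Tuple.monotone_sort x).strictMono_of_injective (hx.comp (Tuple.sort x).injective)
  have hzs : StrictMono (z ∘ Tuple.sort z) :=
    (Tuple.monotone_sort z).strictMono_of_injective (hzi.comp (Tuple.sort z).injective)
  have hb : GruenwaldBound S w (x ∘ Tuple.sort x) :=
    gruenwaldBound_of_weightedDisc_le hn hS hS' hd hw hder hxs.injective (fun k => hxS _)
      fun y hy => by rw [weightedDisc_comp_perm]; exact hxm y hy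
  have := eq_of_strictMono_of_weightedDisc_max hn hS'.convex hw hconc hxs hzs (fun k => hxS _)
    (fun k => hzS _) hb (by rw [weightedDisc_comp_perm, weightedDisc_comp_perm, heq])
  rw [← (Tuple.sort x).surjective.range_comp x, ← (Tuple.sort z).surjective.range_comp z, this]

/-! ### Stable interpolatory systems -/

theorem isStable_gruenwaldSystem_iff {n : ℕ} [NeZero n] {S : Set ℝ} {w : ℝ → ℝ}
    (hw : ∀ t ∈ S, 0 < w t) {x : Fin n → ℝ} (hx : Function.Injective x) (hxS : ∀ k, x k ∈ S) :
    IsStable S w x (gruenwaldSystem x) ↔ GruenwaldBound S w x := by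
  have hq : ∀ k t, (gruenwaldSystem x k).eval t = (fundPoly x k).eval t ^ 2 := fun k t => by
    rw [gruenwaldSystem, eval_pow]
  constructor
  · intro h t ht
    simpa [hq] using (h.2 1 (fun _ => zero_le_one) t ht).2
  · intro h
    refine ⟨⟨hx, hxS, fun k i => ?_⟩, fun y hy t ht => ⟨?_, ?_⟩⟩
    · rw [hq, eval_fundPoly hx]; split_ifs <;> simp
    · refine mul_nonneg (hw t ht).le (Finset.sum_nonneg fun k _ => ?_)
      rw [hq]
      exact mul_nonneg (div_nonneg (sq_nonneg _) (hw _ (hxS k)).le) (hy k)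
    · have hle : ∀ k, y k ≤ ⨆ k, y k := le_ciSup (Set.finite_range y).bddAbove
      have hsup : 0 ≤ ⨆ k, y k := (hy 0).trans (hle 0)
      calc w t * ∑ k, (gruenwaldSystem x k).eval t / w (x k) * y k
          ≤ w t * ∑ k, (fundPoly x k).eval t ^ 2 / w (x k) * ⨆ k, y k := by
            refine mul_le_mul_of_nonneg_left (Finset.sum_le_sum fun k _ => ?_) (hw t ht).le
            rw [hq]
            exact mul_le_mul_of_nonneg_left (hle k) (div_nonneg (sq_nonneg _) (hw _ (hxS k)).le)
        _ = (w t * ∑ k, (fundPoly x k).eval t ^ 2 / w (x k)) * ⨆ k, y k := by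
            rw [← Finset.sum_mul, mul_assoc]
        _ ≤ ⨆ k, y k := mul_le_of_le_one_left hsup (h t ht)

/-- The polynomials of a stable system are nonnegative, so all their zeros at interior nodes are
double. -/
theorem IsStable.le_natDegree {n : ℕ} {S : Set ℝ} (hS : IsOpen S) {w : ℝ → ℝ}
    (hw : ∀ t ∈ S, 0 < w t) {x : Fin n → ℝ} {q : Fin n → ℝ[X]} (h : IsStable S w x q)
    (k : Fin n) : 2 * (n - 1) ≤ (q k).natDegree := by
  obtain ⟨⟨hx, hxS, hq⟩, hst⟩ := h
  have hnn : ∀ t ∈ S, 0 ≤ (q k).eval t := by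
    intro t ht
    have h1 := (hst (Pi.single k 1)
      (fun j => by by_cases hj : j = k <;> simp [hj]) t ht).1
    rw [Finset.sum_eq_single k (by intro j _ hj; simp [hj]) (by simp),
      Pi.single_eq_same, mul_one] at h1
    have h2 := nonneg_of_mul_nonneg_right h1 (hw t ht)
    simpa using (le_div_iff₀ (hw _ (hxS k))).1 h2
  have hq0 : q k ≠ 0 := by
    intro h0
    have := hq k k
    simp [h0] at this
  have hdvd : ∏ i ∈ Finset.univ.erase k, (X - C (x i)) ^ 2 ∣ q k := by
    refine Finset.prod_dvd_of_coprime (fun i _ j _ hij => ?_) fun i hi => ?_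
    · exact (pairwise_coprime_X_sub_C hx hij).pow
    · have hik : k ≠ i := (Finset.ne_of_mem_erase hi).symm
      have h0 : (q k).eval (x i) = 0 := by rw [hq, if_neg hik]
      have hmin : IsLocalMin (fun t => (q k).eval t) (x i) := by
        filter_upwards [hS.mem_nhds (hxS i)] with t ht
        rw [h0]; exact hnn t ht
      have h1 := hmin.hasDerivAt_eq_zero ((q k).hasDerivAt (x i))
      exact (le_rootMultiplicity_iff hq0).1
        ((one_lt_rootMultiplicity_iff_isRoot hq0).2 ⟨h0, h1⟩)
  have := natDegree_le_of_dvd hdvd hq0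
  rw [natDegree_prod _ _ fun i _ => pow_ne_zero 2 (X_sub_C_ne_zero _)] at this
  simpa [Finset.card_erase_of_mem, mul_comm] using this

theorem isStableMostEconomical_gruenwaldSystem_iff {n : ℕ} [NeZero n] {S : Set ℝ} (hS : IsOpen S)
    {w : ℝ → ℝ} (hw : ∀ t ∈ S, 0 < w t) {x : Fin n → ℝ} (hx : Function.Injective x)
    (hxS : ∀ k, x k ∈ S) :
    IsStableMostEconomical S w x (gruenwaldSystem x) ↔ GruenwaldBound S w x := by
  rw [IsStableMostEconomical, isStable_gruenwaldSystem_iff hw hx hxS, and_iff_left_iff_imp]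
  intro _ x' q' h'
  refine Finset.sum_le_sum fun k _ => ?_
  rw [gruenwaldSystem, natDegree_pow, natDegree_fundPoly hx]
  exact h'.le_natDegree hS hw k

/-! ### Existence of the Mhaskar-Rakhmanov-Saff interval -/

/-- The pairs `(c, r)` for which `[c - r, c + r] ⊆ S`. -/
def discDomain (S : Set ℝ) : Set (ℝ × ℝ) := {p | p.1 - p.2 ∈ S ∧ p.1 + p.2 ∈ S}

theorem add_mul_cos_mem {S : Set ℝ} (hS : S.OrdConnected) {c r : ℝ} (h : (c, r) ∈ discDomain S)
    (θ : ℝ) : c + r * Real.cos θ ∈ S := by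
  have h1 := Real.neg_one_le_cos θ
  have h2 := Real.cos_le_one θ
  have hsub := hS.uIcc_subset h.1 h.2
  apply hsub
  rw [mem_uIcc]
  rcases le_total 0 r with hr | hr
  · left; constructor <;> simp only <;> nlinarith
  · right; constructor <;> simp only <;> nlinarith

theorem continuous_comp_cos {S : Set ℝ} (hS : S.OrdConnected) {q : ℝ → ℝ} (hq : ContinuousOn q S)
    {c r : ℝ} (h : (c, r) ∈ discDomain S) : Continuous fun θ => q (c + r * Real.cos θ) :=
  hq.comp_continuous (by fun_prop) fun θ => add_mul_cos_mem hS h θ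

/-- `∫_0^π cos θ q(c + r cos θ) dθ`, the first Fourier cosine coefficient. -/
noncomputable def cosInt (q : ℝ → ℝ) (p : ℝ × ℝ) : ℝ :=
  ∫ θ in (0 : ℝ)..Real.pi, Real.cos θ * q (p.1 + p.2 * Real.cos θ)

/-- `∫_0^π q(c + r cos θ) dθ`. -/
noncomputable def meanInt (q : ℝ → ℝ) (p : ℝ × ℝ) : ℝ :=
  ∫ θ in (0 : ℝ)..Real.pi, q (p.1 + p.2 * Real.cos θ)

theorem continuousOn_integral_comp_cos {S : Set ℝ} (hS : S.OrdConnected) {q : ℝ → ℝ}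
    (hq : ContinuousOn q S) {φ : ℝ → ℝ} (hφ : Continuous φ) :
    ContinuousOn (fun p : ℝ × ℝ => ∫ θ in (0 : ℝ)..Real.pi, φ θ * q (p.1 + p.2 * Real.cos θ))
      (discDomain S) := by
  rw [continuousOn_iff_continuous_domRestrict] at *
  apply intervalIntegral.continuous_parametric_intervalIntegral_of_continuous' _ _ _
  have h (y : discDomain S × ℝ) : y.1.1.1 + y.1.1.2 * Real.cos y.2 ∈ S :=
    add_mul_cos_mem hS y.1.2 _
  have h1 : Continuous fun y : discDomain S × ℝ => q (y.1.1.1 + y.1.1.2 * Real.cos y.2) :=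
    hq.comp (f := fun y : discDomain S × ℝ =>
      (⟨y.1.1.1 + y.1.1.2 * Real.cos y.2, h y⟩ : S)) (by fun_prop)
  exact (hφ.comp continuous_snd).mul h1

theorem continuousOn_cosInt {S : Set ℝ} (hS : S.OrdConnected) {q : ℝ → ℝ} (hq : ContinuousOn q S) :
    ContinuousOn (cosInt q) (discDomain S) :=
  continuousOn_integral_comp_cos hS hq Real.continuous_cos

theorem continuousOn_meanInt {S : Set ℝ} (hS : S.OrdConnected) {q : ℝ → ℝ}
    (hq : ContinuousOn q S) : ContinuousOn (meanInt q) (discDomain S) := by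
  have := continuousOn_integral_comp_cos hS hq (φ := fun _ => 1) continuous_const
  simp only [one_mul] at this
  exact this

theorem discDomain_mono {S : Set ℝ} (hS : S.OrdConnected) {c r s : ℝ} (h : (c, s) ∈ discDomain S)
    (hr : 0 ≤ r) (hrs : r ≤ s) : (c, r) ∈ discDomain S := by
  have h1 := h.1
  have h2 := h.2
  simp only at h1 h2
  exact ⟨hS.out h1 h2 ⟨by simp only; linarith, by simp only; linarith⟩,
    hS.out h1 h2 ⟨by simp only; linarith, by simp only; linarith⟩⟩

theorem mem_of_mem_discDomain {S : Set ℝ} (hS : S.OrdConnected) {c r : ℝ}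
    (h : (c, r) ∈ discDomain S) : c ∈ S := by
  have := add_mul_cos_mem hS h (Real.pi / 2)
  simpa using this

theorem cosInt_eq {S : Set ℝ} (hS : S.OrdConnected) {q : ℝ → ℝ} (hq : ContinuousOn q S)
    {c r : ℝ} (h : (c, r) ∈ discDomain S) :
    cosInt q (c, r) =
      ∫ θ in (0 : ℝ)..Real.pi, Real.cos θ * (q (c + r * Real.cos θ) - q c) := by
  have hc : Continuous fun θ => Real.cos θ * q (c + r * Real.cos θ) :=
    Real.continuous_cos.mul (continuous_comp_cos hS hq h)
  have hc' : Continuous fun θ => Real.cos θ * q c := by fun_prop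
  simp_rw [mul_sub]
  rw [intervalIntegral.integral_sub (hc.intervalIntegrable _ _) (hc'.intervalIntegrable _ _),
    intervalIntegral.integral_mul_const, integral_cos]
  simp [cosInt]

theorem cos_mul_sub_nonneg {S : Set ℝ} (hS : S.OrdConnected) {q : ℝ → ℝ} (hq : MonotoneOn q S)
    {c r : ℝ} (h : (c, r) ∈ discDomain S) (hr : 0 ≤ r) (θ : ℝ) :
    0 ≤ Real.cos θ * (q (c + r * Real.cos θ) - q c) := by
  have hc := mem_of_mem_discDomain hS h
  have hm := add_mul_cos_mem hS h θ
  rcases le_total 0 (Real.cos θ) with h0 | h0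
  · exact mul_nonneg h0 (sub_nonneg.2 (hq hc hm (by nlinarith)))
  · exact mul_nonneg_of_nonpos_of_nonpos h0 (sub_nonpos.2 (hq hm hc (by nlinarith)))

theorem cosInt_mono {S : Set ℝ} (hS : S.OrdConnected) {q : ℝ → ℝ} (hqc : ContinuousOn q S)
    (hq : MonotoneOn q S) {c r s : ℝ} (h : (c, s) ∈ discDomain S) (hr : 0 ≤ r) (hrs : r ≤ s) :
    cosInt q (c, r) ≤ cosInt q (c, s) := by
  have h' := discDomain_mono hS h hr hrs
  refine intervalIntegral.integral_mono_on Real.pi_pos.le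
    ((Real.continuous_cos.mul (continuous_comp_cos hS hqc h')).intervalIntegrable _ _)
    ((Real.continuous_cos.mul (continuous_comp_cos hS hqc h)).intervalIntegrable _ _) fun θ _ => ?_
  have hm := add_mul_cos_mem hS h θ
  have hm' := add_mul_cos_mem hS h' θ
  rcases le_total 0 (Real.cos θ) with h0 | h0
  · exact mul_le_mul_of_nonneg_left (hq hm' hm (by simp only; nlinarith)) h0
  · exact mul_le_mul_of_nonpos_left (hq hm hm' (by simp only; nlinarith)) h0

theorem mul_cosInt_lt {S : Set ℝ} (hS : S.OrdConnected) {q : ℝ → ℝ} (hqc : ContinuousOn q S)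
    (hq : MonotoneOn q S) {c r s : ℝ} (h : (c, s) ∈ discDomain S) (hr : 0 ≤ r) (hrs : r < s)
    (hpos : 0 < r * cosInt q (c, r)) : r * cosInt q (c, r) < s * cosInt q (c, s) := by
  have h1 := cosInt_mono hS hqc hq h hr hrs.le
  have h2 : 0 < cosInt q (c, r) := pos_of_mul_pos_right hpos hr
  calc r * cosInt q (c, r) < s * cosInt q (c, r) := mul_lt_mul_of_pos_right hrs h2
    _ ≤ s * cosInt q (c, s) := mul_le_mul_of_nonneg_left h1 (hr.trans hrs.le)

/-- By monotonicity of `q`, replacing `|cos θ|` by `sin θ` decreases the integral, which can then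
be computed. -/
theorem le_mul_cosInt {S : Set ℝ} (hS : S.OrdConnected) {Q q : ℝ → ℝ}
    (hQ : ∀ t ∈ S, HasDerivAt Q (q t) t) (hqc : ContinuousOn q S) (hq : MonotoneOn q S) {c r : ℝ}
    (h : (c, r) ∈ discDomain S) (hr : 0 ≤ r) :
    Q (c + r) + Q (c - r) - 2 * Q c ≤ r * cosInt q (c, r) := by
  have hcc := continuous_comp_cos hS hqc h
  have hmem := add_mul_cos_mem hS h
  have hqm : ∀ {θ φ : ℝ}, Real.cos θ ≤ Real.cos φ →
      q (c + r * Real.cos θ) ≤ q (c + r * Real.cos φ) := fun hle =>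
    hq (hmem _) (hmem _) (by nlinarith)
  have hcq : Continuous fun θ => Real.cos θ * q (c + r * Real.cos θ) :=
    Real.continuous_cos.mul hcc
  have hsq : Continuous fun θ => Real.sin θ * q (c + r * Real.cos θ) :=
    Real.continuous_sin.mul hcc
  have hprim : ∀ u v : ℝ, ∫ θ in u..v, Real.sin θ * q (c + r * Real.cos θ) * r =
      Q (c + r * Real.cos u) - Q (c + r * Real.cos v) := by
    intro u v
    have hd : ∀ θ ∈ uIcc u v, HasDerivAt (fun θ => - Q (c + r * Real.cos θ))
        (Real.sin θ * q (c + r * Real.cos θ) * r) θ := by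
      intro θ _
      have h1 : HasDerivAt (fun θ => c + r * Real.cos θ) (r * (-Real.sin θ)) θ :=
        ((Real.hasDerivAt_cos θ).const_mul r).const_add c
      have h2 := ((hQ _ (hmem θ)).comp θ h1).neg
      refine h2.congr_deriv ?_
      ring
    rw [intervalIntegral.integral_eq_sub_of_hasDerivAt hd
      (((Real.continuous_sin.mul hcc).mul continuous_const).intervalIntegrable _ _)]
    ring
  have hii : ∀ {f : ℝ → ℝ}, Continuous f → ∀ u v, IntervalIntegrable f volume u v :=
    fun hf u v => hf.intervalIntegrable u v
  -- the half where `cos` is nonnegative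
  have hA : ∫ θ in (0 : ℝ)..(Real.pi / 2), Real.sin θ * q (c + r * Real.cos θ) ≤
      ∫ θ in (0 : ℝ)..(Real.pi / 2), Real.cos θ * q (c + r * Real.cos θ) := by
    set t₀ := c + r * Real.cos (Real.pi / 4)
    have h0 : ∫ θ in (0 : ℝ)..(Real.pi / 2), (Real.cos θ - Real.sin θ) * q t₀ = 0 := by
      rw [intervalIntegral.integral_mul_const, intervalIntegral.integral_sub
        (hii Real.continuous_cos _ _) (hii Real.continuous_sin _ _), integral_cos, integral_sin]
      simp
    have h1 : ∫ θ in (0 : ℝ)..(Real.pi / 2), (Real.cos θ - Real.sin θ) * q t₀ ≤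
        ∫ θ in (0 : ℝ)..(Real.pi / 2), (Real.cos θ - Real.sin θ) * q (c + r * Real.cos θ) := by
      refine intervalIntegral.integral_mono_on (by positivity) (hii (by fun_prop) _ _)
        (hii ((Real.continuous_cos.sub Real.continuous_sin).mul hcc) _ _) fun θ hθ => ?_
      rcases le_total θ (Real.pi / 4) with hle | hle
      · have hcos : Real.cos (Real.pi / 4) ≤ Real.cos θ :=
          Real.cos_le_cos_of_nonneg_of_le_pi hθ.1 (by linarith [Real.pi_pos]) hle
        have hsin : Real.sin θ ≤ Real.sin (Real.pi / 4) :=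
          Real.sin_le_sin_of_le_of_le_pi_div_two (by linarith [hθ.1, Real.pi_pos])
            (by linarith [Real.pi_pos]) hle
        rw [Real.sin_pi_div_four] at hsin
        refine mul_le_mul_of_nonneg_left (hqm hcos) ?_
        rw [Real.cos_pi_div_four] at hcos
        linarith
      · have hcos : Real.cos θ ≤ Real.cos (Real.pi / 4) :=
          Real.cos_le_cos_of_nonneg_of_le_pi (by positivity) (by linarith [hθ.2, Real.pi_pos]) hle
        have hsin : Real.sin (Real.pi / 4) ≤ Real.sin θ :=
          Real.sin_le_sin_of_le_of_le_pi_div_two (by linarith [Real.pi_pos]) hθ.2 hle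
        rw [Real.sin_pi_div_four] at hsin
        refine mul_le_mul_of_nonpos_left (hqm hcos) ?_
        rw [Real.cos_pi_div_four] at hcos
        linarith
    rw [h0] at h1
    simp_rw [sub_mul] at h1
    rw [intervalIntegral.integral_sub (hii hcq _ _) (hii hsq _ _)] at h1
    linarith
  -- the half where `cos` is nonpositive
  have hB : - ∫ θ in (Real.pi / 2)..Real.pi, Real.sin θ * q (c + r * Real.cos θ) ≤
      ∫ θ in (Real.pi / 2)..Real.pi, Real.cos θ * q (c + r * Real.cos θ) := by
    set t₀ := c + r * Real.cos (Real.pi - Real.pi / 4)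
    have h0 : ∫ θ in (Real.pi / 2)..Real.pi, (Real.cos θ + Real.sin θ) * q t₀ = 0 := by
      rw [intervalIntegral.integral_mul_const, intervalIntegral.integral_add
        (hii Real.continuous_cos _ _) (hii Real.continuous_sin _ _), integral_cos, integral_sin]
      simp
    have h1 : ∫ θ in (Real.pi / 2)..Real.pi, (Real.cos θ + Real.sin θ) * q t₀ ≤
        ∫ θ in (Real.pi / 2)..Real.pi, (Real.cos θ + Real.sin θ) * q (c + r * Real.cos θ) := by
      refine intervalIntegral.integral_mono_on (by linarith [Real.pi_pos]) (hii (by fun_prop) _ _)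
        (hii ((Real.continuous_cos.add Real.continuous_sin).mul hcc) _ _) fun θ hθ => ?_
      have hs := Real.sin_pi_sub θ
      rcases le_total (Real.pi - Real.pi / 4) θ with hle | hle
      · have hcos : Real.cos θ ≤ Real.cos (Real.pi - Real.pi / 4) :=
          Real.cos_le_cos_of_nonneg_of_le_pi (by linarith [Real.pi_pos]) hθ.2 hle
        have hsin : Real.sin (Real.pi - θ) ≤ Real.sin (Real.pi / 4) :=
          Real.sin_le_sin_of_le_of_le_pi_div_two (by linarith [hθ.2, Real.pi_pos])
            (by linarith [Real.pi_pos]) (by linarith)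
        rw [Real.sin_pi_div_four, hs] at hsin
        refine mul_le_mul_of_nonpos_left (hqm hcos) ?_
        rw [Real.cos_pi_sub, Real.cos_pi_div_four] at hcos
        linarith
      · have hcos : Real.cos (Real.pi - Real.pi / 4) ≤ Real.cos θ :=
          Real.cos_le_cos_of_nonneg_of_le_pi (by linarith [hθ.1, Real.pi_pos])
            (by linarith [Real.pi_pos]) hle
        have hsin : Real.sin (Real.pi / 4) ≤ Real.sin (Real.pi - θ) :=
          Real.sin_le_sin_of_le_of_le_pi_div_two (by linarith [Real.pi_pos]) (by linarith [hθ.1])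
            (by linarith)
        rw [Real.sin_pi_div_four, hs] at hsin
        refine mul_le_mul_of_nonneg_left (hqm hcos) ?_
        rw [Real.cos_pi_sub, Real.cos_pi_div_four] at hcos
        linarith
    rw [h0] at h1
    simp_rw [add_mul] at h1
    rw [intervalIntegral.integral_add (hii hcq _ _) (hii hsq _ _)] at h1
    linarith
  have hsplit : cosInt q (c, r) =
      (∫ θ in (0 : ℝ)..(Real.pi / 2), Real.cos θ * q (c + r * Real.cos θ)) +
      ∫ θ in (Real.pi / 2)..Real.pi, Real.cos θ * q (c + r * Real.cos θ) :=
    (intervalIntegral.integral_add_adjacent_intervals (hii hcq _ _) (hii hcq _ _)).symm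
  have hp1 := hprim 0 (Real.pi / 2)
  have hp2 := hprim (Real.pi / 2) Real.pi
  rw [intervalIntegral.integral_mul_const] at hp1 hp2
  simp only [Real.cos_zero, Real.cos_pi_div_two, Real.cos_pi, mul_one, mul_zero, add_zero,
    mul_neg] at hp1 hp2
  have hA' := mul_le_mul_of_nonneg_right hA hr
  have hB' := mul_le_mul_of_nonneg_right hB hr
  rw [← sub_eq_add_neg] at hp2
  rw [hsplit]
  linarith

/-- `Q` tends to `+∞` at the right end of `S`. -/
def BlowsUpRight (S : Set ℝ) (Q : ℝ → ℝ) : Prop :=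
  ∀ M : ℝ, ∃ t₀ ∈ S, ∀ t ∈ S, t₀ ≤ t → M ≤ Q t

/-- `Q` tends to `+∞` at the left end of `S`. -/
def BlowsUpLeft (S : Set ℝ) (Q : ℝ → ℝ) : Prop :=
  ∀ M : ℝ, ∃ t₀ ∈ S, ∀ t ∈ S, t ≤ t₀ → M ≤ Q t

theorem exists_forall_le_of_blowsUp {S : Set ℝ} (hS : S.OrdConnected) {Q : ℝ → ℝ}
    (hQ : ContinuousOn Q S) (hr : BlowsUpRight S Q) (hl : BlowsUpLeft S Q) {c : ℝ} (hc : c ∈ S) :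
    ∃ m ∈ S, ∀ t ∈ S, Q m ≤ Q t := by
  obtain ⟨t₁, ht₁, h₁⟩ := hr (Q c)
  obtain ⟨t₂, ht₂, h₂⟩ := hl (Q c)
  have hsub : Icc (min t₂ c) (max t₁ c) ⊆ S :=
    hS.out (by rcases min_choice t₂ c with h | h <;> rwa [h])
      (by rcases max_choice t₁ c with h | h <;> rwa [h])
  obtain ⟨m, hm, hmin⟩ := isCompact_Icc.exists_isMinOn
    ⟨c, min_le_right _ _, le_max_right _ _⟩ (hQ.mono hsub)
  refine ⟨m, hsub hm, fun t ht => ?_⟩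
  have hmc : Q m ≤ Q c := hmin ⟨min_le_right _ _, le_max_right _ _⟩
  rcases le_total t (min t₂ c) with h | h
  · exact hmc.trans (h₂ t ht (h.trans (min_le_left _ _)))
  · rcases le_total t (max t₁ c) with h' | h'
    · exact hmin ⟨h, h'⟩
    · exact hmc.trans (h₁ t ht ((le_max_left _ _).trans h'))

section Existence

variable {S : Set ℝ} {Q q : ℝ → ℝ}

theorem exists_mem_discDomain_le (hSo : IsOpen S) (hS : S.OrdConnected)
    (hQ : ∀ t ∈ S, HasDerivAt Q (q t) t) (hqc : ContinuousOn q S) (hq : MonotoneOn q S)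
    (hr : BlowsUpRight S Q) (hl : BlowsUpLeft S Q) {c : ℝ} (hc : c ∈ S) (N : ℝ) :
    ∃ r, 0 < r ∧ (c, r) ∈ discDomain S ∧ N ≤ r * cosInt q (c, r) := by
  have hQc : ContinuousOn Q S := fun t ht => (hQ t ht).continuousAt.continuousWithinAt
  obtain ⟨m, hm, hmin⟩ := exists_forall_le_of_blowsUp hS hQc hr hl hc
  obtain ⟨t₁, ht₁, h₁⟩ := hr (N + 2 * Q c - Q m)
  obtain ⟨t₂, ht₂, h₂⟩ := hl (N + 2 * Q c - Q m)
  obtain ⟨t₃, ht₃S, ht₃⟩ : ∃ t ∈ S, c < t := by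
    obtain ⟨ε, hε, hb⟩ := Metric.isOpen_iff.1 hSo c hc
    refine ⟨c + ε / 2, hb ?_, by linarith⟩
    rw [Metric.mem_ball, Real.dist_eq, abs_lt]
    constructor <;> linarith
  obtain ⟨t₄, ht₄S, ht₄⟩ : ∃ t ∈ S, t < c := by
    obtain ⟨ε, hε, hb⟩ := Metric.isOpen_iff.1 hSo c hc
    refine ⟨c - ε / 2, hb ?_, by linarith⟩
    rw [Metric.mem_ball, Real.dist_eq, abs_lt]
    constructor <;> linarith
  set u := max t₁ t₃ with hu
  set v := min t₂ t₄ with hv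
  have huS : u ∈ S := by rcases max_choice t₁ t₃ with h | h <;> rw [hu, h] <;> assumption
  have hvS : v ∈ S := by rcases min_choice t₂ t₄ with h | h <;> rw [hv, h] <;> assumption
  have huc : c < u := ht₃.trans_le (le_max_right _ _)
  have hvc : v < c := (min_le_right _ _).trans_lt ht₄
  have hsub : Icc v u ⊆ S := hS.out hvS huS
  rcases le_total (u - c) (c - v) with hle | hle
  · have hd : (c, u - c) ∈ discDomain S :=
      ⟨hsub ⟨by simp only; linarith, by simp only; linarith⟩,
        hsub ⟨by simp only; linarith, by simp only; linarith⟩⟩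
    refine ⟨u - c, by linarith, hd, ?_⟩
    have h3 := le_mul_cosInt hS hQ hqc hq hd (by linarith)
    have h4 := h₁ (c + (u - c)) hd.2 (by rw [add_sub_cancel]; exact le_max_left _ _)
    have h5 := hmin _ hd.1
    simp only at h5
    linarith
  · have hd : (c, c - v) ∈ discDomain S :=
      ⟨hsub ⟨by simp only; linarith, by simp only; linarith⟩,
        hsub ⟨by simp only; linarith, by simp only; linarith⟩⟩
    refine ⟨c - v, by linarith, hd, ?_⟩
    have h3 := le_mul_cosInt hS hQ hqc hq hd (by linarith)
    have h4 := h₂ (c - (c - v)) hd.1 (by rw [sub_sub_cancel]; exact min_le_left _ _)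
    have h5 := hmin _ hd.2
    simp only at h5
    linarith

/-- For each centre there is a radius for which the integral of `cos θ q(c + r cos θ)` has
the prescribed value `N / r`. -/
theorem exists_radius (hSo : IsOpen S) (hS : S.OrdConnected)
    (hQ : ∀ t ∈ S, HasDerivAt Q (q t) t) (hqc : ContinuousOn q S) (hq : MonotoneOn q S)
    (hr : BlowsUpRight S Q) (hl : BlowsUpLeft S Q) {N : ℝ} (hN : 0 < N) {c : ℝ} (hc : c ∈ S) :
    ∃ r, 0 < r ∧ (c, r) ∈ discDomain S ∧ r * cosInt q (c, r) = N := by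
  obtain ⟨R, hR, hd, hle⟩ := exists_mem_discDomain_le hSo hS hQ hqc hq hr hl hc N
  have hcont : ContinuousOn (fun r => r * cosInt q (c, r)) (Icc 0 R) := by
    refine continuousOn_id.mul ((continuousOn_cosInt hS hqc).comp
      (f := fun r : ℝ => (c, r)) (by fun_prop) fun r hr => ?_)
    exact discDomain_mono hS hd hr.1 hr.2
  obtain ⟨r, hrm, hreq⟩ := intermediate_value_Icc hR.le hcont ⟨by simpa using hN.le, hle⟩
  simp only at hreq
  refine ⟨r, lt_of_le_of_ne hrm.1 ?_, discDomain_mono hS hd hrm.1 hrm.2, hreq⟩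
  rintro rfl
  simp at hreq
  exact hN.ne hreq

/-- The radius of `exists_radius` depends continuously on the centre. -/
theorem continuousOn_radius (hSo : IsOpen S) (hS : S.OrdConnected) (hqc : ContinuousOn q S)
    (hq : MonotoneOn q S) {N : ℝ} (hN : 0 < N) {ρ : ℝ → ℝ} (hρ0 : ∀ c ∈ S, 0 < ρ c)
    (hρd : ∀ c ∈ S, (c, ρ c) ∈ discDomain S) (hρ : ∀ c ∈ S, ρ c * cosInt q (c, ρ c) = N) :
    ContinuousOn ρ S := by
  have hopen : IsOpen (discDomain S) :=
    (hSo.preimage (f := fun p : ℝ × ℝ => p.1 - p.2) (by fun_prop)).inter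
      (hSo.preimage (f := fun p : ℝ × ℝ => p.1 + p.2) (by fun_prop))
  have hcont : ∀ {c r : ℝ}, (c, r) ∈ discDomain S →
      ContinuousAt (fun c' => r * cosInt q (c', r)) c := fun {c r} h => by
    have h1 := (continuousOn_cosInt hS hqc).continuousAt (hopen.mem_nhds h)
    have h2 : ContinuousAt (fun c' : ℝ => (c', r)) c := by fun_prop
    exact continuousAt_const.mul (ContinuousAt.comp (f := fun c' : ℝ => (c', r)) h1 h2)
  have hnear : ∀ {c r : ℝ}, (c, r) ∈ discDomain S → ∀ᶠ c' in 𝓝 c, (c', r) ∈ discDomain S :=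
    fun {c r} h => by
      have h2 : ContinuousAt (fun c' : ℝ => (c', r)) c := by fun_prop
      exact h2.eventually (hopen.mem_nhds h)
  intro c hc
  apply ContinuousAt.continuousWithinAt
  rw [ContinuousAt, tendsto_order]
  constructor
  · intro u hu
    set r₁ := max u (ρ c / 2) with hr₁
    have h0 := hρ0 c hc
    have h1 : 0 < r₁ := lt_of_lt_of_le (by linarith) (le_max_right _ _)
    have h2 : r₁ < ρ c := max_lt hu (by linarith)
    have hd₁ := discDomain_mono hS (hρd c hc) h1.le h2.le
    have hlt : r₁ * cosInt q (c, r₁) < N := by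
      by_contra hge
      push Not at hge
      have := mul_cosInt_lt hS hqc hq (hρd c hc) h1.le h2 (hN.trans_le hge)
      rw [hρ c hc] at this
      linarith
    filter_upwards [(hcont hd₁).eventually (gt_mem_nhds hlt), hnear hd₁, hSo.mem_nhds hc]
      with c' hc'1 hc'2 hc'S
    refine (le_max_left u (ρ c / 2)).trans_lt (lt_of_not_ge fun hge => ?_)
    have h3 := hρ c' hc'S
    rcases eq_or_lt_of_le hge with h4 | h4
    · rw [h4] at h3; linarith
    · have := mul_cosInt_lt hS hqc hq hc'2 (hρ0 c' hc'S).le h4 (by rw [h3]; exact hN)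
      linarith
  · intro u hu
    obtain ⟨r₂, h1, h2, hd₂⟩ : ∃ r₂, ρ c < r₂ ∧ r₂ ≤ u ∧ (c, r₂) ∈ discDomain S := by
      have hcr : ContinuousAt (fun r : ℝ => (c, r)) (ρ c) := by fun_prop
      have h1 := hcr.eventually (hopen.mem_nhds (hρd c hc))
      have h2 : ∀ᶠ r in 𝓝[>] (ρ c), (c, r) ∈ discDomain S := h1.filter_mono nhdsWithin_le_nhds
      have h3 : ∀ᶠ r in 𝓝[>] (ρ c), r ∈ Ioc (ρ c) u := Ioc_mem_nhdsGT hu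
      obtain ⟨r, hr1, hr2⟩ := (h2.and h3).exists
      exact ⟨r, hr2.1, hr2.2, hr1⟩
    have hlt : N < r₂ * cosInt q (c, r₂) := by
      have h3 := hρ c hc
      have := mul_cosInt_lt hS hqc hq hd₂ (hρ0 c hc).le h1 (by rw [h3]; exact hN)
      rwa [h3] at this
    filter_upwards [(hcont hd₂).eventually (lt_mem_nhds hlt), hSo.mem_nhds hc] with c' hc'1 hc'S
    refine lt_of_lt_of_le (lt_of_not_ge fun hge => ?_) h2
    have h3 := hρ c' hc'S
    have h4 := hρ0 c hc
    rcases eq_or_lt_of_le hge with h5 | h5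
    · rw [← h5] at h3; linarith
    · have := mul_cosInt_lt hS hqc hq (hρd c' hc'S) (by linarith) h5 (by linarith)
      linarith

/-- If the centre is far to the right, then the mean of `q` over the interval is nonnegative: the
negative values of `q` occur at distance at least `c - m` from the centre, so that their
contribution is controlled by the cosine integral. -/
theorem meanInt_nonneg (hS : S.OrdConnected) (hQ : ∀ t ∈ S, HasDerivAt Q (q t) t)
    (hqc : ContinuousOn q S) (hq : MonotoneOn q S) {N : ℝ} {m c r : ℝ} (hm : m ∈ S)
    (hqm : 0 ≤ q m) (hmc : m < c) (hr : 0 < r) (hd : (c, r) ∈ discDomain S)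
    (hrN : r * cosInt q (c, r) = N) (hN : N ≤ Q c - Q m) : 0 ≤ meanInt q (c, r) := by
  have hc := mem_of_mem_discDomain hS hd
  have hcc := continuous_comp_cos hS hqc hd
  have hmv : Q c - Q m ≤ q c * (c - m) := by
    obtain ⟨ξ, hξ, hξe⟩ := exists_hasDerivAt_eq_slope Q q hmc
      (fun t ht => (hQ t (hS.out hm hc ht)).continuousAt.continuousWithinAt)
      (fun t ht => hQ t (hS.out hm hc (Ioo_subset_Icc_self ht)))
    rw [eq_div_iff (by linarith)] at hξe
    rw [← hξe]
    exact mul_le_mul_of_nonneg_right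
      (hq (hS.out hm hc (Ioo_subset_Icc_self hξ)) hc hξ.2.le) (by linarith)
  have hqc0 : 0 ≤ q c := hqm.trans (hq hm hc hmc.le)
  have hc₁ : Continuous fun θ => (c - m) * q (c + r * Real.cos θ) := continuous_const.mul hcc
  have hc₂ : Continuous fun θ => r * (Real.cos θ * (q (c + r * Real.cos θ) - q c)) :=
    continuous_const.mul (Real.continuous_cos.mul (hcc.sub continuous_const))
  have hint : ∀ u v : ℝ, IntervalIntegrable
      (fun θ => (c - m) * q (c + r * Real.cos θ) +
        r * (Real.cos θ * (q (c + r * Real.cos θ) - q c))) volume u v := fun u v =>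
    (hc₁.add hc₂).intervalIntegrable u v
  -- pointwise lower bounds on the two halves
  have h1 : ∫ θ in (0 : ℝ)..(Real.pi / 2), (c - m) * q c ≤
      ∫ θ in (0 : ℝ)..(Real.pi / 2), ((c - m) * q (c + r * Real.cos θ) +
        r * (Real.cos θ * (q (c + r * Real.cos θ) - q c))) := by
    refine intervalIntegral.integral_mono_on (by positivity) (by simp) (hint _ _) fun θ hθ => ?_
    have h0 : 0 ≤ Real.cos θ :=
      Real.cos_nonneg_of_mem_Icc ⟨by linarith [hθ.1, Real.pi_pos], hθ.2⟩
    have h2 := hq hc (add_mul_cos_mem hS hd θ) (by nlinarith)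
    have h3 := mul_nonneg hr.le (cos_mul_sub_nonneg hS hq hd hr.le θ)
    have h4 := mul_le_mul_of_nonneg_left h2 (sub_nonneg.2 hmc.le)
    linarith
  have h2 : ∫ θ in (Real.pi / 2)..Real.pi, (0 : ℝ) ≤
      ∫ θ in (Real.pi / 2)..Real.pi, ((c - m) * q (c + r * Real.cos θ) +
        r * (Real.cos θ * (q (c + r * Real.cos θ) - q c))) := by
    refine intervalIntegral.integral_mono_on (by linarith [Real.pi_pos]) (by simp) (hint _ _)
      fun θ _ => ?_
    have ht := add_mul_cos_mem hS hd θ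
    have h3 := mul_nonneg hr.le (cos_mul_sub_nonneg hS hq hd hr.le θ)
    rcases le_total m (c + r * Real.cos θ) with h | h
    · have h4 := hqm.trans (hq hm ht h)
      have h5 := mul_nonneg (sub_nonneg.2 hmc.le) h4
      linarith
    · have h4 : q (c + r * Real.cos θ) ≤ q c := hq ht hc (h.trans hmc.le)
      nlinarith
  have h3 := add_le_add h1 h2
  rw [intervalIntegral.integral_add_adjacent_intervals (hint _ _) (hint _ _),
    intervalIntegral.integral_add (hc₁.intervalIntegrable _ _) (hc₂.intervalIntegrable _ _),
    intervalIntegral.integral_const_mul (c - m) fun θ => q (c + r * Real.cos θ),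
    intervalIntegral.integral_const_mul r fun θ => Real.cos θ * (q (c + r * Real.cos θ) - q c),
    ← cosInt_eq hS hqc hd, hrN] at h3
  simp only [intervalIntegral.integral_const, smul_eq_mul, mul_zero, add_zero, sub_zero] at h3
  have h4 : 0 ≤ (c - m) * meanInt q (c, r) := by
    have h5 : q c * (c - m) ≤ Real.pi / 2 * ((c - m) * q c) := by
      have := mul_nonneg (sub_nonneg.2 hmc.le) hqc0
      nlinarith [Real.pi_gt_three]
    simp only [meanInt]
    linarith
  exact nonneg_of_mul_nonneg_right h4 (sub_pos.2 hmc)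

theorem cosInt_reflect (q : ℝ → ℝ) (c r : ℝ) :
    cosInt (fun t => -q (-t)) (-c, r) = cosInt q (c, r) := by
  have h := intervalIntegral.integral_comp_sub_left
    (fun θ => Real.cos θ * q (c + r * Real.cos θ)) (a := 0) (b := Real.pi) Real.pi
  simp only [sub_self, sub_zero] at h
  rw [cosInt, cosInt, ← h]
  refine intervalIntegral.integral_congr fun θ _ => ?_
  simp only [Real.cos_pi_sub]
  ring_nf

theorem meanInt_reflect (q : ℝ → ℝ) (c r : ℝ) :
    meanInt (fun t => -q (-t)) (-c, r) = -meanInt q (c, r) := by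
  have h := intervalIntegral.integral_comp_sub_left
    (fun θ => q (c + r * Real.cos θ)) (a := 0) (b := Real.pi) Real.pi
  simp only [sub_self, sub_zero] at h
  rw [meanInt, meanInt, ← h, ← intervalIntegral.integral_neg]
  refine intervalIntegral.integral_congr fun θ _ => ?_
  simp only [Real.cos_pi_sub]
  ring_nf

/-- The reflection of `meanInt_nonneg`. -/
theorem meanInt_nonpos (hS : S.OrdConnected) (hQ : ∀ t ∈ S, HasDerivAt Q (q t) t)
    (hqc : ContinuousOn q S) (hq : MonotoneOn q S) {N : ℝ} {m c r : ℝ} (hm : m ∈ S)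
    (hqm : q m ≤ 0) (hmc : c < m) (hr : 0 < r) (hd : (c, r) ∈ discDomain S)
    (hrN : r * cosInt q (c, r) = N) (hN : N ≤ Q c - Q m) : meanInt q (c, r) ≤ 0 := by
  have key := meanInt_nonneg (S := (fun t => -t) ⁻¹' S) (Q := fun t => Q (-t))
    (q := fun t => -q (-t)) (N := N) (m := -m) (c := -c) (r := r)
    ⟨fun u hu v hv t ht => hS.out hv hu ⟨neg_le_neg ht.2, neg_le_neg ht.1⟩⟩
    (fun t ht => by
      have := (hQ (-t) ht).comp t (hasDerivAt_neg t)
      simp only [mul_neg, mul_one] at this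
      exact this)
    ((hqc.comp continuous_neg.continuousOn fun t ht => ht).neg)
    (fun u hu v hv huv => neg_le_neg (hq hv hu (neg_le_neg huv)))
    (by simpa using hm) (by simpa using hqm) (neg_lt_neg hmc) hr
    ⟨by have := hd.2; simpa [add_comm] using this,
      by have := hd.1; simpa [add_comm, sub_eq_add_neg] using this⟩
    (by rw [cosInt_reflect]; exact hrN) (by simpa using hN)
  rw [meanInt_reflect] at key
  linarith

/-- There are a centre and a radius for which the mean of `q` vanishes and the cosine
integral has the prescribed value. -/
theorem exists_center_radius (hSo : IsOpen S) (hS : S.OrdConnected) (hne : S.Nonempty)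
    (hQ : ∀ t ∈ S, HasDerivAt Q (q t) t) (hqc : ContinuousOn q S) (hq : MonotoneOn q S)
    (hr : BlowsUpRight S Q) (hl : BlowsUpLeft S Q) {N : ℝ} (hN : 0 < N) :
    ∃ c r, 0 < r ∧ (c, r) ∈ discDomain S ∧ r * cosInt q (c, r) = N ∧ meanInt q (c, r) = 0 := by
  have hQc : ContinuousOn Q S := fun t ht => (hQ t ht).continuousAt.continuousWithinAt
  obtain ⟨m, hm, hmin⟩ := exists_forall_le_of_blowsUp hS hQc hr hl hne.some_mem
  have hqm : q m = 0 := by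
    have : IsLocalMin Q m := by
      filter_upwards [hSo.mem_nhds hm] with t ht using hmin t ht
    exact this.hasDerivAt_eq_zero (hQ m hm)
  choose! ρ hρ0 hρd hρ using fun c (hc : c ∈ S) => exists_radius hSo hS hQ hqc hq hr hl hN hc
  have hρc := continuousOn_radius hSo hS hqc hq hN hρ0 hρd hρ
  have hcont : ContinuousOn (fun c => meanInt q (c, ρ c)) S :=
    (continuousOn_meanInt hS hqc).comp (continuousOn_id.prodMk hρc) hρd
  obtain ⟨c₁, hc₁, h₁⟩ : ∃ c ∈ S, 0 ≤ meanInt q (c, ρ c) := by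
    obtain ⟨t, ht, hle⟩ := hr (N + Q m)
    have hmem : max t m ∈ S := by rcases max_choice t m with h | h <;> rwa [h]
    have h1 := hle _ hmem (le_max_left _ _)
    have h2 : m < max t m := lt_of_le_of_ne (le_max_right _ _) fun h => by
      rw [← h] at h1; linarith
    exact ⟨_, hmem, meanInt_nonneg hS hQ hqc hq hm hqm.ge h2 (hρ0 _ hmem) (hρd _ hmem)
      (hρ _ hmem) (by linarith)⟩
  obtain ⟨c₂, hc₂, h₂⟩ : ∃ c ∈ S, meanInt q (c, ρ c) ≤ 0 := by
    obtain ⟨t, ht, hle⟩ := hl (N + Q m)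
    have hmem : min t m ∈ S := by rcases min_choice t m with h | h <;> rwa [h]
    have h1 := hle _ hmem (min_le_left _ _)
    have h2 : min t m < m := lt_of_le_of_ne (min_le_right _ _) fun h => by
      rw [h] at h1; linarith
    exact ⟨_, hmem, meanInt_nonpos hS hQ hqc hq hm hqm.le h2 (hρ0 _ hmem) (hρd _ hmem)
      (hρ _ hmem) (by linarith)⟩
  obtain ⟨c, hc, hc0⟩ := hS.isPreconnected.intermediate_value hc₂ hc₁ hcont ⟨h₂, h₁⟩
  exact ⟨c, ρ c, hρ0 c hc, hρd c hc, hρ c hc, hc0⟩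

end Existence

/-- The substitution `t = c + r cos θ` in integrals against the arcsine density. -/
theorem integral_div_sqrt_eq (h : ℝ → ℝ) (c : ℝ) {r : ℝ} (hr : 0 < r) :
    ∫ t in (c - r)..(c + r), h t / √((t - (c - r)) * (c + r - t)) =
      ∫ θ in (0 : ℝ)..Real.pi, h (c + r * Real.cos θ) := by
  have himg : (fun θ => c + r * Real.cos θ) '' Ioo 0 Real.pi = Ioo (c - r) (c + r) := by
    ext t
    simp only [mem_image, mem_Ioo]
    constructor
    · rintro ⟨θ, hθ, rfl⟩
      have h1 : Real.cos θ < 1 := by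
        have := Real.cos_lt_cos_of_nonneg_of_le_pi le_rfl hθ.2.le hθ.1
        simpa using this
      have h2 : -1 < Real.cos θ := by
        have := Real.cos_lt_cos_of_nonneg_of_le_pi hθ.1.le le_rfl hθ.2
        simpa using this
      constructor <;> nlinarith
    · rintro ⟨h1, h2⟩
      have h3 : -1 < (t - c) / r := by rw [lt_div_iff₀ hr]; linarith
      have h4 : (t - c) / r < 1 := by rw [div_lt_iff₀ hr]; linarith
      refine ⟨Real.arccos ((t - c) / r), ⟨Real.arccos_pos.2 h4, ?_⟩, ?_⟩
      · refine lt_of_le_of_ne (Real.arccos_le_pi _) fun h5 => ?_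
        exact absurd (Real.arccos_eq_pi.1 h5) (not_le.2 h3)
      · rw [Real.cos_arccos h3.le h4.le]; field_simp; ring
  have hder : ∀ θ ∈ Ioo 0 Real.pi, HasDerivWithinAt (fun θ => c + r * Real.cos θ)
      (r * (-Real.sin θ)) (Ioo 0 Real.pi) θ := fun θ _ =>
    (((Real.hasDerivAt_cos θ).const_mul r).const_add c).hasDerivWithinAt
  have hinj : InjOn (fun θ => c + r * Real.cos θ) (Ioo 0 Real.pi) := by
    intro u hu v hv huv
    refine Real.injOn_cos (Ioo_subset_Icc_self hu) (Ioo_subset_Icc_self hv) ?_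
    exact mul_left_cancel₀ hr.ne' (add_left_cancel huv)
  rw [intervalIntegral.integral_of_le (by linarith), intervalIntegral.integral_of_le Real.pi_pos.le,
    integral_Ioc_eq_integral_Ioo, integral_Ioc_eq_integral_Ioo, ← himg,
    integral_image_eq_integral_abs_deriv_smul measurableSet_Ioo hder hinj]
  refine setIntegral_congr_fun measurableSet_Ioo fun θ hθ => ?_
  have hs : 0 < Real.sin θ := Real.sin_pos_of_pos_of_lt_pi hθ.1 hθ.2
  have h1 : (c + r * Real.cos θ - (c - r)) * (c + r - (c + r * Real.cos θ)) =
      (r * Real.sin θ) ^ 2 := by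
    have := Real.sin_sq_add_cos_sq θ
    linear_combination -r ^ 2 * this
  simp only [smul_eq_mul]
  rw [h1, Real.sqrt_sq (by positivity), mul_neg, abs_neg, abs_of_pos (by positivity)]
  field_simp

/-- A convex field which tends to `+∞` at both ends of `S` has a Mhaskar-Rakhmanov-Saff
interval of every order. -/
theorem exists_isMRSInterval {S : Set ℝ} (hSo : IsOpen S) (hS : S.OrdConnected) (hne : S.Nonempty)
    {w : ℝ → ℝ} (hQ : ∀ t ∈ S, HasDerivAt (extField w) (deriv (extField w) t) t)
    (hqc : ContinuousOn (deriv (extField w)) S) (hq : MonotoneOn (deriv (extField w)) S)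
    (hr : BlowsUpRight S (extField w)) (hl : BlowsUpLeft S (extField w)) {n : ℕ} (hn : 0 < n) :
    ∃ α β, IsMRSInterval S w n α β := by
  obtain ⟨c, r, hr0, hd, hcos, hmean⟩ := exists_center_radius hSo hS hne hQ hqc hq hr hl
    (N := n * Real.pi) (by positivity)
  refine ⟨c - r, c + r, hd.1, hd.2, by linarith, ?_, ?_⟩
  · rw [integral_div_sqrt_eq _ c hr0]
    rw [meanInt] at hmean
    rw [hmean, mul_zero]
  · rw [integral_div_sqrt_eq (fun t => t * deriv (extField w) t) c hr0]
    have hcc := continuous_comp_cos hS hqc hd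
    have hc₁ : Continuous fun θ => c * deriv (extField w) (c + r * Real.cos θ) :=
      continuous_const.mul hcc
    have hc₂ : Continuous fun θ => r * (Real.cos θ * deriv (extField w) (c + r * Real.cos θ)) :=
      continuous_const.mul (Real.continuous_cos.mul hcc)
    have h1 : ∀ θ, (c + r * Real.cos θ) * deriv (extField w) (c + r * Real.cos θ) =
        c * deriv (extField w) (c + r * Real.cos θ) +
          r * (Real.cos θ * deriv (extField w) (c + r * Real.cos θ)) := fun θ => by ring
    simp_rw [h1]
    rw [intervalIntegral.integral_add (hc₁.intervalIntegrable _ _) (hc₂.intervalIntegrable _ _),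
      intervalIntegral.integral_const_mul, intervalIntegral.integral_const_mul]
    simp only [meanInt, cosInt] at hmean hcos
    rw [hmean, hcos]
    field_simp [Real.pi_pos.ne']
    ring

/-! ### Approximating weights -/

theorem isOpen_openInterval (a b : EReal) : IsOpen (openInterval a b) :=
  (isOpen_lt continuous_const continuous_coe_real_ereal).inter
    (isOpen_lt continuous_coe_real_ereal continuous_const)

theorem ordConnected_openInterval (a b : EReal) : (openInterval a b).OrdConnected :=
  ⟨fun _ hu _ hv _ ht => ⟨hu.1.trans_le (EReal.coe_le_coe_iff.2 ht.1),
    (EReal.coe_le_coe_iff.2 ht.2).trans_lt hv.2⟩⟩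

theorem nonempty_openInterval {a b : EReal} (hab : a < b) : (openInterval a b).Nonempty := by
  obtain ⟨t, h1, h2⟩ := EReal.lt_iff_exists_real_btwn.1 hab
  exact ⟨t, h1, h2⟩

theorem exists_of_eventually_atTop {a : EReal} (ha : a < ⊤) {P : ℝ → Prop}
    (h : ∀ᶠ t in atTop, P t) :
    ∃ t₀ ∈ openInterval a ⊤, ∀ t ∈ openInterval a ⊤, t₀ ≤ t → P t := by
  obtain ⟨u, hu⟩ := eventually_atTop.1 h
  obtain ⟨v, hv⟩ := nonempty_openInterval ha
  exact ⟨max u v, ⟨hv.1.trans_le (EReal.coe_le_coe_iff.2 (le_max_right _ _)),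
    EReal.coe_lt_top _⟩, fun t _ ht => hu t ((le_max_left _ _).trans ht)⟩

theorem exists_of_eventually_nhdsLT {a : EReal} {b : ℝ} (ha : a < b) {P : ℝ → Prop}
    (h : ∀ᶠ t in 𝓝[<] b, P t) :
    ∃ t₀ ∈ openInterval a b, ∀ t ∈ openInterval a b, t₀ ≤ t → P t := by
  obtain ⟨u, hu, hsub⟩ := mem_nhdsLT_iff_exists_Ioo_subset.1 h
  obtain ⟨v, hv1, hv2⟩ := EReal.lt_iff_exists_real_btwn.1 (max_lt ha (EReal.coe_lt_coe_iff.2 hu))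
  refine ⟨v, ⟨(le_max_left _ _).trans_lt hv1, hv2⟩, fun t ht hvt => hsub ⟨?_, ?_⟩⟩
  · exact (EReal.coe_lt_coe_iff.1 ((le_max_right _ _).trans_lt hv1)).trans_le hvt
  · exact EReal.coe_lt_coe_iff.1 ht.2

theorem exists_of_eventually_atBot {b : EReal} (hb : ⊥ < b) {P : ℝ → Prop}
    (h : ∀ᶠ t in atBot, P t) :
    ∃ t₀ ∈ openInterval ⊥ b, ∀ t ∈ openInterval ⊥ b, t ≤ t₀ → P t := by
  obtain ⟨u, hu⟩ := eventually_atBot.1 h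
  obtain ⟨v, hv⟩ := nonempty_openInterval hb
  exact ⟨min u v, ⟨EReal.bot_lt_coe _,
    (EReal.coe_le_coe_iff.2 (min_le_right _ _)).trans_lt hv.2⟩,
    fun t _ ht => hu t (ht.trans (min_le_left _ _))⟩

theorem exists_of_eventually_nhdsGT {a : ℝ} {b : EReal} (hb : a < b) {P : ℝ → Prop}
    (h : ∀ᶠ t in 𝓝[>] a, P t) :
    ∃ t₀ ∈ openInterval a b, ∀ t ∈ openInterval a b, t ≤ t₀ → P t := by
  obtain ⟨u, hu, hsub⟩ := mem_nhdsGT_iff_exists_Ioo_subset.1 h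
  obtain ⟨v, hv1, hv2⟩ := EReal.lt_iff_exists_real_btwn.1 (lt_min hb (EReal.coe_lt_coe_iff.2 hu))
  refine ⟨v, ⟨hv1, hv2.trans_le (min_le_left _ _)⟩, fun t ht hvt => hsub ⟨?_, ?_⟩⟩
  · exact EReal.coe_lt_coe_iff.1 ht.1
  · exact hvt.trans_lt (EReal.coe_lt_coe_iff.1 (hv2.trans_le (min_le_right _ _)))

namespace IsApproximating

variable {a b : EReal} {w : ℝ → ℝ}

theorem hasDerivAt_extField (hw : IsApproximating a b w) {t : ℝ} (ht : t ∈ openInterval a b) :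
    HasDerivAt (extField w) (-(deriv w t / w t)) t :=
  (((hw.differentiable.differentiableAt ((isOpen_openInterval a b).mem_nhds ht)).hasDerivAt).log
    (hw.pos t ht).ne').neg

theorem deriv_extField (hw : IsApproximating a b w) {t : ℝ} (ht : t ∈ openInterval a b) :
    deriv (extField w) t = -(deriv w t / w t) :=
  (hw.hasDerivAt_extField ht).deriv

theorem hasDerivAt_extField' (hw : IsApproximating a b w) {t : ℝ} (ht : t ∈ openInterval a b) :
    HasDerivAt (extField w) (deriv (extField w) t) t := by
  rw [hw.deriv_extField ht]; exact hw.hasDerivAt_extField ht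

theorem deriv_weight (hw : IsApproximating a b w) {t : ℝ} (ht : t ∈ openInterval a b) :
    deriv w t = -(deriv (extField w) t * w t) := by
  rw [hw.deriv_extField ht]
  field_simp [(hw.pos t ht).ne']

theorem differentiableOn_deriv_extField (hw : IsApproximating a b w) :
    DifferentiableOn ℝ (deriv (extField w)) (openInterval a b) := by
  have h : DifferentiableOn ℝ (fun t => -(deriv w t / w t)) (openInterval a b) :=
    (hw.differentiable_deriv.div hw.differentiable fun t ht => (hw.pos t ht).ne').neg
  exact h.congr fun t ht => hw.deriv_extField ht

theorem continuousOn_deriv_extField (hw : IsApproximating a b w) :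
    ContinuousOn (deriv (extField w)) (openInterval a b) :=
  hw.differentiableOn_deriv_extField.continuousOn

theorem monotoneOn_deriv_extField (hw : IsApproximating a b w) :
    MonotoneOn (deriv (extField w)) (openInterval a b) := by
  refine monotoneOn_of_deriv_nonneg (ordConnected_openInterval a b).convex
    hw.continuousOn_deriv_extField ?_ ?_
  · rw [(isOpen_openInterval a b).interior_eq]
    exact hw.differentiableOn_deriv_extField
  · rw [(isOpen_openInterval a b).interior_eq]
    intro t ht
    have h := hw.log_convex t ht
    have he : (fun s => Real.log (1 / w s)) = extField w := by
      funext s; rw [extField, one_div, Real.log_inv]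
    rwa [he] at h

theorem concaveOn_log (hw : IsApproximating a b w) :
    ConcaveOn ℝ (openInterval a b) fun t => Real.log (w t) := by
  have h : ConvexOn ℝ (openInterval a b) (extField w) := by
    refine MonotoneOn.convexOn_of_deriv (ordConnected_openInterval a b).convex
      (fun t ht => (hw.hasDerivAt_extField ht).continuousAt.continuousWithinAt) ?_ ?_
    · exact fun t ht =>
        (hw.hasDerivAt_extField (interior_subset ht)).differentiableAt.differentiableWithinAt
    · exact hw.monotoneOn_deriv_extField.mono interior_subset
  have h2 := h.neg
  refine h2.congr fun t _ => ?_
  simp [extField]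

theorem weight_eq_exp (hw : IsApproximating a b w) {t : ℝ} (ht : t ∈ openInterval a b) :
    w t = Real.exp (-extField w t) := by
  rw [extField, neg_neg, Real.exp_log (hw.pos t ht)]

theorem tendsto_nhdsLT (hw : IsApproximating a b w) {b' : ℝ} (hb : b = b') :
    Tendsto w (𝓝[<] b') (𝓝 0) := by
  have h1 := hw.right_end b' hb
  have h2 : Tendsto (fun t => b' - t) (𝓝[<] b') (𝓝 0) := by
    have : Tendsto (fun t => b' - t) (𝓝 b') (𝓝 (b' - b')) :=
      (continuous_const.sub continuous_id).tendsto _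
    rw [sub_self] at this
    exact this.mono_left nhdsWithin_le_nhds
  have h3 := h1.mul h2
  rw [mul_zero] at h3
  refine h3.congr' ?_
  filter_upwards [self_mem_nhdsWithin] with t ht
  have : b' - t ≠ 0 := (sub_pos.2 ht).ne'
  field_simp

theorem tendsto_nhdsGT (hw : IsApproximating a b w) {a' : ℝ} (ha : a = a') :
    Tendsto w (𝓝[>] a') (𝓝 0) := by
  have h1 := hw.left_end a' ha
  have h2 : Tendsto (fun t => t - a') (𝓝[>] a') (𝓝 0) := by
    have : Tendsto (fun t => t - a') (𝓝 a') (𝓝 (a' - a')) :=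
      (continuous_id.sub continuous_const).tendsto _
    rw [sub_self] at this
    exact this.mono_left nhdsWithin_le_nhds
  have h3 := h1.mul h2
  rw [mul_zero] at h3
  refine h3.congr' ?_
  filter_upwards [self_mem_nhdsWithin] with t ht
  have : t - a' ≠ 0 := (sub_pos.2 ht).ne'
  field_simp

theorem tendsto_abs_mul (hw : IsApproximating a b w) {l : Filter ℝ} [l.NeBot]
    (hl : l ≤ Bornology.cobounded ℝ) (hS : ∀ᶠ t in l, t ∈ openInterval a b) :
    Tendsto (fun t => |t| * w t) l (𝓝 0) := by
  have hub : ¬ Bornology.IsBounded (closure (openInterval a b)) := by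
    intro hb
    have h1 : (closure (openInterval a b))ᶜ ∈ l := hl (Bornology.isBounded_def.1 hb)
    obtain ⟨t, ht1, ht2⟩ := ((Filter.eventually_mem_set.2 h1).and hS).exists
    exact ht1 (subset_closure ht2)
  have h := (hw.admissible.decay hub).mono_left
    (le_inf hl (le_principal_iff.2 (mem_of_superset hS subset_closure)))
  refine h.congr' ?_
  filter_upwards [hS] with t ht
  rw [indicator_of_mem ht]

theorem tendsto_atTop (hw : IsApproximating a ⊤ w) (ha : a < ⊤) :
    Tendsto w atTop (𝓝 0) := by
  have hS : ∀ᶠ t in (atTop : Filter ℝ), t ∈ openInterval a ⊤ := by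
    obtain ⟨u, hu⟩ := nonempty_openInterval ha
    filter_upwards [eventually_ge_atTop u] with t ht
    exact ⟨hu.1.trans_le (EReal.coe_le_coe_iff.2 ht), EReal.coe_lt_top _⟩
  have h := hw.tendsto_abs_mul IsOrderBornology.atTop_le_cobounded hS
  refine squeeze_zero' (hS.mono fun t ht => (hw.pos t ht).le) ?_ h
  filter_upwards [hS, eventually_ge_atTop 1] with t ht h1
  exact le_mul_of_one_le_left (hw.pos t ht).le (h1.trans (le_abs_self t))

theorem tendsto_atBot (hw : IsApproximating ⊥ b w) (hb : ⊥ < b) :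
    Tendsto w atBot (𝓝 0) := by
  have hS : ∀ᶠ t in (atBot : Filter ℝ), t ∈ openInterval ⊥ b := by
    obtain ⟨u, hu⟩ := nonempty_openInterval hb
    filter_upwards [eventually_le_atBot u] with t ht
    exact ⟨EReal.bot_lt_coe _, (EReal.coe_le_coe_iff.2 ht).trans_lt hu.2⟩
  have h := hw.tendsto_abs_mul IsOrderBornology.atBot_le_cobounded hS
  refine squeeze_zero' (hS.mono fun t ht => (hw.pos t ht).le) ?_ h
  filter_upwards [hS, eventually_le_atBot (-1)] with t ht h1
  exact le_mul_of_one_le_left (hw.pos t ht).le (by rw [abs_of_neg (by linarith)]; linarith)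

theorem exists_weight_lt_right (hw : IsApproximating a b w) (hab : a < b) {ε : ℝ} (hε : 0 < ε) :
    ∃ t₀ ∈ openInterval a b, ∀ t ∈ openInterval a b, t₀ ≤ t → w t < ε := by
  induction b with
  | bot => exact absurd hab not_lt_bot
  | coe b' => exact exists_of_eventually_nhdsLT hab ((hw.tendsto_nhdsLT rfl).eventually_lt_const hε)
  | top => exact exists_of_eventually_atTop hab ((hw.tendsto_atTop hab).eventually_lt_const hε)

theorem exists_weight_lt_left (hw : IsApproximating a b w) (hab : a < b) {ε : ℝ} (hε : 0 < ε) :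
    ∃ t₀ ∈ openInterval a b, ∀ t ∈ openInterval a b, t ≤ t₀ → w t < ε := by
  induction a with
  | bot => exact exists_of_eventually_atBot hab ((hw.tendsto_atBot hab).eventually_lt_const hε)
  | coe a' => exact exists_of_eventually_nhdsGT hab ((hw.tendsto_nhdsGT rfl).eventually_lt_const hε)
  | top => exact absurd hab not_top_lt

theorem le_extField_of_weight_lt (hw : IsApproximating a b w) {t M : ℝ}
    (ht : t ∈ openInterval a b) (h : w t < Real.exp (-M)) : M ≤ extField w t := by
  rw [hw.weight_eq_exp ht, Real.exp_lt_exp] at h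
  linarith

theorem blowsUpRight (hw : IsApproximating a b w) (hab : a < b) :
    BlowsUpRight (openInterval a b) (extField w) := fun M => by
  obtain ⟨t₀, ht₀, h⟩ := hw.exists_weight_lt_right hab (Real.exp_pos (-M))
  exact ⟨t₀, ht₀, fun t ht hle => hw.le_extField_of_weight_lt ht (h t ht hle)⟩

theorem blowsUpLeft (hw : IsApproximating a b w) (hab : a < b) :
    BlowsUpLeft (openInterval a b) (extField w) := fun M => by
  obtain ⟨t₀, ht₀, h⟩ := hw.exists_weight_lt_left hab (Real.exp_pos (-M))
  exact ⟨t₀, ht₀, fun t ht hle => hw.le_extField_of_weight_lt ht (h t ht hle)⟩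

theorem isOneNormal_iff (hw : IsApproximating a b w) (hab : a < b) {n : ℕ} (hn : 0 < n)
    (x : Fin n → ℝ) :
    IsOneNormal (openInterval a b) w x ↔ GruenwaldBound (openInterval a b) w x := by
  refine ⟨fun h => h.2, fun h => ⟨?_, h⟩⟩
  obtain ⟨α, β, hαβ⟩ := exists_isMRSInterval (isOpen_openInterval a b)
    (ordConnected_openInterval a b) (nonempty_openInterval hab)
    (fun t ht => hw.hasDerivAt_extField' ht) hw.continuousOn_deriv_extField
    hw.monotoneOn_deriv_extField (hw.blowsUpRight hab) (hw.blowsUpLeft hab) hn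
  have hA : 0 < max |α| |β| := by
    by_contra hle
    push Not at hle
    have h1 := abs_eq_zero.1 (le_antisymm ((le_max_left _ _).trans hle) (abs_nonneg α))
    have h2 := abs_eq_zero.1 (le_antisymm ((le_max_right _ _).trans hle) (abs_nonneg β))
    have := hαβ.lt
    rw [h1, h2] at this
    exact lt_irrefl _ this
  -- `L` only has to exceed `1` and the quotients of `|x_k|` by the positive number `a_n`
  refine ⟨_, ⟨α, β, hαβ, rfl⟩, 2 + (∑ k, |x k|) / max |α| |β|, ?_, fun k => ?_⟩
  · have : 0 ≤ (∑ k, |x k|) / max |α| |β| :=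
      div_nonneg (Finset.sum_nonneg fun k _ => abs_nonneg _) hA.le
    linarith
  · have : |x k| ≤ ∑ k, |x k| :=
      Finset.single_le_sum (f := fun k => |x k|) (fun k _ => abs_nonneg _) (Finset.mem_univ k)
    rw [add_mul, div_mul_cancel₀ _ hA.ne']
    linarith

/-- The equivalences which do not involve orthogonal polynomials. -/
theorem tfae (hw : IsApproximating a b w) (hab : a < b) {n : ℕ} (hn : 2 ≤ n) {x : Fin n → ℝ}
    (hx : Function.Injective x) (hxS : ∀ k, x k ∈ openInterval a b)
    (hder : HasNonnegDeriv (2 * n) (fun t => 1 / w t) (openInterval a b)) :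
    List.TFAE [∀ k, fejerConst w x k = 0,
      IsFekete (openInterval a b) n (rootWeight n w) x,
      IsUniqueFekete (openInterval a b) n (rootWeight n w) x,
      IsStableMostEconomical (openInterval a b) w x (gruenwaldSystem x),
      IsOneNormal (openInterval a b) w x] := by
  have : NeZero n := ⟨by omega⟩
  have hSo := isOpen_openInterval a b
  have hS := ordConnected_openInterval a b
  rw [isStableMostEconomical_gruenwaldSystem_iff hSo hw.pos hx hxS,
    hw.isOneNormal_iff hab (by omega)]
  tfae_have 1 → 4 := gruenwaldBound_of_fejerConst (by omega) hx hSo hS hw.differentiable hw.pos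
    hxS hder
  tfae_have 4 → 2 := fun h => (isFekete_rootWeight_iff hn hw.pos).2
    ⟨hxS, fun z hz => h.weightedDisc_le hx hxS hw.pos hz⟩
  tfae_have 2 → 1 := fun h => fejerConst_eq_zero_of_weightedDisc_le hx hSo hw.differentiable
    hw.pos hxS ((isFekete_rootWeight_iff hn hw.pos).1 h).2
  tfae_have 2 → 3 := isUniqueFekete_of_isFekete hn hSo hS hw.differentiable hw.pos
    hw.concaveOn_log hder hx
  tfae_have 3 → 2 := fun h => h.1
  tfae_have 4 ↔ 5 := Iff.rfl
  tfae_finish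

end IsApproximating

/-! ### Integration by parts against an approximating weight -/

/-- An open interval is exhausted by compact intervals. -/
theorem exists_exhaustion {a b : EReal} (hab : a < b) :
    ∃ v u : ℕ → ℝ, (∀ k, v k ∈ openInterval a b) ∧ (∀ k, u k ∈ openInterval a b) ∧
      (∀ t ∈ openInterval a b, ∀ᶠ k in atTop, v k ≤ t) ∧
      (∀ t ∈ openInterval a b, ∀ᶠ k in atTop, t ≤ u k) := by
  obtain ⟨c, hc⟩ := nonempty_openInterval hab
  obtain ⟨u, -, hu, hut⟩ := exists_seq_strictMono_tendsto' hc.2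
  obtain ⟨v, -, hv, hvt⟩ := exists_seq_strictAnti_tendsto' hc.1
  have hur : ∀ k, ((u k).toReal : EReal) = u k := fun k =>
    EReal.coe_toReal (hu k).2.ne_top (lt_of_le_of_lt bot_le (hu k).1).ne'
  have hvr : ∀ k, ((v k).toReal : EReal) = v k := fun k =>
    EReal.coe_toReal (hv k).2.ne_top (lt_of_le_of_lt bot_le (hv k).1).ne'
  refine ⟨fun k => (v k).toReal, fun k => (u k).toReal, fun k => ?_, fun k => ?_, fun t ht => ?_,
    fun t ht => ?_⟩
  · rw [openInterval, mem_ofPred_eq, hvr]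
    exact ⟨(hv k).1, (hv k).2.trans hc.2⟩
  · rw [openInterval, mem_ofPred_eq, hur]
    exact ⟨hc.1.trans (hu k).1, (hu k).2⟩
  · filter_upwards [hvt.eventually_lt_const ht.1] with k hk
    rw [← hvr] at hk
    exact (EReal.coe_lt_coe_iff.1 hk).le
  · filter_upwards [hut.eventually_const_lt ht.2] with k hk
    rw [← hur] at hk
    exact (EReal.coe_lt_coe_iff.1 hk).le

theorem measurableSet_openInterval (a b : EReal) : MeasurableSet (openInterval a b) :=
  (isOpen_openInterval a b).measurableSet

theorem aecover_of_exhaustion {S : Set ℝ} (hS : MeasurableSet S) {v u : ℕ → ℝ}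
    (hv : ∀ t ∈ S, ∀ᶠ k in atTop, v k ≤ t) (hu : ∀ t ∈ S, ∀ᶠ k in atTop, t ≤ u k) :
    AECover (volume.restrict S) atTop fun k => Icc (v k) (u k) where
  ae_eventually_mem := by
    rw [ae_restrict_iff' hS]
    exact ae_of_all _ fun t ht => (hv t ht).and (hu t ht)
  measurableSet _ := measurableSet_Icc

theorem tendsto_eval_mul_exp_neg (p : ℝ[X]) {κ : ℝ} (hκ : 0 < κ) :
    Tendsto (fun t => p.eval t * Real.exp (-(κ * t))) atTop (𝓝 0) := by
  have h1 := (p.comp (C κ⁻¹ * X)).tendsto_div_exp_atTop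
  have h2 : Tendsto (fun t => κ * t) atTop atTop := tendsto_id.const_mul_atTop hκ
  refine (h1.comp h2).congr fun t => ?_
  simp only [Function.comp, eval_comp, eval_mul, eval_C, eval_X, Real.exp_neg]
  rw [inv_mul_cancel_left₀ hκ.ne', div_eq_mul_inv]

namespace IsApproximating

variable {a b : EReal} {w : ℝ → ℝ}

theorem extField_tangent_le (hw : IsApproximating a b w) {s t : ℝ} (hs : s ∈ openInterval a b)
    (ht : t ∈ openInterval a b) :
    extField w s + deriv (extField w) s * (t - s) ≤ extField w t := by
  have hsub := (ordConnected_openInterval a b).out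
  have hm := hw.monotoneOn_deriv_extField
  rcases lt_trichotomy s t with h | h | h
  · obtain ⟨ξ, hξ, he⟩ := exists_hasDerivAt_eq_slope (extField w) (deriv (extField w)) h
      (fun r hr => (hw.hasDerivAt_extField (hsub hs ht hr)).continuousAt.continuousWithinAt)
      (fun r hr => hw.hasDerivAt_extField' (hsub hs ht (Ioo_subset_Icc_self hr)))
    rw [eq_div_iff (by linarith)] at he
    have := hm hs (hsub hs ht (Ioo_subset_Icc_self hξ)) hξ.1.le
    nlinarith
  · subst h; simp
  · obtain ⟨ξ, hξ, he⟩ := exists_hasDerivAt_eq_slope (extField w) (deriv (extField w)) h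
      (fun r hr => (hw.hasDerivAt_extField (hsub ht hs hr)).continuousAt.continuousWithinAt)
      (fun r hr => hw.hasDerivAt_extField' (hsub ht hs (Ioo_subset_Icc_self hr)))
    rw [eq_div_iff (by linarith)] at he
    have := hm (hsub ht hs (Ioo_subset_Icc_self hξ)) hs hξ.2.le
    nlinarith

theorem exists_deriv_extField_eq_zero (hw : IsApproximating a b w) (hab : a < b) :
    ∃ m ∈ openInterval a b, deriv (extField w) m = 0 := by
  obtain ⟨m, hm, hmin⟩ := exists_forall_le_of_blowsUp (ordConnected_openInterval a b)
    (fun t ht => (hw.hasDerivAt_extField ht).continuousAt.continuousWithinAt)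
    (hw.blowsUpRight hab) (hw.blowsUpLeft hab) (nonempty_openInterval hab).some_mem
  refine ⟨m, hm, IsLocalMin.deriv_eq_zero ?_⟩
  filter_upwards [(isOpen_openInterval a b).mem_nhds hm] with t ht using hmin t ht

theorem exists_deriv_extField_pos (hw : IsApproximating a b w) (hab : a < b) :
    ∃ s ∈ openInterval a b, 0 < deriv (extField w) s := by
  obtain ⟨c, hc⟩ := nonempty_openInterval hab
  obtain ⟨t, ht, h⟩ := hw.blowsUpRight hab (extField w c + 1)
  have hmem : max t c ∈ openInterval a b := by rcases max_choice t c with h | h <;> rwa [h]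
  have h1 := h _ hmem (le_max_left _ _)
  have h2 := hw.extField_tangent_le hmem hc
  refine ⟨_, hmem, ?_⟩
  by_contra hle
  push Not at hle
  nlinarith [le_max_right t c]

theorem exists_deriv_extField_neg (hw : IsApproximating a b w) (hab : a < b) :
    ∃ s ∈ openInterval a b, deriv (extField w) s < 0 := by
  obtain ⟨c, hc⟩ := nonempty_openInterval hab
  obtain ⟨t, ht, h⟩ := hw.blowsUpLeft hab (extField w c + 1)
  have hmem : min t c ∈ openInterval a b := by rcases min_choice t c with h | h <;> rwa [h]
  have h1 := h _ hmem (min_le_left _ _)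
  have h2 := hw.extField_tangent_le hmem hc
  refine ⟨_, hmem, ?_⟩
  by_contra hle
  push Not at hle
  nlinarith [min_le_right t c]

theorem weight_le_exp (hw : IsApproximating a b w) {s t : ℝ} (hs : s ∈ openInterval a b)
    (ht : t ∈ openInterval a b) :
    w t ≤ Real.exp (-extField w s + deriv (extField w) s * s) *
      Real.exp (-(deriv (extField w) s * t)) := by
  rw [hw.weight_eq_exp ht, ← Real.exp_add, Real.exp_le_exp]
  linarith [hw.extField_tangent_le hs ht]

theorem exists_eval_mul_lt_right (hw : IsApproximating a b w) (hab : a < b) (p : ℝ[X]) {ε : ℝ}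
    (hε : 0 < ε) :
    ∃ t₀ ∈ openInterval a b, ∀ t ∈ openInterval a b, t₀ ≤ t → |p.eval t * w t| < ε := by
  induction b with
  | bot => exact absurd hab not_lt_bot
  | coe b' =>
    have h := (p.continuous.tendsto b').mono_left (nhdsWithin_le_nhds (s := Iio b'))
    have h2 := (h.mul (hw.tendsto_nhdsLT rfl)).abs
    rw [mul_zero, abs_zero] at h2
    exact exists_of_eventually_nhdsLT hab (h2.eventually_lt_const hε)
  | top =>
    obtain ⟨s, hs, hpos⟩ := hw.exists_deriv_extField_pos hab
    have h1 := ((tendsto_eval_mul_exp_neg p hpos).const_mul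
      (Real.exp (-extField w s + deriv (extField w) s * s))).abs
    rw [mul_zero, abs_zero] at h1
    obtain ⟨t₀, ht₀, h⟩ := exists_of_eventually_atTop hab (h1.eventually_lt_const hε)
    refine ⟨t₀, ht₀, fun t ht hle => lt_of_le_of_lt ?_ (h t ht hle)⟩
    rw [mul_left_comm, abs_mul, abs_mul (p.eval t), abs_of_pos (hw.pos t ht)]
    refine mul_le_mul_of_nonneg_left ((hw.weight_le_exp hs ht).trans (le_abs_self _)) (abs_nonneg _)

theorem exists_eval_mul_lt_left (hw : IsApproximating a b w) (hab : a < b) (p : ℝ[X]) {ε : ℝ}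
    (hε : 0 < ε) :
    ∃ t₀ ∈ openInterval a b, ∀ t ∈ openInterval a b, t ≤ t₀ → |p.eval t * w t| < ε := by
  induction a with
  | bot =>
    obtain ⟨s, hs, hneg⟩ := hw.exists_deriv_extField_neg hab
    have h1 := ((tendsto_eval_mul_exp_neg (p.comp (-X)) (neg_pos.2 hneg)).const_mul
      (Real.exp (-extField w s + deriv (extField w) s * s))).abs
    rw [mul_zero, abs_zero] at h1
    obtain ⟨t₀, ht₀, h⟩ := exists_of_eventually_atBot hab
      ((h1.comp tendsto_neg_atBot_atTop).eventually_lt_const hε)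
    refine ⟨t₀, ht₀, fun t ht hle => lt_of_le_of_lt ?_ (h t ht hle)⟩
    simp only [Function.comp, eval_comp, eval_neg, eval_X, neg_neg, neg_mul, mul_neg]
    rw [mul_left_comm, abs_mul, abs_mul (p.eval t), abs_of_pos (hw.pos t ht)]
    refine mul_le_mul_of_nonneg_left ((hw.weight_le_exp hs ht).trans (le_abs_self _)) (abs_nonneg _)
  | coe a' =>
    have h := (p.continuous.tendsto a').mono_left (nhdsWithin_le_nhds (s := Ioi a'))
    have h2 := (h.mul (hw.tendsto_nhdsGT rfl)).abs
    rw [mul_zero, abs_zero] at h2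
    exact exists_of_eventually_nhdsGT hab (h2.eventually_lt_const hε)
  | top => exact absurd hab not_top_lt

theorem integrableOn_eval_mul (hw : IsApproximating a b w) (p : ℝ[X]) :
    IntegrableOn (fun t => p.eval t * w t) (openInterval a b) := by
  simp_rw [eval_eq_sum_range, Finset.sum_mul, mul_assoc]
  exact integrable_finsetSum _ fun i _ => (hw.finite_moments i).const_mul _

theorem continuousOn_weight (hw : IsApproximating a b w) : ContinuousOn w (openInterval a b) :=
  hw.differentiable.continuousOn

theorem continuousOn_eval_mul_deriv_mul (hw : IsApproximating a b w) (p : ℝ[X]) :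
    ContinuousOn (fun t => p.eval t * deriv (extField w) t * w t) (openInterval a b) :=
  (p.continuous.continuousOn.mul hw.continuousOn_deriv_extField).mul hw.continuousOn_weight

theorem hasDerivAt_eval_mul (hw : IsApproximating a b w) (p : ℝ[X]) {t : ℝ}
    (ht : t ∈ openInterval a b) :
    HasDerivAt (fun t => p.eval t * w t)
      ((derivative p).eval t * w t - p.eval t * deriv (extField w) t * w t) t := by
  have h1 := (p.hasDerivAt t).mul
    (hw.differentiable.differentiableAt ((isOpen_openInterval a b).mem_nhds ht)).hasDerivAt
  refine h1.congr_deriv ?_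
  rw [hw.deriv_weight ht]; ring

theorem intervalIntegral_by_parts (hw : IsApproximating a b w) (p : ℝ[X]) {u v : ℝ}
    (hu : u ∈ openInterval a b) (hv : v ∈ openInterval a b) :
    ∫ t in u..v, p.eval t * deriv (extField w) t * w t =
      (∫ t in u..v, (derivative p).eval t * w t) - (p.eval v * w v - p.eval u * w u) := by
  have hsub : uIcc u v ⊆ openInterval a b := (ordConnected_openInterval a b).uIcc_subset hu hv
  have hi1 : IntervalIntegrable (fun t => (derivative p).eval t * w t) volume u v :=
    (((derivative p).continuous.continuousOn.mul hw.continuousOn_weight).mono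
      hsub).intervalIntegrable
  have hi2 : IntervalIntegrable (fun t => p.eval t * deriv (extField w) t * w t) volume u v :=
    ((hw.continuousOn_eval_mul_deriv_mul p).mono hsub).intervalIntegrable
  have h := intervalIntegral.integral_eq_sub_of_hasDerivAt
    (fun t ht => hw.hasDerivAt_eval_mul p (hsub ht)) (hi1.sub hi2)
  rw [intervalIntegral.integral_sub hi1 hi2] at h
  linarith

theorem integral_abs_deriv_le (hw : IsApproximating a b w) (p : ℝ[X]) {u v : ℝ} (huv : u ≤ v)
    (hu : u ∈ openInterval a b) (hv : v ∈ openInterval a b) :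
    |∫ t in u..v, (derivative p).eval t * w t| ≤
      ∫ t in openInterval a b, |(derivative p).eval t * w t| := by
  have hsub : Ioc u v ⊆ openInterval a b :=
    Ioc_subset_Icc_self.trans ((ordConnected_openInterval a b).out hu hv)
  refine (intervalIntegral.abs_integral_le_integral_abs huv).trans ?_
  rw [intervalIntegral.integral_of_le huv]
  exact setIntegral_mono_set (hw.integrableOn_eval_mul _).abs (ae_of_all _ fun t => abs_nonneg _)
    (ae_of_all _ hsub)

/-- On each side of the minimum of the field the derivative has a constant sign, so integration by
parts bounds the integrals of `|p Q' w|` over compact intervals. -/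
theorem integrableOn_eval_mul_deriv_mul (hw : IsApproximating a b w) (hab : a < b) (p : ℝ[X]) :
    IntegrableOn (fun t => p.eval t * deriv (extField w) t * w t) (openInterval a b) := by
  set S := openInterval a b with hS
  have hsub : ∀ {u v}, u ∈ S → v ∈ S → Icc u v ⊆ S := fun hu hv =>
    (ordConnected_openInterval a b).out hu hv
  -- a nonnegative polynomial above `|p|`
  set P : ℝ[X] := 1 + p ^ 2 with hP
  have hPp : ∀ t, |p.eval t| ≤ P.eval t := fun t => by
    simp only [hP, eval_add, eval_one, eval_pow]
    nlinarith [abs_nonneg (p.eval t), sq_abs (p.eval t)]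
  have hP0 : ∀ t, 0 ≤ P.eval t := fun t => (abs_nonneg _).trans (hPp t)
  suffices h : IntegrableOn (fun t => P.eval t * deriv (extField w) t * w t) S by
    refine Integrable.mono h ?_ ?_
    · exact (hw.continuousOn_eval_mul_deriv_mul p).aestronglyMeasurable
        (measurableSet_openInterval a b)
    · rw [ae_restrict_iff' (measurableSet_openInterval a b)]
      refine ae_of_all _ fun t ht => ?_
      rw [Real.norm_eq_abs, Real.norm_eq_abs, abs_mul, abs_mul, abs_mul, abs_mul]
      exact mul_le_mul_of_nonneg_right (mul_le_mul_of_nonneg_right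
        ((hPp t).trans (le_abs_self _)) (abs_nonneg _)) (abs_nonneg _)
  obtain ⟨v, u, hvS, huS, hv, hu⟩ := exists_exhaustion hab
  obtain ⟨m, hm, hm0⟩ := hw.exists_deriv_extField_eq_zero hab
  have hcov := aecover_of_exhaustion (measurableSet_openInterval a b) hv hu
  have hci : ∀ {s t}, s ∈ S → t ∈ S →
      IntegrableOn (fun t => P.eval t * deriv (extField w) t * w t) (Icc s t) := fun hs ht =>
    ((hw.continuousOn_eval_mul_deriv_mul P).mono (hsub hs ht)).integrableOn_Icc
  have hii : ∀ {s t}, s ∈ S → t ∈ S →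
      IntervalIntegrable (fun t => |P.eval t * deriv (extField w) t * w t|) volume s t :=
    fun hs ht => (((hw.continuousOn_eval_mul_deriv_mul P).mono
      ((ordConnected_openInterval a b).uIcc_subset hs ht)).abs).intervalIntegrable
  set D := ∫ t in S, |(derivative P).eval t * w t| with hD
  refine hcov.integrable_of_integral_norm_bounded (2 * (D + P.eval m * w m))
    (fun k => (hci (hvS k) (huS k)).mono_measure Measure.restrict_le_self) ?_
  filter_upwards [hv m hm, hu m hm] with k hvk huk
  rw [Measure.restrict_restrict_of_subset (hsub (hvS k) (huS k)), integral_Icc_eq_integral_Ioc,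
    ← intervalIntegral.integral_of_le (hvk.trans huk)]
  simp only [Real.norm_eq_abs]
  rw [← intervalIntegral.integral_add_adjacent_intervals (hii (hvS k) hm) (hii hm (huS k))]
  have hPw : ∀ {s}, s ∈ S → 0 ≤ P.eval s * w s := fun {s} hs => mul_nonneg (hP0 s) (hw.pos s hs).le
  have h1 : ∫ t in v k..m, |P.eval t * deriv (extField w) t * w t| ≤ D + P.eval m * w m := by
    have : ∫ t in v k..m, |P.eval t * deriv (extField w) t * w t| =
        - ∫ t in v k..m, P.eval t * deriv (extField w) t * w t := by
      rw [← intervalIntegral.integral_neg]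
      refine intervalIntegral.integral_congr fun t ht => ?_
      rw [uIcc_of_le hvk] at ht
      have htS := hsub (hvS k) hm ht
      have := hw.monotoneOn_deriv_extField htS hm ht.2
      rw [hm0] at this
      exact abs_of_nonpos (mul_nonpos_of_nonpos_of_nonneg
        (mul_nonpos_of_nonneg_of_nonpos (hP0 t) this) (hw.pos t htS).le)
    rw [this, hw.intervalIntegral_by_parts P (hvS k) hm]
    have h2 := neg_abs_le (∫ t in v k..m, (derivative P).eval t * w t)
    have h3 := hw.integral_abs_deriv_le P hvk (hvS k) hm
    linarith [hPw (hvS k)]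
  have h2 : ∫ t in m..u k, |P.eval t * deriv (extField w) t * w t| ≤ D + P.eval m * w m := by
    have : ∫ t in m..u k, |P.eval t * deriv (extField w) t * w t| =
        ∫ t in m..u k, P.eval t * deriv (extField w) t * w t := by
      refine intervalIntegral.integral_congr fun t ht => ?_
      rw [uIcc_of_le huk] at ht
      have htS := hsub hm (huS k) ht
      have := hw.monotoneOn_deriv_extField hm htS ht.1
      rw [hm0] at this
      exact abs_of_nonneg (mul_nonneg (mul_nonneg (hP0 t) this) (hw.pos t htS).le)
    rw [this, hw.intervalIntegral_by_parts P hm (huS k)]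
    have h2 := le_abs_self (∫ t in m..u k, (derivative P).eval t * w t)
    have h3 := hw.integral_abs_deriv_le P huk hm (huS k)
    linarith [hPw (huS k)]
  linarith

/-- Integration by parts; the boundary terms vanish. -/
theorem integral_eval_mul_deriv_mul (hw : IsApproximating a b w) (hab : a < b) (p : ℝ[X]) :
    ∫ t in openInterval a b, p.eval t * deriv (extField w) t * w t =
      ∫ t in openInterval a b, (derivative p).eval t * w t := by
  set S := openInterval a b with hS
  have hsub : ∀ {u v}, u ∈ S → v ∈ S → Icc u v ⊆ S := fun hu hv =>
    (ordConnected_openInterval a b).out hu hv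
  obtain ⟨v, u, hvS, huS, hv, hu⟩ := exists_exhaustion hab
  have hcov := aecover_of_exhaustion (measurableSet_openInterval a b) hv hu
  have h1 := hcov.integral_tendsto_of_countably_generated
    (hw.integrableOn_eval_mul_deriv_mul hab p)
  have h2 := hcov.integral_tendsto_of_countably_generated (hw.integrableOn_eval_mul (derivative p))
  have hu0 : Tendsto (fun k => p.eval (u k) * w (u k)) atTop (𝓝 0) := by
    rw [Metric.tendsto_nhds]
    intro ε hε
    obtain ⟨t₀, ht₀, h⟩ := hw.exists_eval_mul_lt_right hab p hε
    filter_upwards [hu t₀ ht₀] with k hk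
    simpa using h _ (huS k) hk
  have hv0 : Tendsto (fun k => p.eval (v k) * w (v k)) atTop (𝓝 0) := by
    rw [Metric.tendsto_nhds]
    intro ε hε
    obtain ⟨t₀, ht₀, h⟩ := hw.exists_eval_mul_lt_left hab p hε
    filter_upwards [hv t₀ ht₀] with k hk
    simpa using h _ (hvS k) hk
  have h3 := h2.sub (hu0.sub hv0)
  rw [sub_self, sub_zero] at h3
  refine tendsto_nhds_unique h1 (h3.congr' ?_)
  obtain ⟨m, hm⟩ := nonempty_openInterval hab
  filter_upwards [hv m hm, hu m hm] with k hvk huk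
  have hle := hvk.trans huk
  rw [Measure.restrict_restrict_of_subset (hsub (hvS k) (huS k)), integral_Icc_eq_integral_Ioc,
    integral_Icc_eq_integral_Ioc, ← intervalIntegral.integral_of_le hle,
    ← intervalIntegral.integral_of_le hle, hw.intervalIntegral_by_parts p (hvS k) (huS k)]

end IsApproximating

/-! ### Orthogonal polynomials -/

theorem monicOrtho_monic_natDegree (S : Set ℝ) (w : ℝ → ℝ) (n : ℕ) :
    (monicOrtho S w n).Monic ∧ (monicOrtho S w n).natDegree = n := by
  induction n using Nat.strong_induction_on with
  | _ n ih =>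
    have hdeg : (∑ j : Fin n, C (weightedInner S w (X ^ n) (monicOrtho S w j)
        / weightedInner S w (monicOrtho S w j) (monicOrtho S w j)) * monicOrtho S w j).degree
          < n := by
      refine mem_degreeLT.1 (Submodule.sum_mem _ fun j _ => mem_degreeLT.2 ?_)
      rw [← smul_eq_C_mul]
      refine lt_of_le_of_lt (degree_smul_le _ _) ?_
      rw [degree_eq_natDegree (ih j j.2).1.ne_zero, (ih j j.2).2]
      exact_mod_cast j.2
    have h : (monicOrtho S w n).Monic := by
      rw [monicOrtho]; exact monic_X_pow_sub hdeg
    refine ⟨h, ?_⟩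
    rw [monicOrtho]
    apply natDegree_eq_of_degree_eq_some
    rw [degree_sub_eq_left_of_degree_lt (by rwa [degree_X_pow]), degree_X_pow]

theorem monicOrtho_monic (S : Set ℝ) (w : ℝ → ℝ) (n : ℕ) : (monicOrtho S w n).Monic :=
  (monicOrtho_monic_natDegree S w n).1

theorem natDegree_monicOrtho (S : Set ℝ) (w : ℝ → ℝ) (n : ℕ) :
    (monicOrtho S w n).natDegree = n :=
  (monicOrtho_monic_natDegree S w n).2

theorem degree_monicOrtho (S : Set ℝ) (w : ℝ → ℝ) (n : ℕ) : (monicOrtho S w n).degree = n := by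
  rw [degree_eq_natDegree (monicOrtho_monic S w n).ne_zero, natDegree_monicOrtho]

theorem weightedInner_comm (S : Set ℝ) (w : ℝ → ℝ) (p q : ℝ[X]) :
    weightedInner S w p q = weightedInner S w q p := by
  simp only [weightedInner, mul_comm (p.eval _)]

theorem weightedInner_eq (S : Set ℝ) (w : ℝ → ℝ) (p q : ℝ[X]) :
    weightedInner S w p q = ∫ t in S, (p * q).eval t * w t := by
  simp only [weightedInner, eval_mul]

theorem weightedInner_C_mul_left (S : Set ℝ) (w : ℝ → ℝ) (c : ℝ) (p q : ℝ[X]) :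
    weightedInner S w (C c * p) q = c * weightedInner S w p q := by
  simp only [weightedInner, eval_mul, eval_C, mul_assoc]
  rw [integral_const_mul]

/-- The parity of the multiplicities of the zeros in `S` decides whether a polynomial changes sign
on `S`. -/
theorem nonneg_or_nonpos_of_even_rootMultiplicity {S : Set ℝ} (hS : S.OrdConnected) (f : ℝ[X])
    (hf : f ≠ 0) (h : ∀ r ∈ S, Even (f.rootMultiplicity r)) :
    (∀ t ∈ S, 0 ≤ f.eval t) ∨ ∀ t ∈ S, f.eval t ≤ 0 := by
  induction hd : f.natDegree using Nat.strong_induction_on generalizing f with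
  | _ d ih =>
    by_cases hroot : ∃ r ∈ S, f.eval r = 0
    · obtain ⟨r, hr, hr0⟩ := hroot
      have h1 : 0 < f.rootMultiplicity r := (rootMultiplicity_pos hf).2 hr0
      have h2 : 2 ≤ f.rootMultiplicity r := by
        obtain ⟨k, hk⟩ := h r hr
        omega
      obtain ⟨g, hg⟩ := (le_rootMultiplicity_iff hf).1 h2
      have hg0 : g ≠ 0 := by rintro rfl; exact hf (by rw [hg, mul_zero])
      have hX : ((X - C r) ^ 2 : ℝ[X]) ≠ 0 := pow_ne_zero 2 (X_sub_C_ne_zero r)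
      have hdeg : g.natDegree < d := by
        rw [← hd, hg, natDegree_mul hX hg0, natDegree_pow, natDegree_X_sub_C]
        omega
      have heven : ∀ s ∈ S, Even (g.rootMultiplicity s) := by
        intro s hs
        have h3 := h s hs
        rw [hg, rootMultiplicity_mul (mul_ne_zero hX hg0), Nat.even_add] at h3
        refine h3.1 ?_
        rw [← count_roots, roots_pow, roots_X_sub_C, Multiset.count_nsmul]
        exact even_two_mul _
      have hev : ∀ t, f.eval t = (t - r) ^ 2 * g.eval t := fun t => by
        rw [hg]; simp
      rcases ih _ hdeg g hg0 heven rfl with h4 | h4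
      · left
        intro t ht
        rw [hev]
        exact mul_nonneg (sq_nonneg _) (h4 t ht)
      · right
        intro t ht
        rw [hev]
        exact mul_nonpos_of_nonneg_of_nonpos (sq_nonneg _) (h4 t ht)
    · push Not at hroot
      by_contra hcon
      push Not at hcon
      obtain ⟨⟨s, hs, hs0⟩, t, ht, ht0⟩ := hcon
      obtain ⟨r, hr, hr0⟩ := hS.isPreconnected.intermediate_value hs ht
        f.continuous.continuousOn ⟨hs0.le, ht0.le⟩
      exact hroot r hr hr0

namespace IsApproximating

variable {a b : EReal} {w : ℝ → ℝ}

theorem weightedInner_add_left (hw : IsApproximating a b w) (p q r : ℝ[X]) :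
    weightedInner (openInterval a b) w (p + q) r =
      weightedInner (openInterval a b) w p r + weightedInner (openInterval a b) w q r := by
  simp only [weightedInner_eq]
  rw [← integral_add (hw.integrableOn_eval_mul _) (hw.integrableOn_eval_mul _)]
  simp only [add_mul, eval_add]

theorem weightedInner_sub_left (hw : IsApproximating a b w) (p q r : ℝ[X]) :
    weightedInner (openInterval a b) w (p - q) r =
      weightedInner (openInterval a b) w p r - weightedInner (openInterval a b) w q r := by
  simp only [weightedInner_eq]
  rw [← integral_sub (hw.integrableOn_eval_mul _) (hw.integrableOn_eval_mul _)]
  simp only [sub_mul, eval_sub]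

theorem weightedInner_sum_left (hw : IsApproximating a b w) {ι : Type*} (s : Finset ι)
    (f : ι → ℝ[X]) (r : ℝ[X]) :
    weightedInner (openInterval a b) w (∑ i ∈ s, f i) r =
      ∑ i ∈ s, weightedInner (openInterval a b) w (f i) r := by
  classical
  induction s using Finset.induction_on with
  | empty => simp [weightedInner]
  | insert i s hi ih =>
    rw [Finset.sum_insert hi, Finset.sum_insert hi, hw.weightedInner_add_left, ih]

theorem integral_eval_mul_pos (hw : IsApproximating a b w) (hab : a < b) {r : ℝ[X]} (hr : r ≠ 0)
    (hnn : ∀ t ∈ openInterval a b, 0 ≤ r.eval t) :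
    0 < ∫ t in openInterval a b, r.eval t * w t := by
  have hm := measurableSet_openInterval a b
  rw [setIntegral_pos_iff_support_of_nonneg_ae _ (hw.integrableOn_eval_mul r)]
  · have hsub : openInterval a b \ (r.roots.toFinset : Set ℝ) ⊆
        Function.support (fun t => r.eval t * w t) ∩ openInterval a b := by
      rintro t ⟨ht, htr⟩
      refine ⟨mul_ne_zero (fun h0 => htr ?_) (hw.pos t ht).ne', ht⟩
      simp only [Finset.mem_coe, Multiset.mem_toFinset, mem_roots hr]
      exact h0
    refine lt_of_lt_of_le ?_ (measure_mono hsub)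
    rw [measure_sdiff_null ((Finset.finite_toSet _).measure_zero _)]
    exact (isOpen_openInterval a b).measure_pos _ (nonempty_openInterval hab)
  · rw [EventuallyLE, ae_restrict_iff' hm]
    exact ae_of_all _ fun t ht => mul_nonneg (hnn t ht) (hw.pos t ht).le

theorem weightedInner_self_pos (hw : IsApproximating a b w) (hab : a < b) {p : ℝ[X]}
    (hp : p ≠ 0) : 0 < weightedInner (openInterval a b) w p p := by
  rw [weightedInner_eq]
  refine hw.integral_eval_mul_pos hab (mul_ne_zero hp hp) fun t _ => ?_
  rw [eval_mul]; exact mul_self_nonneg _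

theorem weightedInner_monicOrtho_of_lt (hw : IsApproximating a b w) (hab : a < b) (n : ℕ) :
    ∀ j < n, weightedInner (openInterval a b) w (monicOrtho (openInterval a b) w n)
      (monicOrtho (openInterval a b) w j) = 0 := by
  induction n using Nat.strong_induction_on with
  | _ n ih =>
    intro j hj
    conv_lhs => arg 3; rw [monicOrtho]
    rw [hw.weightedInner_sub_left, hw.weightedInner_sum_left]
    simp_rw [weightedInner_C_mul_left]
    have hne :=
      (hw.weightedInner_self_pos hab (monicOrtho_monic (openInterval a b) w j).ne_zero).ne'
    rw [Finset.sum_eq_single (⟨j, hj⟩ : Fin n)]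
    · simp only [div_mul_cancel₀ _ hne, sub_self]
    · intro i _ hij
      have hij' : (i : ℕ) ≠ j := fun h => hij (Fin.ext h)
      rcases lt_or_gt_of_ne hij' with h | h
      · rw [weightedInner_comm _ _ (monicOrtho (openInterval a b) w i)
          (monicOrtho (openInterval a b) w j), ih j hj i h, mul_zero]
      · rw [ih i i.2 j h, mul_zero]
    · simp

/-- The monic orthogonal polynomial of degree `n` is orthogonal to all polynomials of degree
below `n`. -/
theorem weightedInner_monicOrtho (hw : IsApproximating a b w) (hab : a < b) {n : ℕ} {q : ℝ[X]}
    (hq : q.degree < n) :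
    weightedInner (openInterval a b) w (monicOrtho (openInterval a b) w n) q = 0 := by
  induction hd : q.natDegree using Nat.strong_induction_on generalizing q with
  | _ d ih =>
    by_cases hq0 : q = 0
    · simp [hq0, weightedInner]
    have hdn : d < n := by
      rw [degree_eq_natDegree hq0, hd] at hq
      exact_mod_cast hq
    set π := monicOrtho (openInterval a b) w d with hπ
    set q' := q - C q.leadingCoeff * π with hq'
    have hlc : q.leadingCoeff ≠ 0 := leadingCoeff_ne_zero.2 hq0
    have hlt : q'.degree < q.degree := by
      refine degree_sub_lt_left ?_ hq0 ?_
      · rw [degree_C_mul hlc, degree_monicOrtho, degree_eq_natDegree hq0, hd]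
      · rw [leadingCoeff_mul, leadingCoeff_C, (monicOrtho_monic _ w d).leadingCoeff, mul_one]
    have hsplit : q = q' + C q.leadingCoeff * π := by rw [hq']; ring
    rw [hsplit, weightedInner_comm, hw.weightedInner_add_left, weightedInner_C_mul_left,
      weightedInner_comm _ w π, hw.weightedInner_monicOrtho_of_lt hab n d hdn, mul_zero, add_zero,
      weightedInner_comm]
    by_cases hq'0 : q' = 0
    · simp [hq'0, weightedInner]
    refine ih q'.natDegree ?_ (hlt.trans hq) rfl
    rw [← hd]
    exact natDegree_lt_natDegree hq'0 hlt

/-- All zeros of an orthogonal polynomial are simple and belong to the interval: otherwise its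
product with the factors of its zeros of odd multiplicity would have a constant sign. -/
theorem exists_zeros_monicOrtho (hw : IsApproximating a b w) (hab : a < b) (n : ℕ) :
    ∃ z : Fin n → ℝ, Function.Injective z ∧ (∀ k, z k ∈ openInterval a b) ∧
      ∀ k, (monicOrtho (openInterval a b) w n).eval (z k) = 0 := by
  classical
  set S := openInterval a b with hS
  set p := monicOrtho S w n with hp
  have hp0 : p ≠ 0 := (monicOrtho_monic S w n).ne_zero
  set T := p.roots.toFinset.filter fun r => r ∈ S ∧ Odd (p.rootMultiplicity r) with hT
  set q : ℝ[X] := ∏ r ∈ T, (X - C r) with hq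
  have hq0 : q ≠ 0 := Finset.prod_ne_zero_iff.2 fun r _ => X_sub_C_ne_zero r
  have hqd : q.natDegree = T.card := by
    rw [hq, natDegree_prod _ _ fun r _ => X_sub_C_ne_zero r]; simp
  have hcard : n ≤ T.card := by
    by_contra hlt
    push Not at hlt
    have h0 : weightedInner S w p q = 0 := hw.weightedInner_monicOrtho hab (by
      rw [degree_eq_natDegree hq0, hqd]; exact_mod_cast hlt)
    rw [weightedInner_eq] at h0
    have hpq : p * q ≠ 0 := mul_ne_zero hp0 hq0
    have heven : ∀ r ∈ S, Even ((p * q).rootMultiplicity r) := by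
      intro r hr
      have hqr : q.rootMultiplicity r = if r ∈ T then 1 else 0 := by
        rw [← count_roots, hq, roots_prod_X_sub_C]
        exact Multiset.count_eq_of_nodup T.nodup
      rw [rootMultiplicity_mul hpq, hqr]
      by_cases hodd : Odd (p.rootMultiplicity r)
      · have : r ∈ T := by
          simp only [hT, Finset.mem_filter, Multiset.mem_toFinset]
          exact ⟨(mem_roots hp0).2 ((rootMultiplicity_pos hp0).1 hodd.pos), hr, hodd⟩
        rw [if_pos this]
        exact hodd.add_odd odd_one
      · have : r ∉ T := by simp [hT, hodd]
        rw [if_neg this]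
        simpa using hodd
    rcases nonneg_or_nonpos_of_even_rootMultiplicity (ordConnected_openInterval a b) _ hpq heven
      with h | h
    · exact (hw.integral_eval_mul_pos hab hpq h).ne' h0
    · have h1 := hw.integral_eval_mul_pos hab (neg_ne_zero.2 hpq) fun t ht => by
        rw [eval_neg]; exact neg_nonneg.2 (h t ht)
      simp only [eval_neg, neg_mul] at h1
      rw [integral_neg, h0, neg_zero] at h1
      exact lt_irrefl _ h1
  obtain ⟨T', hT', hT'c⟩ := Finset.exists_subset_card_eq hcard
  refine ⟨T'.orderEmbOfFin hT'c, (T'.orderEmbOfFin hT'c).injective, fun k => ?_, fun k => ?_⟩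
  all_goals
    have h1 := hT' (Finset.orderEmbOfFin_mem T' hT'c k)
    simp only [hT, Finset.mem_filter, Multiset.mem_toFinset, mem_roots hp0] at h1
  · exact h1.2.1
  · exact h1.1

end IsApproximating

/-! ### Ladder relations -/

/-- `∫_S u(t) w(t) (Q'(t) - Q'(x)) / (t - x) dt`, with the continuous extension of the quotient to
`t = x`. -/
noncomputable def ladderInt (S : Set ℝ) (w : ℝ → ℝ) (u : ℝ[X]) (x : ℝ) : ℝ :=
  ∫ t in S, u.eval t * w t * dslope (deriv (extField w)) x t

theorem ae_dslope_eq (S : Set ℝ) (q : ℝ → ℝ) (x : ℝ) :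
    ∀ᵐ t ∂(volume.restrict S), dslope q x t = (q t - q x) / (t - x) := by
  have h : ∀ᵐ t ∂(volume : Measure ℝ), t ≠ x := by simp [ae_iff]
  refine ae_restrict_of_ae (h.mono fun t ht => ?_)
  rw [dslope_of_ne _ ht, slope_def_field]

namespace IsApproximating

variable {a b : EReal} {w : ℝ → ℝ}

theorem continuousOn_dslope_deriv (hw : IsApproximating a b w) {x : ℝ}
    (hx : x ∈ openInterval a b) :
    ContinuousOn (dslope (deriv (extField w)) x) (openInterval a b) :=
  (continuousOn_dslope ((isOpen_openInterval a b).mem_nhds hx)).2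
    ⟨hw.continuousOn_deriv_extField, hw.differentiableOn_deriv_extField.differentiableAt
      ((isOpen_openInterval a b).mem_nhds hx)⟩

/-- The difference quotient of `Q'` is bounded near `x`, and elsewhere it is dominated by
`|Q'|`. -/
theorem exists_abs_dslope_le (hw : IsApproximating a b w) {x : ℝ} (hx : x ∈ openInterval a b) :
    ∃ C D : ℝ, 0 ≤ C ∧ 0 ≤ D ∧ ∀ t ∈ openInterval a b,
      |dslope (deriv (extField w)) x t| ≤ C + D * |deriv (extField w) t| := by
  set q := deriv (extField w) with hq
  have hc : ContinuousAt (dslope q x) x :=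
    (hw.continuousOn_dslope_deriv hx).continuousAt ((isOpen_openInterval a b).mem_nhds hx)
  obtain ⟨δ, hδ, hb⟩ := Metric.continuousAt_iff.1 hc 1 one_pos
  refine ⟨|dslope q x x| + 1 + |q x| / δ, 1 / δ, by positivity, by positivity, fun t _ => ?_⟩
  by_cases hd : dist t x < δ
  · have h1 := hb hd
    rw [Real.dist_eq] at h1
    have h2 := abs_sub_abs_le_abs_sub (dslope q x t) (dslope q x x)
    have h3 : 0 ≤ |q x| / δ := by positivity
    have h4 : 0 ≤ 1 / δ * |q t| := by positivity
    linarith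
  · push Not at hd
    rw [Real.dist_eq] at hd
    have htx : t ≠ x := by
      rintro rfl
      rw [sub_self, abs_zero] at hd
      linarith
    rw [dslope_of_ne _ htx, slope_def_field, abs_div]
    have h1 : |q t - q x| ≤ |q t| + |q x| := abs_sub _ _
    calc |q t - q x| / |t - x| ≤ (|q t| + |q x|) / δ :=
          div_le_div₀ (by positivity) h1 hδ hd
      _ ≤ |dslope q x x| + 1 + |q x| / δ + 1 / δ * |q t| := by
          have := abs_nonneg (dslope q x x)
          rw [add_div, one_div, inv_mul_eq_div]
          linarith

theorem integrableOn_ladder (hw : IsApproximating a b w) (hab : a < b) (u : ℝ[X]) {x : ℝ}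
    (hx : x ∈ openInterval a b) :
    IntegrableOn (fun t => u.eval t * w t * dslope (deriv (extField w)) x t)
      (openInterval a b) := by
  obtain ⟨C, D, hC, hD, h⟩ := hw.exists_abs_dslope_le hx
  have h1 := ((hw.integrableOn_eval_mul u).abs.const_mul C).add
    ((hw.integrableOn_eval_mul_deriv_mul hab u).abs.const_mul D)
  refine Integrable.mono h1 ?_ ?_
  · exact ((u.continuous.continuousOn.mul hw.continuousOn_weight).mul
      (hw.continuousOn_dslope_deriv hx)).aestronglyMeasurable (measurableSet_openInterval a b)
  · rw [ae_restrict_iff' (measurableSet_openInterval a b)]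
    refine ae_of_all _ fun t ht => ?_
    rw [Real.norm_eq_abs, Real.norm_eq_abs, abs_mul]
    refine le_trans ?_ (le_abs_self _)
    refine (mul_le_mul_of_nonneg_left (h t ht) (abs_nonneg _)).trans_eq ?_
    simp only [Pi.add_apply, abs_mul]
    ring

theorem ladderInt_nonneg (hw : IsApproximating a b w) {u : ℝ[X]}
    (hu : ∀ t, 0 ≤ u.eval t) {x : ℝ} (hx : x ∈ openInterval a b) :
    0 ≤ ladderInt (openInterval a b) w u x := by
  refine integral_nonneg_of_ae ?_
  have hm := measurableSet_openInterval a b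
  filter_upwards [ae_dslope_eq (openInterval a b) (deriv (extField w)) x, ae_restrict_mem hm]
    with t h1 ht
  have h2 : 0 ≤ (deriv (extField w) t - deriv (extField w) x) / (t - x) := by
    rcases le_total x t with h | h
    · exact div_nonneg (sub_nonneg.2 (hw.monotoneOn_deriv_extField hx ht h)) (sub_nonneg.2 h)
    · exact div_nonneg_of_nonpos (sub_nonpos.2 (hw.monotoneOn_deriv_extField ht hx h))
        (sub_nonpos.2 h)
  simp only [Pi.zero_apply]
  rw [h1]
  exact mul_nonneg (mul_nonneg (hu t) (hw.pos t ht).le) h2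

/-- The Christoffel-Darboux kernel `(P(t) R(x) - R(t) P(x)) / (t - x)`, as a polynomial in `t`, of
two consecutive monic orthogonal polynomials `P` and `R`. -/
theorem exists_kernel (hw : IsApproximating a b w) (hab : a < b) (m : ℕ) {x : ℝ} :
    let P := monicOrtho (openInterval a b) w (m + 1)
    let R := monicOrtho (openInterval a b) w m
    R.eval x ≠ 0 →
    ∃ k : ℝ[X], k.degree < (m + 1 : ℕ) ∧
      (X - C x) * k = C (R.eval x) * P - C (P.eval x) * R ∧
      ∀ q : ℝ[X], q.degree < (m + 1 : ℕ) →
        weightedInner (openInterval a b) w q k =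
          weightedInner (openInterval a b) w R R * q.eval x := by
  intro P R hRx
  set I := weightedInner (openInterval a b) w with hI
  have hPd : P.natDegree = m + 1 := natDegree_monicOrtho _ _ _
  have hRd : R.natDegree = m := natDegree_monicOrtho _ _ _
  set f := C (R.eval x) * P - C (P.eval x) * R with hf
  have hfx : f.IsRoot x := by simp [hf, IsRoot]; ring
  set k := f /ₘ (X - C x) with hk
  have hkf : (X - C x) * k = f := mul_divByMonic_eq_iff_isRoot.2 hfx
  have hfd : f.natDegree ≤ m + 1 := by
    refine (natDegree_sub_le _ _).trans (max_le ?_ ?_)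
    · exact (natDegree_C_mul_le _ _).trans hPd.le
    · exact (natDegree_C_mul_le _ _).trans (by omega)
  have hkd : k.natDegree ≤ m := by
    rw [hk, natDegree_divByMonic _ (monic_X_sub_C x), natDegree_X_sub_C]
    omega
  have hkc : k.coeff m = R.eval x := by
    have h1 : f.coeff (m + 1) = R.eval x := by
      have hP1 : P.coeff (m + 1) = 1 := by
        rw [← hPd]; exact (monicOrtho_monic _ _ _).coeff_natDegree
      have hR1 : R.coeff (m + 1) = 0 := coeff_eq_zero_of_natDegree_lt (by omega)
      rw [hf, coeff_sub, coeff_C_mul, coeff_C_mul, hP1, hR1]; ring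
    rw [← hkf, sub_mul, coeff_sub, coeff_X_mul, coeff_C_mul,
      coeff_eq_zero_of_natDegree_lt (by omega : k.natDegree < m + 1)] at h1
    simpa using h1
  have hlt : ∀ {p : ℝ[X]}, p.natDegree ≤ m → p.degree < (m + 1 : ℕ) := fun hp =>
    lt_of_le_of_lt degree_le_natDegree (by exact_mod_cast Nat.lt_succ_of_le hp)
  -- orthogonality to the kernel reduces a polynomial to its value at `x`
  have hred : ∀ q : ℝ[X], q.degree < (m + 1 : ℕ) → I q k = q.eval x * I 1 k := by
    intro q hq
    set r := q /ₘ (X - C x) with hr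
    have hqr : q = C (q.eval x) * 1 + (X - C x) * r := by
      conv_lhs => rw [← modByMonic_add_div q (X - C x), modByMonic_X_sub_C_eq_C_eval]
      rw [mul_one]
    have hrd : r = 0 ∨ r.natDegree < m := by
      by_cases hr0 : r = 0
      · exact Or.inl hr0
      · right
        have hq0 : q ≠ 0 := by
          rintro rfl; simp [hr] at hr0
        have h1 : q.natDegree < m + 1 := by
          rw [degree_eq_natDegree hq0] at hq; exact_mod_cast hq
        have h2 : 0 < q.natDegree := by
          by_contra h0
          have h3 := eq_C_of_natDegree_eq_zero (Nat.eq_zero_of_not_pos h0)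
          apply hr0
          rw [hr, h3]
          exact (divByMonic_eq_zero_iff (monic_X_sub_C x)).2
            (lt_of_le_of_lt degree_C_le (by rw [degree_X_sub_C]; exact zero_lt_one))
        rw [hr, natDegree_divByMonic _ (monic_X_sub_C x), natDegree_X_sub_C]
        omega
    have hrlt : r.degree < m := by
      rcases hrd with h | h
      · rw [h, degree_zero]; exact WithBot.bot_lt_coe m
      · exact lt_of_le_of_lt degree_le_natDegree (by exact_mod_cast h)
    have h0 : I ((X - C x) * r) k = 0 := by
      have h1 : I ((X - C x) * r) k = I f r := by
        simp only [hI, weightedInner_eq]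
        rw [← hkf, mul_right_comm]
      have h2 : I P r = 0 :=
        hw.weightedInner_monicOrtho hab (hrlt.trans (by exact_mod_cast m.lt_succ_self))
      have h3 : I R r = 0 := hw.weightedInner_monicOrtho hab hrlt
      rw [h1, hf, hI, hw.weightedInner_sub_left, weightedInner_C_mul_left,
        weightedInner_C_mul_left]
      simp only [hI] at h2 h3
      rw [h2, h3]; ring
    conv_lhs => rw [hqr]
    simp only [hI] at h0 ⊢
    rw [hw.weightedInner_add_left, weightedInner_C_mul_left, h0, add_zero]
  have hone : I 1 k = I R R := by
    have h1 := hred R (hlt hRd.le)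
    have h2 : I R k = R.eval x * I R R := by
      set s := k - C (R.eval x) * R with hs
      have hsd : s.degree < m := by
        rw [degree_lt_iff_coeff_zero]
        intro i hi
        rcases eq_or_lt_of_le hi with h | h
        · have hR1 : R.coeff m = 1 := by
            conv_lhs => rw [← hRd]
            exact (monicOrtho_monic _ _ _).coeff_natDegree
          rw [← h, hs, coeff_sub, coeff_C_mul, hkc, hR1]; ring
        · rw [hs, coeff_sub, coeff_C_mul, coeff_eq_zero_of_natDegree_lt (by omega),
            coeff_eq_zero_of_natDegree_lt (by omega)]; ring
      have h3 : I R s = 0 := hw.weightedInner_monicOrtho hab hsd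
      have h4 : k = C (R.eval x) * R + s := by rw [hs]; ring
      simp only [hI] at h3 ⊢
      conv_lhs => rw [h4]
      rw [weightedInner_comm, hw.weightedInner_add_left, weightedInner_C_mul_left,
        weightedInner_comm _ _ s, h3, add_zero]
    rw [h2] at h1
    exact (mul_left_cancel₀ hRx h1).symm
  exact ⟨k, hlt hkd, hkf, fun q hq => by rw [hred q hq, hone, mul_comm]⟩

/-- The terms of the ladder relations which come from the kernel. -/
theorem integral_kernel_mul (hw : IsApproximating a b w) (hab : a < b) {x : ℝ}
    (hx : x ∈ openInterval a b) {P R k : ℝ[X]} {α β : ℝ}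
    (hk : (X - C x) * k = C α * P - C β * R) (g : ℝ[X]) :
    ∫ t in openInterval a b, (g * k).eval t * deriv (extField w) t * w t =
      α * ladderInt (openInterval a b) w (g * P) x - β * ladderInt (openInterval a b) w (g * R) x +
        deriv (extField w) x * weightedInner (openInterval a b) w g k := by
  set q := deriv (extField w) with hq
  have hi1 := (hw.integrableOn_ladder hab (g * P) hx).const_mul α
  have hi2 := (hw.integrableOn_ladder hab (g * R) hx).const_mul β
  have hi12 : IntegrableOn (fun t => α * ((g * P).eval t * w t * dslope q x t) -
      β * ((g * R).eval t * w t * dslope q x t)) (openInterval a b) := hi1.sub hi2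
  rw [weightedInner_eq, ladderInt, ladderInt, ← integral_const_mul, ← integral_const_mul,
    ← integral_const_mul, ← integral_sub hi1 hi2,
    ← integral_add hi12 ((hw.integrableOn_eval_mul _).const_mul _)]
  have hne : ∀ᵐ t ∂(volume.restrict (openInterval a b)), t ≠ x := by
    have h : ∀ᵐ t ∂(volume : Measure ℝ), t ≠ x := by simp [ae_iff]
    exact ae_restrict_of_ae h
  refine integral_congr_ae ?_
  filter_upwards [ae_dslope_eq (openInterval a b) q x, hne] with t h1 h2
  have h3 := congrArg (eval t) hk
  simp only [eval_mul, eval_sub, eval_X, eval_C] at h3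
  have h4 : t - x ≠ 0 := sub_ne_zero.2 h2
  rw [h1]
  simp only [eval_mul]
  field_simp
  linear_combination g.eval t * w t * (q t - q x) * h3

/-- The lowering relation for consecutive monic orthogonal polynomials. -/
theorem ladder_lower (hw : IsApproximating a b w) (hab : a < b) (m : ℕ) {x : ℝ}
    (hx : x ∈ openInterval a b) :
    let P := monicOrtho (openInterval a b) w (m + 1)
    let R := monicOrtho (openInterval a b) w m
    R.eval x ≠ 0 →
    weightedInner (openInterval a b) w R R * (derivative P).eval x =
      R.eval x * ladderInt (openInterval a b) w (P * P) x -
        P.eval x * ladderInt (openInterval a b) w (P * R) x := by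
  intro P R hRx
  obtain ⟨k, hkd, hk', hrep'⟩ := hw.exists_kernel hab m hRx
  have hk : (X - C x) * k = C (R.eval x) * P - C (P.eval x) * R := hk'
  have hrep : ∀ q : ℝ[X], q.degree < (m + 1 : ℕ) → weightedInner (openInterval a b) w q k =
    weightedInner (openInterval a b) w R R * q.eval x := hrep'
  have hP : P.degree = (m + 1 : ℕ) := degree_monicOrtho _ _ _
  have h1 : weightedInner (openInterval a b) w P (derivative k) = 0 :=
    hw.weightedInner_monicOrtho hab (lt_of_le_of_lt (degree_derivative_le) hkd)
  have h2 : weightedInner (openInterval a b) w P k = 0 := hw.weightedInner_monicOrtho hab hkd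
  have h3 := hrep (derivative P) (by
    rw [← hP]; exact degree_derivative_lt (monicOrtho_monic _ _ _).ne_zero)
  have h4 := hw.integral_eval_mul_deriv_mul hab (P * k)
  have h5 := hw.weightedInner_add_left (derivative P * k) (P * derivative k) 1
  simp only [weightedInner_eq _ _ _ (1 : ℝ[X]), weightedInner_eq _ _ (derivative P),
    weightedInner_eq _ _ P (derivative k), mul_one] at h1 h3 h5
  rw [derivative_mul, h5, h1, h3, hw.integral_kernel_mul hab hx hk, h2] at h4
  linarith

/-- The raising relation for consecutive monic orthogonal polynomials. -/
theorem ladder_raise (hw : IsApproximating a b w) (hab : a < b) (m : ℕ) {x : ℝ}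
    (hx : x ∈ openInterval a b) :
    let P := monicOrtho (openInterval a b) w (m + 1)
    let R := monicOrtho (openInterval a b) w m
    R.eval x ≠ 0 →
    weightedInner (openInterval a b) w R R * (derivative R).eval x =
      R.eval x * ladderInt (openInterval a b) w (P * R) x -
        P.eval x * ladderInt (openInterval a b) w (R * R) x +
        deriv (extField w) x * (weightedInner (openInterval a b) w R R * R.eval x) := by
  intro P R hRx
  obtain ⟨k, hkd, hk', hrep'⟩ := hw.exists_kernel hab m hRx
  have hk : (X - C x) * k = C (R.eval x) * P - C (P.eval x) * R := hk'
  have hrep : ∀ q : ℝ[X], q.degree < (m + 1 : ℕ) → weightedInner (openInterval a b) w q k =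
    weightedInner (openInterval a b) w R R * q.eval x := hrep'
  have hR : R.degree = m := degree_monicOrtho _ _ _
  have hlt : (m : WithBot ℕ) < (m + 1 : ℕ) := by exact_mod_cast m.lt_succ_self
  have hkd' : (derivative k).degree < m := by
    by_cases hk0 : k.natDegree = 0
    · rw [derivative_of_natDegree_zero hk0, degree_zero]; exact WithBot.bot_lt_coe m
    · have h0 : k ≠ 0 := by rintro rfl; simp at hk0
      have h1 := degree_derivative_lt h0
      have h2 : k.degree ≤ m := Order.lt_succ_iff.1 (by exact_mod_cast hkd)
      exact h1.trans_le h2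
  have h1 : weightedInner (openInterval a b) w R (derivative k) = 0 :=
    hw.weightedInner_monicOrtho hab hkd'
  have h2 := hrep R (by rw [hR]; exact hlt)
  have h3 := hrep (derivative R) (lt_of_le_of_lt degree_derivative_le (by rw [hR]; exact hlt))
  have h4 := hw.integral_eval_mul_deriv_mul hab (R * k)
  have h5 := hw.weightedInner_add_left (derivative R * k) (R * derivative k) 1
  simp only [weightedInner_eq _ _ _ (1 : ℝ[X]), weightedInner_eq _ _ (derivative R),
    weightedInner_eq _ _ R (derivative k), mul_one] at h1 h3 h5
  rw [derivative_mul, h5, h1, h3, hw.integral_kernel_mul hab hx hk, h2, mul_comm R P] at h4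
  linarith

/-- Consecutive orthogonal polynomials have no common zero. -/
theorem eval_monicOrtho_ne_zero (hw : IsApproximating a b w) (hab : a < b) (m : ℕ) {x : ℝ}
    (hP : (monicOrtho (openInterval a b) w (m + 1)).eval x = 0) :
    (monicOrtho (openInterval a b) w m).eval x ≠ 0 := by
  set P := monicOrtho (openInterval a b) w (m + 1) with hPdef
  set R := monicOrtho (openInterval a b) w m with hRdef
  intro hR
  have hPd : P.natDegree = m + 1 := natDegree_monicOrtho _ _ _
  have hRd : R.natDegree = m := natDegree_monicOrtho _ _ _
  set r := P /ₘ (X - C x) with hr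
  set s := R /ₘ (X - C x) with hs
  have hr1 : (X - C x) * r = P := mul_divByMonic_eq_iff_isRoot.2 hP
  have hs1 : (X - C x) * s = R := mul_divByMonic_eq_iff_isRoot.2 hR
  have hrd : r.natDegree = m := by
    rw [hr, natDegree_divByMonic _ (monic_X_sub_C x), natDegree_X_sub_C, hPd]; omega
  have hrm : r.Monic := by
    have := monicOrtho_monic (openInterval a b) w (m + 1)
    rw [← hPdef, ← hr1] at this
    exact (monic_X_sub_C x).of_mul_monic_left this
  have hs0 : s ≠ 0 := by
    intro h0
    rw [h0, mul_zero] at hs1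
    exact (monicOrtho_monic (openInterval a b) w m).ne_zero hs1.symm
  have hsd : s.natDegree < m + 1 := by
    rw [hs, natDegree_divByMonic _ (monic_X_sub_C x), natDegree_X_sub_C, hRd]; omega
  have h1 : weightedInner (openInterval a b) w P s = 0 :=
    hw.weightedInner_monicOrtho hab (by
      rw [degree_eq_natDegree hs0]; exact_mod_cast hsd)
  have h2 : weightedInner (openInterval a b) w P s = weightedInner (openInterval a b) w R r := by
    simp only [weightedInner_eq]
    rw [← hr1, ← hs1, mul_right_comm]
  have h3 : weightedInner (openInterval a b) w R (r - R) = 0 := by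
    refine hw.weightedInner_monicOrtho hab ?_
    have := degree_sub_lt_left (p := r) (q := R)
      (by rw [degree_eq_natDegree hrm.ne_zero, hrd, degree_monicOrtho]) hrm.ne_zero
      (by rw [hrm.leadingCoeff, (monicOrtho_monic _ w m).leadingCoeff])
    rwa [degree_eq_natDegree hrm.ne_zero, hrd] at this
  have h4 := hw.weightedInner_self_pos hab (monicOrtho_monic (openInterval a b) w m).ne_zero
  rw [weightedInner_comm, hw.weightedInner_sub_left, weightedInner_comm _ _ r, ← h2, h1] at h3
  linarith

end IsApproximating

/-! ### Fejér constants of the zeros of the orthogonal polynomials -/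

/-- At a zero of `P`, a lowering and a raising relation between `P` and `R` combine to a second
order relation for `P`. Nothing is assumed on the regularity of the coefficient `B`: its limit at
`x₀` exists because `P` has a simple zero there, and it has to be `B x₀`, since `D ≥ 0` while `P`
changes sign. -/
theorem eval_derivative_derivative_of_ladder {P R : ℝ[X]} {A B D q : ℝ → ℝ} {h A' x₀ : ℝ}
    (hh : h ≠ 0) (hA : HasDerivAt A A' x₀) (hA0 : A x₀ ≠ 0) (hq : ContinuousAt q x₀)
    (hD : ∀ᶠ x in 𝓝 x₀, 0 ≤ D x) (hP : P.eval x₀ = 0) (hR : R.eval x₀ ≠ 0)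
    (hlow : ∀ᶠ x in 𝓝 x₀, h * (derivative P).eval x = R.eval x * A x - P.eval x * B x)
    (hraise : ∀ᶠ x in 𝓝 x₀, h * (derivative R).eval x =
      R.eval x * B x - P.eval x * D x + q x * (h * R.eval x)) :
    (derivative P).eval x₀ ≠ 0 ∧
      (derivative (derivative P)).eval x₀ = (A' / A x₀ + q x₀) * (derivative P).eval x₀ := by
  set c := (derivative P).eval x₀ with hc
  have hlow0 : h * c = R.eval x₀ * A x₀ := by
    have := hlow.self_of_nhds
    rwa [hP, zero_mul, sub_zero] at this
  have hraise0 := hraise.self_of_nhds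
  rw [hP, zero_mul, sub_zero] at hraise0
  have hc0 : c ≠ 0 := fun h0 => mul_ne_zero hR hA0 (by rw [← hlow0, h0, mul_zero])
  refine ⟨hc0, ?_⟩
  set F' := (derivative R).eval x₀ * A x₀ + R.eval x₀ * A' -
    h * (derivative (derivative P)).eval x₀ with hF'
  have hF : HasDerivAt (fun x => R.eval x * A x - h * (derivative P).eval x) F' x₀ :=
    ((R.hasDerivAt x₀).mul hA).sub (((derivative P).hasDerivAt x₀).const_mul h)
  have hPs := hasDerivAt_iff_tendsto_slope.1 (P.hasDerivAt x₀)
  -- the lowering relation exhibits `B` as the quotient of two functions with a zero at `x₀`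
  have hB : Tendsto B (𝓝[≠] x₀) (𝓝 (F' / c)) := by
    refine ((hasDerivAt_iff_tendsto_slope.1 hF).div hPs hc0).congr' ?_
    filter_upwards [hPs.eventually_ne hc0, hlow.filter_mono nhdsWithin_le_nhds,
      self_mem_nhdsWithin] with x h1 h2 h3
    have h3' : x - x₀ ≠ 0 := sub_ne_zero.2 h3
    rw [slope_def_field, hP, sub_zero] at h1
    have h4 : P.eval x ≠ 0 := fun h0 => h1 (by rw [h0, zero_div])
    rw [Pi.div_apply, slope_def_field, slope_def_field, hP, ← hc, hlow0, h2]
    field_simp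
    ring
  -- `M` is the limit of `P D`, which is `0` because it has both signs
  set M := R.eval x₀ * (F' / c) + q x₀ * (h * R.eval x₀) - h * (derivative R).eval x₀ with hM
  have hG : Tendsto (fun x => P.eval x * D x * c) (𝓝[≠] x₀) (𝓝 (M * c)) := by
    have hle : 𝓝[≠] x₀ ≤ 𝓝 x₀ := nhdsWithin_le_nhds
    have h1 := (R.continuous.tendsto x₀).mono_left hle
    have h2 := ((derivative R).continuous.tendsto x₀).mono_left hle
    have h3 : Tendsto q (𝓝[≠] x₀) (𝓝 (q x₀)) := hq.tendsto.mono_left hle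
    have h4 := ((h1.mul hB).add (h3.mul (h1.const_mul h))).sub (h2.const_mul h)
    refine (h4.mul_const c).congr' ?_
    filter_upwards [hraise.filter_mono hle] with x hx
    rw [hx]; ring
  have hsign : ∀ᶠ x in 𝓝[≠] x₀, 0 < slope (fun x => P.eval x) x₀ x * c := by
    have h1 := hPs.mul_const c
    exact h1.eventually (lt_mem_nhds (by rw [← hc]; exact mul_self_pos.2 hc0))
  have hM0 : M * c = 0 := by
    have hgt : 𝓝[>] x₀ ≤ 𝓝[≠] x₀ := nhdsWithin_mono _ fun x hx => ne_of_gt hx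
    have hlt : 𝓝[<] x₀ ≤ 𝓝[≠] x₀ := nhdsWithin_mono _ fun x hx => ne_of_lt hx
    apply le_antisymm
    · refine le_of_tendsto (hG.mono_left hlt) ?_
      filter_upwards [hlt hsign, hD.filter_mono nhdsWithin_le_nhds, self_mem_nhdsWithin]
        with x h1 h2 h3
      have h3' : x - x₀ < 0 := sub_neg.2 h3
      rw [slope_def_field, hP, sub_zero] at h1
      have h4 : P.eval x * c = P.eval x / (x - x₀) * c * (x - x₀) := by
        field_simp [h3'.ne]
      have h5 : P.eval x * c ≤ 0 := by
        rw [h4]; exact mul_nonpos_of_nonneg_of_nonpos h1.le h3'.le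
      nlinarith [mul_nonpos_of_nonpos_of_nonneg h5 h2]
    · refine ge_of_tendsto (hG.mono_left hgt) ?_
      filter_upwards [hgt hsign, hD.filter_mono nhdsWithin_le_nhds, self_mem_nhdsWithin]
        with x h1 h2 h3
      have h3' : 0 < x - x₀ := sub_pos.2 h3
      rw [slope_def_field, hP, sub_zero] at h1
      have h4 : P.eval x * c = P.eval x / (x - x₀) * c * (x - x₀) := by
        field_simp [h3'.ne']
      have h5 : 0 ≤ P.eval x * c := by
        rw [h4]; exact mul_nonneg h1.le h3'.le
      nlinarith [mul_nonneg h5 h2]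
  have hM1 : M = 0 := (mul_eq_zero.1 hM0).resolve_right hc0
  have hL : F' = c * B x₀ := by
    have h1 : R.eval x₀ * (F' / c - B x₀) = 0 := by
      rw [hM, hraise0] at hM1; linarith
    have h2 := sub_eq_zero.1 ((mul_eq_zero.1 h1).resolve_left hR)
    rw [← h2]; field_simp
  have h3 : R.eval x₀ = h * c / A x₀ := by rw [hlow0]; field_simp
  have h4 : h * (h * (derivative (derivative P)).eval x₀) =
      h * (h * ((A' / A x₀ + q x₀) * c)) := by
    have h5 : h * (derivative (derivative P)).eval x₀ =
        (derivative R).eval x₀ * A x₀ + R.eval x₀ * A' - c * B x₀ := by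
      rw [hF'] at hL; linarith
    rw [h5, mul_sub, mul_add, ← mul_assoc, hraise0, h3]
    field_simp
    ring
  exact mul_left_cancel₀ hh (mul_left_cancel₀ hh h4)

theorem nodal_eq_of_monic {n : ℕ} {x : Fin n → ℝ} (hx : Function.Injective x) {p : ℝ[X]}
    (hp : p.Monic) (hpn : p.natDegree = n) (h0 : ∀ k, p.eval (x k) = 0) :
    Lagrange.nodal Finset.univ x = p := by
  have hN : (Lagrange.nodal Finset.univ x).Monic := Lagrange.nodal_monic
  have hd : (Lagrange.nodal Finset.univ x).degree = n := by simp [Lagrange.degree_nodal]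
  refine eq_of_degree_sub_lt_of_eval_index_eq Finset.univ (v := x) hx.injOn ?_ fun k _ => ?_
  · rw [Finset.card_univ, Fintype.card_fin, ← hd]
    refine degree_sub_lt_left ?_ hN.ne_zero (by rw [hN.leadingCoeff, hp.leadingCoeff])
    rw [hd, degree_eq_natDegree hp.ne_zero, hpn]
  · rw [h0, Lagrange.eval_nodal_at_node (Finset.mem_univ k)]

namespace IsApproximating

variable {a b : EReal} {w : ℝ → ℝ}

theorem leadingCoeff_orthoPoly_pos (hw : IsApproximating a b w) (hab : a < b) (n : ℕ) :
    0 < (orthoPoly (openInterval a b) w n).leadingCoeff := by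
  rw [orthoPoly, leadingCoeff_mul, leadingCoeff_C, (monicOrtho_monic _ _ _).leadingCoeff, mul_one]
  have := hw.weightedInner_self_pos hab (monicOrtho_monic (openInterval a b) w n).ne_zero
  positivity

theorem rhoConst_pos (hw : IsApproximating a b w) (hab : a < b) (n : ℕ) :
    0 < rhoConst (openInterval a b) w n :=
  div_pos (hw.leadingCoeff_orthoPoly_pos hab _) (hw.leadingCoeff_orthoPoly_pos hab _)

theorem eval_orthoPoly_eq_zero_iff (hw : IsApproximating a b w) (hab : a < b) (n : ℕ) (t : ℝ) :
    (orthoPoly (openInterval a b) w n).eval t = 0 ↔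
      (monicOrtho (openInterval a b) w n).eval t = 0 := by
  have := hw.weightedInner_self_pos hab (monicOrtho_monic (openInterval a b) w n).ne_zero
  rw [orthoPoly, eval_mul, eval_C, mul_eq_zero, or_iff_right (by positivity)]

theorem exists_funA_eq (hw : IsApproximating a b w) (hab : a < b) (n : ℕ) :
    ∃ κ : ℝ, κ ≠ 0 ∧ ∀ t, funA (openInterval a b) w n t =
      κ * ladderInt (openInterval a b) w
        (monicOrtho (openInterval a b) w n * monicOrtho (openInterval a b) w n) t := by
  have hpos := hw.weightedInner_self_pos hab (monicOrtho_monic (openInterval a b) w n).ne_zero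
  refine ⟨rhoConst (openInterval a b) w n * (1 / Real.sqrt (weightedInner (openInterval a b) w
    (monicOrtho (openInterval a b) w n) (monicOrtho (openInterval a b) w n))) ^ 2,
    mul_ne_zero (hw.rhoConst_pos hab n).ne' (by positivity), fun t => ?_⟩
  rw [funA, ladderInt, mul_assoc]
  congr 1
  rw [← integral_const_mul]
  refine integral_congr_ae ?_
  filter_upwards [ae_dslope_eq (openInterval a b) (deriv (extField w)) t] with s hs
  rw [hs, orthoPoly]
  simp only [eval_mul, eval_C]
  ring

/-- The second order equation of the orthogonal polynomials at their zeros. -/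
theorem eval_derivative_derivative_monicOrtho (hw : IsApproximating a b w) (hab : a < b) {n : ℕ}
    (hn : n ≠ 0) (hW : IsApproximating a b (modWeight (openInterval a b) w n)) {x₀ : ℝ}
    (hx : x₀ ∈ openInterval a b) (h0 : (monicOrtho (openInterval a b) w n).eval x₀ = 0) :
    (derivative (derivative (monicOrtho (openInterval a b) w n))).eval x₀
        / (derivative (monicOrtho (openInterval a b) w n)).eval x₀
      + deriv (modWeight (openInterval a b) w n) x₀ / modWeight (openInterval a b) w n x₀ = 0 := by
  obtain ⟨m, rfl⟩ := Nat.exists_eq_succ_of_ne_zero hn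
  have hn1 : m.succ = m + 1 := rfl
  rw [hn1] at h0 hW ⊢
  set S := openInterval a b with hS
  set W := modWeight S w (m + 1) with hWdef
  have hnhds : ∀ᶠ t in 𝓝 x₀, t ∈ S := (isOpen_openInterval a b).mem_nhds hx
  obtain ⟨κ, hκ, hfun⟩ := hw.exists_funA_eq hab (m + 1)
  have hρ : 0 < rhoConst S w (m + 1) := hw.rhoConst_pos hab (m + 1)
  set A := ladderInt S w (monicOrtho S w (m + 1) * monicOrtho S w (m + 1)) with hA
  set c := rhoConst S w (m + 1) / κ with hcdef
  have hc : c ≠ 0 := div_ne_zero hρ.ne' hκ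
  have hAeq : ∀ t ∈ S, A t = c * w t / W t := by
    intro t ht
    -- by the convention `u / 0 = 0`, a zero of `A` would be a zero of `W`
    have h1 : W t ≠ 0 := (hW.pos t ht).ne'
    have h2 : W t = w t * rhoConst S w (m + 1) / (κ * A t) := by
      rw [hWdef, modWeight, hfun]
    have h3 : A t ≠ 0 := by
      intro h3
      rw [h3, mul_zero, div_zero] at h2
      exact h1 h2
    have h4 := (hw.pos t ht).ne'
    rw [h2, hcdef]
    field_simp [hρ.ne']
  have hw0 := (hw.pos x₀ hx).ne'
  have hW0 := (hW.pos x₀ hx).ne'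
  have hdw := (hw.differentiable.differentiableAt hnhds).hasDerivAt
  have hdW := (hW.differentiable.differentiableAt hnhds).hasDerivAt
  have hdA := ((hdw.const_mul c).div hdW hW0).congr_of_eventuallyEq (f₁ := A)
    (hnhds.mono fun t ht => hAeq t ht)
  have hA0 : A x₀ ≠ 0 := by
    rw [hAeq x₀ hx]; exact div_ne_zero (mul_ne_zero hc hw0) hW0
  have hR := hw.eval_monicOrtho_ne_zero hab m h0
  have hRev : ∀ᶠ t in 𝓝 x₀, (monicOrtho S w m).eval t ≠ 0 :=
    (monicOrtho S w m).continuous.continuousAt.eventually_ne hR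
  have hh := hw.weightedInner_self_pos hab (monicOrtho_monic S w m).ne_zero
  obtain ⟨h1, h2⟩ := eval_derivative_derivative_of_ladder
    (B := ladderInt S w (monicOrtho S w (m + 1) * monicOrtho S w m))
    (D := ladderInt S w (monicOrtho S w m * monicOrtho S w m)) (q := deriv (extField w))
    hh.ne' hdA hA0 (hw.continuousOn_deriv_extField.continuousAt hnhds)
    (hnhds.mono fun t ht => hw.ladderInt_nonneg
      (fun s => by rw [eval_mul]; exact mul_self_nonneg _) ht)
    h0 hR
    ((hnhds.and hRev).mono fun t ht => hw.ladder_lower hab m ht.1 ht.2)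
    ((hnhds.and hRev).mono fun t ht => hw.ladder_raise hab m ht.1 ht.2)
  rw [h2, mul_div_cancel_right₀ _ h1, hAeq x₀ hx, hw.deriv_extField hx]
  field_simp
  ring

theorem fejerConst_eq_zero_of_eval_monicOrtho (hw : IsApproximating a b w) (hab : a < b) {n : ℕ}
    (hn : n ≠ 0) (hW : IsApproximating a b (modWeight (openInterval a b) w n)) {x : Fin n → ℝ}
    (hx : Function.Injective x) (hxS : ∀ k, x k ∈ openInterval a b)
    (h0 : ∀ k, (monicOrtho (openInterval a b) w n).eval (x k) = 0) (k : Fin n) :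
    fejerConst (modWeight (openInterval a b) w n) x k = 0 := by
  rw [fejerConst, nodal_eq_of_monic hx (monicOrtho_monic _ _ _) (natDegree_monicOrtho _ _ _) h0]
  exact hw.eval_derivative_derivative_monicOrtho hab hn hW (hxS k) (h0 k)

/-- The zeros of the orthogonal polynomial form a Fekete set, and the Fekete set is unique. -/
theorem fejerConst_eq_zero_iff_eval_orthoPoly (hw : IsApproximating a b w) (hab : a < b) {n : ℕ}
    (hn : 2 ≤ n) (hW : IsApproximating a b (modWeight (openInterval a b) w n))
    (hder : HasNonnegDeriv (2 * n) (fun t => 1 / modWeight (openInterval a b) w n t)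
      (openInterval a b))
    {x : Fin n → ℝ} (hx : Function.Injective x) (hxS : ∀ k, x k ∈ openInterval a b) :
    (∀ k, fejerConst (modWeight (openInterval a b) w n) x k = 0) ↔
      ∀ k, (orthoPoly (openInterval a b) w n).eval (x k) = 0 := by
  simp only [hw.eval_orthoPoly_eq_zero_iff hab]
  refine ⟨fun h k => ?_, hw.fejerConst_eq_zero_of_eval_monicOrtho hab (by omega) hW hx hxS⟩
  obtain ⟨z, hz, hzS, hz0⟩ := hw.exists_zeros_monicOrtho hab n
  have h1 := ((hW.tfae hab hn hz hzS hder).out 0 2).1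
    (hw.fejerConst_eq_zero_of_eval_monicOrtho hab (by omega) hW hz hzS hz0)
  have h2 := ((hW.tfae hab hn hx hxS hder).out 0 1).1 h
  have h3 : x k ∈ Set.range z := h1.2 x h2 ▸ Set.mem_range_self k
  obtain ⟨i, hi⟩ := h3
  rw [← hi]
  exact hz0 i

end IsApproximating

end FejerFekete

theorem mainTheorem4 (a b : EReal) (hab : a < b) (w : ℝ → ℝ)
    (hw : FejerFekete.IsApproximating a b w) (n : ℕ) (hn : 2 ≤ n)
    (x : Fin n → ℝ) (hx : Function.Injective x)
    (hxI : ∀ k, x k ∈ FejerFekete.openInterval a b) :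
    (FejerFekete.HasNonnegDeriv (2 * n) (fun t => 1 / w t) (FejerFekete.openInterval a b) →
      List.TFAE [
        ∀ k, FejerFekete.fejerConst w x k = 0,
        FejerFekete.IsFekete (FejerFekete.openInterval a b) n (FejerFekete.rootWeight n w) x,
        FejerFekete.IsUniqueFekete (FejerFekete.openInterval a b) n
          (FejerFekete.rootWeight n w) x,
        FejerFekete.IsStableMostEconomical (FejerFekete.openInterval a b) w x
          (FejerFekete.gruenwaldSystem x),
        FejerFekete.IsOneNormal (FejerFekete.openInterval a b) w x]) ∧
    (FejerFekete.IsApproximating a b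
        (FejerFekete.modWeight (FejerFekete.openInterval a b) w n) →
      FejerFekete.HasNonnegDeriv (2 * n)
        (fun t => 1 / FejerFekete.modWeight (FejerFekete.openInterval a b) w n t)
        (FejerFekete.openInterval a b) →
      List.TFAE [
        ∀ k, FejerFekete.fejerConst
          (FejerFekete.modWeight (FejerFekete.openInterval a b) w n) x k = 0,
        FejerFekete.IsFekete (FejerFekete.openInterval a b) n
          (FejerFekete.rootWeight n
            (FejerFekete.modWeight (FejerFekete.openInterval a b) w n)) x,
        FejerFekete.IsUniqueFekete (FejerFekete.openInterval a b) n
          (FejerFekete.rootWeight n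
            (FejerFekete.modWeight (FejerFekete.openInterval a b) w n)) x,
        ∀ k, (FejerFekete.orthoPoly (FejerFekete.openInterval a b) w n).eval (x k) = 0,
        FejerFekete.IsStableMostEconomical (FejerFekete.openInterval a b)
          (FejerFekete.modWeight (FejerFekete.openInterval a b) w n) x
          (FejerFekete.gruenwaldSystem x),
        FejerFekete.IsOneNormal (FejerFekete.openInterval a b)
          (FejerFekete.modWeight (FejerFekete.openInterval a b) w n) x]) := by
  refine ⟨hw.tfae hab hn hx hxI, fun hW hder => ?_⟩
  have h := hW.tfae hab hn hx hxI hder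
  tfae_have 1 ↔ 2 := h.out 0 1
  tfae_have 1 ↔ 3 := h.out 0 2
  tfae_have 1 ↔ 4 := hw.fejerConst_eq_zero_iff_eval_orthoPoly hab hn hW hder hx hxI
  tfae_have 1 ↔ 5 := h.out 0 3
  tfae_have 1 ↔ 6 := h.out 0 4
  tfae_finish
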